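/- **Definitions.** All graphs are finite and simple (in particular loopless). The *bull* is the graph on $\{0,1,2,3,4\}$ with edges $01,02,12,03,14$ (a triangle with two disjoint pendant edges); the *chair* is the graph on $\{0,1,2,3,4\}$ with edges $01,02,03,34$ (a claw with one edge subdivided). A graph is $(\mathrm{bull},\mathrm{chair})$-free if neither the bull nor the chair is isomorphic to an induced subgraph of it. An $H$-coloring of a graph $F$ is a map $c:V(F)\to V(H)$ with $c(u)c(v)\in E(H)$ for every $uv\in E(F)$. For a fixed graph $H$, the input of *Max Partial $H$-Coloring* is a graph $G$ with a revenue function $\mathsf{rev}:V(G)\times V(H)\to\mathbb{Q}_{\ge 0}$; the task is to find a set $X\subseteq V(G)$ and an $H$-coloring $c$ of $G[X]$ for which $\sum_{v\in X}\mathsf{rev}(v,c(v))$ is maximum possible. Running times are measured on a unit-cost random access machine with natural-number registers and arrays (addition, truncated subtraction, comparison, indirect addressing, no multiplication), with rational registers and arrays for the revenues (addition, subtraction and comparison in constant time), and with structured programs that may use recursive parameterless procedures. The input is given by $n=|V(G)|$, the adjacency matrix of $G$ and the table of $\mathsf{rev}$; the output is an array that tells for each vertex whether it is in $X$ and, if so,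 its color. **Theorem.** There is an absolute constant $\tau$ such that for every graph $H$ there are a program $P$ and a constant $C$ (both depending only on $H$) with the following property. For every $(\mathrm{bull},\mathrm{chair})$-free graph $G$ with $n$ vertices and clique number $\omega$, and every revenue function $\mathsf{rev}:V(G)\times V(H)\to\mathbb{Q}_{\ge 0}$, the program $P$, started on $(G,\mathsf{rev})$, halts and outputs an optimum solution $(X,c)$ of Max Partial $H$-Coloring on $(G,\mathsf{rev})$, within $n^{\tau\,|V(H)|\,\omega}$ steps if $n\ge 2$, and within $C$ steps if $n\le 1$. In other words, for every simple graph $H$, Max Partial $H$-Coloring on $(\mathrm{bull},\mathrm{chair})$-free instances with $n$ vertices and clique number $\omega$ can be solved in time $n^{\mathcal{O}(|V(H)|\,\omega)}$. -/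

import Mathlib

namespace HColoring

/-! ## The two forbidden induced subgraphs -/

/-- The bull: the triangle `0 1 2` with pendant edges `0 3` and `1 4`. -/
def bull : SimpleGraph (Fin 5) :=
  SimpleGraph.fromEdgeSet {s(0, 1), s(0, 2), s(1, 2), s(0, 3), s(1, 4)}

/-- The chair: the claw with centre `0` and leaves `1`, `2`, `3`, whose edge `0 3` is prolonged
by the edge `3 4`. -/
def chair : SimpleGraph (Fin 5) :=
  SimpleGraph.fromEdgeSet {s(0, 1), s(0, 2), s(0, 3), s(3, 4)}

/-- `G` is `F`-free: `F` is not (isomorphic to) an induced subgraph of `G`. -/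
def InducedFree {V W : Type*} (F : SimpleGraph W) (G : SimpleGraph V) : Prop :=
  ¬ F.IsIndContained G

/-! ## The optimisation problem -/

/-- A feasible solution of Max Partial `H`-Coloring on `G`: a set `X` of vertices together with
an `H`-coloring (a graph homomorphism to `H`) of the induced subgraph `G[X]`. -/
structure Solution {V W : Type*} (G : SimpleGraph V) (H : SimpleGraph W) where
  X : Finset V
  c : G.induce (X : Set V) →g H

/-- The total revenue `∑ v ∈ X, rev (v, c v)` of a feasible solution. -/
def Solution.revenue {V W : Type*} {G : SimpleGraph V} {H : SimpleGraph W}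
    (S : Solution G H) (rev : V → W → NNRat) : NNRat :=
  ∑ v : S.X, rev v (S.c v)

/-- `S` is an optimum solution of the instance `(G, rev)`. -/
def Solution.IsOptimum {V W : Type*} {G : SimpleGraph V} {H : SimpleGraph W}
    (S : Solution G H) (rev : V → W → NNRat) : Prop :=
  ∀ S' : Solution G H, S'.revenue rev ≤ S.revenue rev

/-! ## The machine model

A unit-cost random access machine, with programs in structured form.  It has registers and arrays
that hold natural numbers (with addition, truncated subtraction, comparison and indirect
addressing; no multiplication), and registers and arrays that hold rational numbers (with addition,
subtraction and comparison).  Register names and array names are literals of the program, so that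
a program uses finitely many of them; array indices are read from registers.  Every elementary operation,
every evaluation of a test, every procedure call and every bookkeeping step takes unit time. -/

/-- The memory of the machine. -/
structure Memory where
  /-- natural number registers -/
  reg : ℕ → ℕ
  /-- natural number arrays: `arr A i` is the entry with index `i` of array `A` -/
  arr : ℕ → ℕ → ℕ
  /-- rational registers -/
  qreg : ℕ → ℚ
  /-- rational arrays -/
  qarr : ℕ → ℕ → ℚ

/-- Elementary operations. -/
inductive Op where
  /-- `reg d := c` -/
  | const (d c : ℕ)
  /-- `reg d := reg a` -/
  | copy (d a : ℕ)
  /-- `reg d := reg a + reg b` -/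
  | add (d a b : ℕ)
  /-- `reg d := reg a - reg b` (truncated) -/
  | sub (d a b : ℕ)
  /-- `reg d := arr A (reg i)` -/
  | load (d A i : ℕ)
  /-- `arr A (reg i) := reg a` -/
  | store (A i a : ℕ)
  /-- `qreg d := c` -/
  | qconst (d : ℕ) (c : ℚ)
  /-- `qreg d := qreg a` -/
  | qcopy (d a : ℕ)
  /-- `qreg d := qreg a + qreg b` -/
  | qadd (d a b : ℕ)
  /-- `qreg d := qreg a - qreg b` -/
  | qsub (d a b : ℕ)
  /-- `qreg d := qarr A (reg i)` -/
  | qload (d A i : ℕ)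
  /-- `qarr A (reg i) := qreg a` -/
  | qstore (A i a : ℕ)

/-- The effect of an elementary operation on the memory. -/
def Op.apply : Op → Memory → Memory
  | .const d c, m => { m with reg := Function.update m.reg d c }
  | .copy d a, m => { m with reg := Function.update m.reg d (m.reg a) }
  | .add d a b, m => { m with reg := Function.update m.reg d (m.reg a + m.reg b) }
  | .sub d a b, m => { m with reg := Function.update m.reg d (m.reg a - m.reg b) }
  | .load d A i, m => { m with reg := Function.update m.reg d (m.arr A (m.reg i)) }
  | .store A i a, m =>
      { m with arr := Function.update m.arr A (Function.update (m.arr A) (m.reg i) (m.reg a)) }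
  | .qconst d c, m => { m with qreg := Function.update m.qreg d c }
  | .qcopy d a, m => { m with qreg := Function.update m.qreg d (m.qreg a) }
  | .qadd d a b, m => { m with qreg := Function.update m.qreg d (m.qreg a + m.qreg b) }
  | .qsub d a b, m => { m with qreg := Function.update m.qreg d (m.qreg a - m.qreg b) }
  | .qload d A i, m => { m with qreg := Function.update m.qreg d (m.qarr A (m.reg i)) }
  | .qstore A i a, m =>
      { m with qarr := Function.update m.qarr A (Function.update (m.qarr A) (m.reg i) (m.qreg a)) }

/-- Tests: comparison of two natural number registers or of two rational registers. -/
inductive Test where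
  | eq (a b : ℕ)
  | lt (a b : ℕ)
  | qlt (a b : ℕ)

/-- The outcome of a test. -/
def Test.eval : Test → Memory → Bool
  | .eq a b, m => decide (m.reg a = m.reg b)
  | .lt a b, m => decide (m.reg a < m.reg b)
  | .qlt a b, m => decide (m.qreg a < m.qreg b)

/-- Commands. -/
inductive Com where
  | skip
  | op (o : Op)
  | seq (c₁ c₂ : Com)
  | cond (b : Test) (c₁ c₂ : Com)
  /-- repeat `c` as long as the test `b` succeeds -/
  | loop (b : Test) (c : Com)
  /-- call the (parameterless, possibly recursive) procedure with number `p` -/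
  | call (p : ℕ)

/-- A program: a main command and a finite list of procedures. -/
structure Program where
  main : Com
  procs : List Com

/-- A configuration: the stack of commands that are still to be executed, and the memory. -/
abbrev Config := List Com × Memory

/-- One step of the machine.  A call of a procedure that does not exist does nothing. -/
def Program.step (P : Program) : Config → Config
  | ([], m) => ([], m)
  | (.skip :: K, m) => (K, m)
  | (.op o :: K, m) => (K, o.apply m)
  | (.seq c₁ c₂ :: K, m) => (c₁ :: c₂ :: K, m)
  | (.cond b c₁ c₂ :: K, m) => ((if b.eval m then c₁ else c₂) :: K, m)
  | (.loop b c :: K, m) => (if b.eval m then c :: .loop b c :: K else K, m)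
  | (.call p :: K, m) => (P.procs.getD p .skip :: K, m)

/-- Started on memory `m`, the program `P` halts within `t` steps, with final memory `m'`. -/
def Program.HaltsWithin (P : Program) (m : Memory) (t : ℕ) (m' : Memory) : Prop :=
  P.step^[t] ([P.main], m) = ([], m')

/-! ## Input and output conventions -/

open Classical in
/-- The initial memory for the instance `(G, rev)`: register `0` holds the number `n` of vertices,
array `0` holds the adjacency matrix of `G` row by row (entry `n * u + v` is `1` if `u` and `v` are
adjacent, and `0` otherwise), and rational array `0` holds the revenue function row by row (entry
`k * v + i` is `rev v i`).  Everything else is `0`. -/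
noncomputable def inputMemory {n k : ℕ} (G : SimpleGraph (Fin n)) (rev : Fin n → Fin k → NNRat) :
    Memory where
  reg r := if r = 0 then n else 0
  arr A i := if A = 0 ∧ ∃ u v : Fin n, G.Adj u v ∧ i = n * u + v then 1 else 0
  qreg _ := 0
  qarr A i := if A = 0 then ∑ v : Fin n, ∑ j : Fin k, if i = k * v + j then (rev v j : ℚ) else 0
    else 0

/-- The memory `m` holds the solution `S = (X, c)` in array `1`: for every vertex `v`, entry `v`
is `c v + 1` if `v ∈ X`, and `0` otherwise. -/
def Outputs {n k : ℕ} {G : SimpleGraph (Fin n)} {H : SimpleGraph (Fin k)}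
    (m : Memory) (S : Solution G H) : Prop :=
  ∀ v : Fin n, m.arr 1 v = if hv : v ∈ S.X then (S.c ⟨v, hv⟩ : ℕ) + 1 else 0

/-- Within `t` steps, the program `P` finds an optimum solution of the instance `(G, rev)` of
Max Partial `H`-Coloring. -/
def Program.SolvesWithin {n k : ℕ} (P : Program) (H : SimpleGraph (Fin k))
    (G : SimpleGraph (Fin n)) (rev : Fin n → Fin k → NNRat) (t : ℕ) : Prop :=
  ∃ (m' : Memory) (S : Solution G H),
    P.HaltsWithin (inputMemory G rev) t m' ∧ Outputs m' S ∧ S.IsOptimum rev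

end HColoring

/-! Relax the problem: every vertex receives a set of colors, sets at adjacent vertices must be
completely joined in `H`, and a set `S` at `v` earns the largest revenue of a color in `S`, or `0`
(`maxRev`). Picking a best color from every useful set turns this back into a partial `H`-coloring
of the same value. The relaxed problem behaves well under contraction. The outside sees a module
only through the union of the colors used in it, so the module can be replaced by one vertex that
earns, for `S`, the optimum of the module with colors from `S` (`IsBest.biUnion`,
`IsBlocks.contract`). The program contracts minimal modules with at least two vertices until at most
one vertex is left (`den_contract`, `den_solve`). Such a module induces a prime graph
(`IsMinMod.isPrimeGraph`), so two kinds of prime graphs have to be handled.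

Without a co-diamond (an edge plus two isolated vertices), guess for every color up to two vertices
that carry it. These witnesses determine the largest sets compatible with the guess, and the sets
are automatically compatible with each other: two bad colors on an edge would produce a co-diamond
(`isAssign_allowedSet`, `exists_witnesses`). There are at most `(n + 1) ^ (2 * k)` guesses.

With a co-diamond, a prime (bull, chair)-free graph has maximum degree at most two
(`degree_le_two`). Primality and the absence of chairs give an induced four-vertex path with a
vertex `z` that misses it (`exists_isP4_anti`). Take a maximal connected set `B` around such a path
that some vertex misses, and the distance levels of `B` from `z` through a vertex `y` that is mixed
on `B`. Induced four-vertex paths towards `z` force consecutive levels to be joined and far levels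
to be cliques (`IsLevel.adj_succ`, `IsLevel.adj_same`). Since `B` has no universal vertex
(`IsMaxAnti.not_universal`), there are at least four levels in `B`. Then outside vertices that are
mixed on `B` attach exactly to the first or to the last level, and primality shrinks every level,
the vertices attached to either end and the set of vertices missing `B` to at most one vertex each.
What remains is a path or a cycle, solved by a table indexed by the colors permitted at the two ends
of a growing segment (`IsSegTable.extend`, `den_path`).

This computes the optimum value. A solution is found by self-reduction: each revenue in turn is set
to `0` unless this lowers the optimum, and the positive entries that survive are an optimum solution
(`IsReduced.exists_assign`).

The algorithm is written in a small language with a verified compiler. Every constructor of the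
language multiplies the running time by at most `64 * (n + 2)`, so the time is bounded through the
nesting depth, which is linear in `k` (`Stmt.cost_le`, `Prog.height_main`). The clique number plays
no role beyond being at least one. -/

namespace HColoring

/-! ## Running commands -/

/-- Executing `c` from memory `m` takes at most `T` steps and ends in a memory that satisfies `Q`. -/
def Run (P : Program) (c : Com) (m : Memory) (T : ℕ) (Q : Memory → Prop) : Prop :=
  ∃ t ≤ T, ∃ m', (∀ K, P.step^[t] (c :: K, m) = (K, m')) ∧ Q m'

namespace Run

variable {P : Program} {c c₁ c₂ : Com} {m : Memory} {T T₁ T₂ : ℕ} {Q R : Memory → Prop}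

theorem mono (h : Run P c m T₁ Q) (hT : T₁ ≤ T₂) (hQ : ∀ m', Q m' → R m') : Run P c m T₂ R := by
  obtain ⟨t, ht, m', h₁, h₂⟩ := h
  exact ⟨t, ht.trans hT, m', h₁, hQ _ h₂⟩

theorem skip (h : Q m) : Run P .skip m 1 Q :=
  ⟨1, le_rfl, m, fun _ => rfl, h⟩

theorem op {o : Op} (h : Q (o.apply m)) : Run P (.op o) m 1 Q :=
  ⟨1, le_rfl, _, fun _ => rfl, h⟩

theorem seq (h₁ : Run P c₁ m T₁ R) (h₂ : ∀ m', R m' → Run P c₂ m' T₂ Q) :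
    Run P (.seq c₁ c₂) m (T₁ + T₂ + 1) Q := by
  obtain ⟨t₁, ht₁, m₁, e₁, r₁⟩ := h₁
  obtain ⟨t₂, ht₂, m₂, e₂, r₂⟩ := h₂ m₁ r₁
  refine ⟨t₂ + (t₁ + 1), by omega, m₂, fun K => ?_, r₂⟩
  rw [Function.iterate_add_apply, Function.iterate_succ_apply]
  simp only [Program.step]
  rw [e₁, e₂]

theorem cond {b : Test} (h₁ : b.eval m = true → Run P c₁ m T Q)
    (h₂ : b.eval m = false → Run P c₂ m T Q) : Run P (.cond b c₁ c₂) m (T + 1) Q := by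
  cases hb : b.eval m with
  | true =>
    obtain ⟨t, ht, m', e, q⟩ := h₁ hb
    refine ⟨t + 1, by omega, m', fun K => ?_, q⟩
    rw [Function.iterate_succ_apply]
    simp only [Program.step, hb, if_true]
    exact e K
  | false =>
    obtain ⟨t, ht, m', e, q⟩ := h₂ hb
    refine ⟨t + 1, by omega, m', fun K => ?_, q⟩
    rw [Function.iterate_succ_apply]
    simp only [Program.step, hb]
    exact e K

/-- For loops whose number `N` of rounds is known in advance: the invariant itself decides the test,
so induction on the remaining rounds gives termination and time bound together. -/
theorem loop {b : Test} {N : ℕ} (Inv : ℕ → Memory → Prop)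
    (hb : ∀ j m, Inv j m → b.eval m = decide (j < N))
    (hc : ∀ j m, j < N → Inv j m → Run P c m T (Inv (j + 1))) (h : Inv 0 m) :
    Run P (.loop b c) m (N * (T + 1) + 1) (Inv N) := by
  have key : ∀ d j m, j + d = N → Inv j m → Run P (.loop b c) m (d * (T + 1) + 1) (Inv N) := by
    intro d
    induction d with
    | zero =>
      intro j m hj hI
      refine ⟨1, by omega, m, fun K => ?_, by simpa [← hj] using hI⟩
      have := hb j m hI
      simp only [Function.iterate_one, Program.step, this]
      simp [show ¬ j < N by omega]
    | succ d ih =>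
      intro j m hj hI
      obtain ⟨t₁, ht₁, m₁, e₁, r₁⟩ := hc j m (by omega) hI
      obtain ⟨t₂, ht₂, m₂, e₂, r₂⟩ := ih (j + 1) m₁ (by omega) r₁
      refine ⟨t₂ + (t₁ + 1), by rw [Nat.succ_mul]; omega, m₂, fun K => ?_, r₂⟩
      rw [Function.iterate_add_apply, Function.iterate_succ_apply]
      have := hb j m hI
      simp only [Program.step, this, show j < N by omega, decide_true, if_true]
      rw [e₁, e₂]
  exact key N 0 m (by omega) h

end Run

/-! ## A small imperative language -/

/-- The memory as the language sees it: registers that hold loop variables, arrays of natural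
numbers, arrays of rational numbers. -/
structure Store where
  reg : ℕ → ℕ
  arr : ℕ → ℕ → ℕ
  qarr : ℕ → ℕ → ℚ

/-- Assignment to a register. -/
def Store.set (s : Store) (i v : ℕ) : Store := { s with reg := Function.update s.reg i v }

/-- Assignment to an entry of an array. -/
def Store.setA (s : Store) (A i v : ℕ) : Store :=
  { s with arr := Function.update s.arr A (Function.update (s.arr A) i v) }

/-- Assignment to an entry of a rational array. -/
def Store.setQ (s : Store) (A i : ℕ) (v : ℚ) : Store :=
  { s with qarr := Function.update s.qarr A (Function.update (s.qarr A) i v) }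

inductive Ty where
  | nat | bool | rat

/-- The values of a type. -/
abbrev Ty.Val : Ty → Type
  | .nat => ℕ
  | .bool => Bool
  | .rat => ℚ

/-- Expressions.  All quantifiers, sums and suprema range over `0, …, n`. -/
inductive Expr : Ty → Type where
  | const (c : ℕ) : Expr .nat
  | len : Expr .nat
  | reg (r : ℕ) : Expr .nat
  | arr (A : ℕ) (e : Expr .nat) : Expr .nat
  | add (e₁ e₂ : Expr .nat) : Expr .nat
  | find (i : ℕ) (b : Expr .bool) : Expr .nat
  | eq (e₁ e₂ : Expr .nat) : Expr .bool
  | lt (e₁ e₂ : Expr .nat) : Expr .bool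
  | qlt (e₁ e₂ : Expr .rat) : Expr .bool
  | and (b₁ b₂ : Expr .bool) : Expr .bool
  | not (b : Expr .bool) : Expr .bool
  | ex (i : ℕ) (b : Expr .bool) : Expr .bool
  | qzero : Expr .rat
  | qarr (A : ℕ) (e : Expr .nat) : Expr .rat
  | qadd (e₁ e₂ : Expr .rat) : Expr .rat
  | qmax (e₁ e₂ : Expr .rat) : Expr .rat
  | qite (b : Expr .bool) (e₁ e₂ : Expr .rat) : Expr .rat
  | qsum (i : ℕ) (e : Expr .rat) : Expr .rat
  | qsup (i : ℕ) (e : Expr .rat) : Expr .rat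

/-- The maximum of `0, g 0, …, g (m - 1)`. -/
def supUpto (g : ℕ → ℚ) : ℕ → ℚ
  | 0 => 0
  | m + 1 => max (supUpto g m) (g m)

/-- The value of an expression. -/
def Expr.eval (n : ℕ) : {τ : Ty} → Expr τ → Store → τ.Val
  | _, .const c, _ => c
  | _, .len, _ => n
  | _, .reg r, s => s.reg r
  | _, .arr A e, s => s.arr A (e.eval n s)
  | _, .add e₁ e₂, s => (e₁.eval n s : ℕ) + (e₂.eval n s : ℕ)
  | _, .find i b, s => Nat.findGreatest (fun j => b.eval n (s.set i j) = true) n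
  | _, .eq e₁ e₂, s => decide ((e₁.eval n s : ℕ) = e₂.eval n s)
  | _, .lt e₁ e₂, s => decide ((e₁.eval n s : ℕ) < e₂.eval n s)
  | _, .qlt e₁ e₂, s => decide ((e₁.eval n s : ℚ) < e₂.eval n s)
  | _, .and b₁ b₂, s => (b₁.eval n s && b₂.eval n s)
  | _, .not b, s => !(b.eval n s)
  | _, .ex i b, s => decide (∃ j, j < n + 1 ∧ b.eval n (s.set i j) = true)
  | _, .qzero, _ => (0 : ℚ)
  | _, .qarr A e, s => s.qarr A (e.eval n s)
  | _, .qadd e₁ e₂, s => (e₁.eval n s : ℚ) + (e₂.eval n s : ℚ)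
  | _, .qmax e₁ e₂, s => max (e₁.eval n s : ℚ) (e₂.eval n s : ℚ)
  | _, .qite b e₁ e₂, s => if b.eval n s = true then e₁.eval n s else e₂.eval n s
  | _, .qsum i e, s => ∑ j ∈ Finset.range (n + 1), (e.eval n (s.set i j) : ℚ)
  | _, .qsup i e, s => supUpto (fun j => e.eval n (s.set i j)) (n + 1)

/-- A bound for the time that the evaluation of an expression takes. -/
def Expr.cost (n : ℕ) : {τ : Ty} → Expr τ → ℕ
  | _, .const _ => 1
  | _, .len => 1
  | _, .reg _ => 1
  | _, .arr _ e => e.cost n + 2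
  | _, .add e₁ e₂ => e₁.cost n + e₂.cost n + 3
  | _, .find _ b => (n + 1) * (b.cost n + 12) + 20
  | _, .eq e₁ e₂ => e₁.cost n + e₂.cost n + 4
  | _, .lt e₁ e₂ => e₁.cost n + e₂.cost n + 4
  | _, .qlt e₁ e₂ => e₁.cost n + e₂.cost n + 4
  | _, .and b₁ b₂ => b₁.cost n + b₂.cost n + 4
  | _, .not b => b.cost n + 4
  | _, .ex _ b => (n + 1) * (b.cost n + 12) + 20
  | _, .qzero => 1
  | _, .qarr _ e => e.cost n + 2
  | _, .qadd e₁ e₂ => e₁.cost n + e₂.cost n + 3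
  | _, .qmax e₁ e₂ => e₁.cost n + e₂.cost n + 4
  | _, .qite b e₁ e₂ => b.cost n + (e₁.cost n + e₂.cost n) + 6
  | _, .qsum _ e => (n + 1) * (e.cost n + 12) + 20
  | _, .qsup _ e => (n + 1) * (e.cost n + 12) + 20

/-- Statements. -/
inductive Stmt where
  | skip
  | setA (A : ℕ) (i e : Expr .nat)
  | setQ (A : ℕ) (i : Expr .nat) (e : Expr .rat)
  | seq (p q : Stmt)
  | ite (b : Expr .bool) (p q : Stmt)
  | forN (i : ℕ) (p : Stmt)

/-- `f (m-1) (… (f 1 (f 0 s)))`. -/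
def iter {α : Type*} (f : ℕ → α → α) : ℕ → α → α
  | 0, s => s
  | m + 1, s => f m (iter f m s)

/-- The effect of a statement. -/
def Stmt.den (n : ℕ) : Stmt → Store → Store
  | .skip, s => s
  | .setA A i e, s => s.setA A (i.eval n s) (e.eval n s)
  | .setQ A i e, s => s.setQ A (i.eval n s) (e.eval n s)
  | .seq p q, s => q.den n (p.den n s)
  | .ite b p q, s => if b.eval n s = true then p.den n s else q.den n s
  | .forN i p, s => (iter (fun j s' => p.den n (s'.set i j)) (n + 1) s).set i (s.reg i)

/-- A bound for the running time of a statement. -/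
def Stmt.cost (n : ℕ) : Stmt → ℕ
  | .skip => 1
  | .setA _ i e => i.cost n + e.cost n + 3
  | .setQ _ i e => i.cost n + e.cost n + 3
  | .seq p q => p.cost n + q.cost n + 1
  | .ite b p q => b.cost n + (p.cost n + q.cost n) + 6
  | .forN _ p => (n + 1) * (p.cost n + 12) + 20

/-! ## Compilation -/

/-- The loop for the variable `i`, with hidden counter.  The register of `i` is restored. -/
def loopCom (d i : ℕ) (init body : Com) : Com :=
  -- The temporaries `d`, `d + 1`, `d + 2` hold the saved variable, the counter and the bound `n +
  -- 1`. Temporary `d + 3` is left for an accumulator and the body works from `d + 4` on.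
  .seq (.op (.copy (2 * d + 2) (2 * i + 1)))
  (.seq (.op (.const (2 * (d + 1) + 2) 0))
  (.seq (.op (.const (2 * (d + 2) + 2) 1))
  (.seq (.op (.add (2 * (d + 2) + 2) (2 * (d + 2) + 2) 0))
  (.seq init
  (.seq (.loop (.lt (2 * (d + 1) + 2) (2 * (d + 2) + 2))
    (.seq (.op (.copy (2 * i + 1) (2 * (d + 1) + 2)))
    (.seq body
    (.seq (.op (.const (2 * (d + 4) + 2) 1))
      (.op (.add (2 * (d + 1) + 2) (2 * (d + 1) + 2) (2 * (d + 4) + 2)))))))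
  (.op (.copy (2 * i + 1) (2 * d + 2))))))))

/-- The code that evaluates an expression into the temporary register number `d`. -/
def Expr.comp : {τ : Ty} → Expr τ → ℕ → Com
  | _, .const c, d => .op (.const (2 * d + 2) c)
  -- Register `0` keeps the length, odd registers are the variables of the language, and even
  -- registers from `2` on are temporaries, so the three kinds never collide.
  | _, .len, d => .op (.copy (2 * d + 2) 0)
  | _, .reg r, d => .op (.copy (2 * d + 2) (2 * r + 1))
  | _, .arr A e, d => .seq (e.comp d) (.op (.load (2 * d + 2) A (2 * d + 2)))
  | _, .add e₁ e₂, d => .seq (e₁.comp d) (.seq (e₂.comp (d + 1))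
      (.op (.add (2 * d + 2) (2 * d + 2) (2 * (d + 1) + 2))))
  | _, .find i b, d => .seq (loopCom d i (.op (.const (2 * (d + 3) + 2) 0))
      (.seq (b.comp (d + 4)) (.seq (.op (.const (2 * (d + 5) + 2) 1))
        (.cond (.eq (2 * (d + 4) + 2) (2 * (d + 5) + 2))
          (.op (.copy (2 * (d + 3) + 2) (2 * (d + 1) + 2))) .skip))))
      (.op (.copy (2 * d + 2) (2 * (d + 3) + 2)))
  | _, .eq e₁ e₂, d => .seq (e₁.comp d) (.seq (e₂.comp (d + 1))
      (.cond (.eq (2 * d + 2) (2 * (d + 1) + 2)) (.op (.const (2 * d + 2) 1))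
        (.op (.const (2 * d + 2) 0))))
  | _, .lt e₁ e₂, d => .seq (e₁.comp d) (.seq (e₂.comp (d + 1))
      (.cond (.lt (2 * d + 2) (2 * (d + 1) + 2)) (.op (.const (2 * d + 2) 1))
        (.op (.const (2 * d + 2) 0))))
  | _, .qlt e₁ e₂, d => .seq (e₁.comp d) (.seq (e₂.comp (d + 1))
      (.cond (.qlt d (d + 1)) (.op (.const (2 * d + 2) 1)) (.op (.const (2 * d + 2) 0))))
  -- With truth values `0` and `1`, the conjunction equals the second value except for the pair `0 <
  -- 1`, where the first one is kept.
  | _, .and b₁ b₂, d => .seq (b₁.comp d) (.seq (b₂.comp (d + 1))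
      (.cond (.lt (2 * d + 2) (2 * (d + 1) + 2)) .skip
        (.op (.copy (2 * d + 2) (2 * (d + 1) + 2)))))
  | _, .not b, d => .seq (b.comp d) (.seq (.op (.const (2 * (d + 1) + 2) 1))
      (.op (.sub (2 * d + 2) (2 * (d + 1) + 2) (2 * d + 2))))
  | _, .ex i b, d => .seq (loopCom d i (.op (.const (2 * (d + 3) + 2) 0))
      (.seq (b.comp (d + 4)) (.seq (.op (.const (2 * (d + 5) + 2) 1))
        (.cond (.eq (2 * (d + 4) + 2) (2 * (d + 5) + 2))
          (.op (.const (2 * (d + 3) + 2) 1)) .skip))))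
      (.op (.copy (2 * d + 2) (2 * (d + 3) + 2)))
  | _, .qzero, d => .op (.qconst d 0)
  | _, .qarr A e, d => .seq (e.comp d) (.op (.qload d A (2 * d + 2)))
  | _, .qadd e₁ e₂, d => .seq (e₁.comp d) (.seq (e₂.comp (d + 1)) (.op (.qadd d d (d + 1))))
  | _, .qmax e₁ e₂, d => .seq (e₁.comp d) (.seq (e₂.comp (d + 1))
      (.cond (.qlt d (d + 1)) (.op (.qcopy d (d + 1))) .skip))
  | _, .qite b e₁ e₂, d => .seq (b.comp d) (.seq (.op (.const (2 * (d + 1) + 2) 1))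
      (.cond (.eq (2 * d + 2) (2 * (d + 1) + 2)) (e₁.comp d) (e₂.comp d)))
  | _, .qsum i e, d => loopCom d i (.op (.qconst d 0))
      (.seq (e.comp (d + 4)) (.op (.qadd d d (d + 4))))
  | _, .qsup i e, d => loopCom d i (.op (.qconst d 0))
      (.seq (e.comp (d + 4)) (.cond (.qlt d (d + 4)) (.op (.qcopy d (d + 4))) .skip))

/-- The code of a statement. -/
def Stmt.comp : Stmt → ℕ → Com
  | .skip, _ => .skip
  | .setA A i e, d => .seq (i.comp d) (.seq (e.comp (d + 1))
      (.op (.store A (2 * d + 2) (2 * (d + 1) + 2))))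
  | .setQ A i e, d => .seq (i.comp d) (.seq (e.comp (d + 1))
      (.op (.qstore A (2 * d + 2) (d + 1))))
  | .seq p q, d => .seq (p.comp d) (q.comp d)
  | .ite b p q, d => .seq (b.comp d) (.seq (.op (.const (2 * (d + 1) + 2) 1))
      (.cond (.eq (2 * d + 2) (2 * (d + 1) + 2)) (p.comp d) (q.comp d)))
  | .forN i p, d => loopCom d i .skip (p.comp (d + 4))

/-- The memory `m` represents the store `s`. -/
structure Sim (n : ℕ) (s : Store) (m : Memory) : Prop where
  len : m.reg 0 = n
  reg : ∀ r, m.reg (2 * r + 1) = s.reg r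
  arr : m.arr = s.arr
  qarr : m.qarr = s.qarr

/-- The temporary registers below `d` agree. -/
structure Keep (d : ℕ) (m₀ m : Memory) : Prop where
  reg : ∀ d' < d, m.reg (2 * d' + 2) = m₀.reg (2 * d' + 2)
  qreg : ∀ d' < d, m.qreg d' = m₀.qreg d'

theorem Keep.refl (d : ℕ) (m : Memory) : Keep d m m := ⟨fun _ _ => rfl, fun _ _ => rfl⟩

theorem Keep.trans {d d' : ℕ} {m₁ m₂ m₃ : Memory} (h : Keep d m₁ m₂) (h' : Keep d' m₂ m₃)
    (hd : d ≤ d') : Keep d m₁ m₃ :=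
  ⟨fun e he => (h'.reg e (by omega)).trans (h.reg e he),
    fun e he => (h'.qreg e (by omega)).trans (h.qreg e he)⟩

/-- The temporary register `d` holds the value `v`. -/
def Holds (d : ℕ) : {τ : Ty} → τ.Val → Memory → Prop
  | .nat, v, m => m.reg (2 * d + 2) = v
  | .bool, v, m => m.reg (2 * d + 2) = if (v : Bool) = true then 1 else 0
  | .rat, v, m => m.qreg d = v

section Updates

variable {n d e : ℕ} {s : Store} {m m₀ : Memory}

theorem Sim.tmp (h : Sim n s m) (v : ℕ) :
    Sim n s { m with reg := Function.update m.reg (2 * d + 2) v } :=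
  ⟨by simp [h.len],
    fun r => by
      simp only [Function.update_apply]
      rw [if_neg (by omega), h.reg], h.arr, h.qarr⟩

theorem Sim.qtmp (h : Sim n s m) (v : ℚ) :
    Sim n s { m with qreg := Function.update m.qreg d v } :=
  ⟨h.len, h.reg, h.arr, h.qarr⟩

theorem Sim.set (h : Sim n s m) (i v : ℕ) :
    Sim n (s.set i v) { m with reg := Function.update m.reg (2 * i + 1) v } :=
  ⟨by simp [h.len],
    fun r => by simp [Function.update_apply, Store.set, h.reg], h.arr, h.qarr⟩

theorem Keep.tmp (h : Keep d m₀ m) (he : d ≤ e) (v : ℕ) :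
    Keep d m₀ { m with reg := Function.update m.reg (2 * e + 2) v } :=
  ⟨fun d' hd' => by
    simp only [Function.update_apply]
    rw [if_neg (by omega), h.reg d' hd'], h.qreg⟩

theorem Keep.qtmp (h : Keep d m₀ m) (he : d ≤ e) (v : ℚ) :
    Keep d m₀ { m with qreg := Function.update m.qreg e v } :=
  ⟨h.reg, fun d' hd' => by
    simp only [Function.update_apply]
    rw [if_neg (by omega), h.qreg d' hd']⟩

theorem Keep.set (h : Keep d m₀ m) (i v : ℕ) :
    Keep d m₀ { m with reg := Function.update m.reg (2 * i + 1) v } :=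
  ⟨fun d' hd' => by
    simp only [Function.update_apply]
    rw [if_neg (by omega), h.reg d' hd'], h.qreg⟩

end Updates

theorem Store.set_set (s : Store) (i v w : ℕ) : (s.set i v).set i w = s.set i w := by
  simp [Store.set]

theorem Store.set_self (s : Store) (i : ℕ) : s.set i (s.reg i) = s := by
  simp [Store.set]

/-- The loop rule: `S j` is the store after `j` rounds and `A j` is what the accumulator satisfies
after `j` rounds. -/
theorem run_loopCom {P : Program} {n d i : ℕ} {s : Store} {m : Memory} {init body : Com} {T : ℕ}
    (S : ℕ → Store) (A : ℕ → Memory → Prop) (hS : S 0 = s)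
    (hA : ∀ j m₁ v d' , (d' < d + 3 ∨ d + 3 < d') → A j m₁ →
      A j { m₁ with reg := Function.update m₁.reg (2 * d' + 2) v })
    (hA' : ∀ j m₁ v, A j m₁ → A j { m₁ with reg := Function.update m₁.reg (2 * i + 1) v })
    (hinit : ∀ m₁, Sim n s m₁ → Run P init m₁ 1
      (fun m₂ => Sim n s m₂ ∧ Keep d m₁ m₂ ∧ (∀ d' < d + 3, m₂.reg (2 * d' + 2) =
        m₁.reg (2 * d' + 2)) ∧ A 0 m₂))
    (hbody : ∀ j m₁, j < n + 1 → Sim n ((S j).set i j) m₁ → A j m₁ → m₁.reg (2 * (d + 1) + 2) = j →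
      Run P body m₁ T (fun m₂ => (∃ r, Sim n ((S (j + 1)).set i r) m₂) ∧ Keep d m₁ m₂ ∧
        (∀ d' < d + 3, m₂.reg (2 * d' + 2) = m₁.reg (2 * d' + 2)) ∧ A (j + 1) m₂))
    (hm : Sim n s m) :
    Run P (loopCom d i init body) m ((n + 1) * (T + 7) + 14)
      (fun m' => Sim n ((S (n + 1)).set i (s.reg i)) m' ∧ Keep d m m' ∧ A (n + 1) m') := by
  have main : Run P (loopCom d i init body) m
      (1 + (1 + (1 + (1 + (1 + ((n + 1) * (1 + (T + (1 + 1 + 1) + 1) + 1 + 1) + 1 + 1 + 1) + 1) + 1) + 1) + 1) + 1)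
      (fun m' => Sim n ((S (n + 1)).set i (s.reg i)) m' ∧ Keep d m m' ∧ A (n + 1) m') := by
    refine Run.seq (R := fun m₁ => Sim n s m₁ ∧ Keep d m m₁ ∧ m₁.reg (2 * d + 2) = s.reg i)
      (Run.op ⟨hm.tmp _, (Keep.refl d m).tmp le_rfl _, by simp [Op.apply, hm.reg]⟩) ?_
    rintro m₁ ⟨s₁, k₁, r₁⟩
    refine Run.seq (R := fun m₂ => Sim n s m₂ ∧ Keep d m m₂ ∧ m₂.reg (2 * d + 2) = s.reg i ∧
      m₂.reg (2 * (d + 1) + 2) = 0)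
      (Run.op ⟨s₁.tmp _, k₁.tmp (by omega) _, by simp [Op.apply, r₁],
        by simp [Op.apply]⟩) ?_
    rintro m₂ ⟨s₂, k₂, r₂, z₂⟩
    refine Run.seq (R := fun m₂ => Sim n s m₂ ∧ Keep d m m₂ ∧ m₂.reg (2 * d + 2) = s.reg i ∧
      m₂.reg (2 * (d + 1) + 2) = 0 ∧ m₂.reg (2 * (d + 2) + 2) = 1)
      (Run.op ⟨s₂.tmp _, k₂.tmp (by omega) _, by simp [Op.apply, r₂],
        by simp [Op.apply, z₂], by simp [Op.apply]⟩) ?_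
    rintro m₃ ⟨s₃, k₃, r₃, z₃, o₃⟩
    refine Run.seq (R := fun m₂ => Sim n s m₂ ∧ Keep d m m₂ ∧ m₂.reg (2 * d + 2) = s.reg i ∧
      m₂.reg (2 * (d + 1) + 2) = 0 ∧ m₂.reg (2 * (d + 2) + 2) = n + 1)
      (Run.op ⟨s₃.tmp _, k₃.tmp (by omega) _, by simp [Op.apply, r₃],
        by simp [Op.apply, z₃],
        by simp only [Op.apply, Function.update_self, o₃, s₃.len]; exact Nat.add_comm 1 n⟩) ?_
    rintro m₄ ⟨s₄, k₄, r₄, z₄, o₄⟩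
    refine Run.seq (hinit m₄ s₄) ?_
    rintro m₅ ⟨s₅, k₅, l₅, a₅⟩
    refine Run.seq (T₁ := (n + 1) * (1 + (T + (1 + 1 + 1) + 1) + 1 + 1) + 1) (T₂ := 1)
      (Run.loop (N := n + 1) (fun j m₆ => (∃ r, Sim n ((S j).set i r) m₆) ∧
      Keep d m m₆ ∧ m₆.reg (2 * d + 2) = s.reg i ∧ m₆.reg (2 * (d + 1) + 2) = j ∧
      m₆.reg (2 * (d + 2) + 2) = n + 1 ∧ A j m₆) ?_ ?_ ?_) ?_
    · rintro j m₆ ⟨-, -, -, h₁, h₂, -⟩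
      simp [Test.eval, h₁, h₂]
    · rintro j m₆ hj ⟨⟨r, s₆⟩, k₆, r₆, z₆, o₆, a₆⟩
      refine Run.seq (R := fun m₇ => Sim n ((S j).set i j) m₇ ∧ Keep d m m₇ ∧
        m₇.reg (2 * d + 2) = s.reg i ∧ m₇.reg (2 * (d + 1) + 2) = j ∧
        m₇.reg (2 * (d + 2) + 2) = n + 1 ∧ A j m₇) (Run.op ⟨?_, k₆.set _ _, ?_, ?_, ?_, ?_⟩) ?_
      · have := s₆.set i (m₆.reg (2 * (d + 1) + 2))
        rw [Store.set_set, z₆] at this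
        simpa [Op.apply, z₆] using this
      · simp only [Op.apply, Function.update_apply]
        rw [if_neg (by omega), r₆]
      · simp only [Op.apply, Function.update_apply]
        rw [if_neg (by omega), z₆]
      · simp only [Op.apply, Function.update_apply]
        rw [if_neg (by omega), o₆]
      · exact hA' _ _ _ a₆
      · rintro m₇ ⟨s₇, k₇, r₇, z₇, o₇, a₇⟩
        refine Run.seq (hbody j m₇ hj s₇ a₇ z₇) ?_
        rintro m₈ ⟨⟨r', s₈⟩, k₈, l₈, a₈⟩
        refine Run.seq (T₁ := 1) (T₂ := 1) (R := fun m₉ => Sim n ((S (j + 1)).set i r') m₉ ∧ Keep d m m₉ ∧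
          m₉.reg (2 * d + 2) = s.reg i ∧ m₉.reg (2 * (d + 1) + 2) = j ∧
          m₉.reg (2 * (d + 2) + 2) = n + 1 ∧ m₉.reg (2 * (d + 4) + 2) = 1 ∧ A (j + 1) m₉)
          (Run.op ⟨s₈.tmp _, (k₇.trans k₈ le_rfl).tmp (by omega) _, ?_, ?_, ?_, ?_, ?_⟩) ?_
        · simp [Op.apply, l₈ d (by omega), r₇]
        · simp only [Op.apply, Function.update_apply]
          rw [if_neg (by omega), l₈ (d + 1) (by omega), z₇]
        · simp only [Op.apply, Function.update_apply]
          rw [if_neg (by omega), l₈ (d + 2) (by omega), o₇]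
        · simp [Op.apply]
        · exact hA _ _ _ _ (by omega) a₈
        · rintro m₉ ⟨s₉, k₉, r₉, z₉, o₉, u₉, a₉⟩
          refine Run.op ⟨⟨r', s₉.tmp _⟩, k₉.tmp (by omega) _, ?_, ?_, ?_, ?_⟩
          · simp [Op.apply, r₉]
          · simp [Op.apply, z₉, u₉]
          · simp [Op.apply, o₉]
          · exact hA _ _ _ _ (by omega) a₉
    · refine ⟨⟨s.reg i, ?_⟩, k₄.trans k₅ le_rfl, ?_, ?_, ?_, a₅⟩
      · rw [hS, Store.set_self]; exact s₅
      · rw [l₅ d (by omega), r₄]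
      · rw [l₅ (d + 1) (by omega), z₄]
      · rw [l₅ (d + 2) (by omega), o₄]
    · rintro m₆ ⟨⟨r, s₆⟩, k₆, r₆, z₆, o₆, a₆⟩
      refine Run.op ⟨?_, k₆.set _ _, hA' _ _ _ a₆⟩
      have := s₆.set i (m₆.reg (2 * d + 2))
      rw [Store.set_set, r₆] at this
      simpa [Op.apply, r₆] using this
  exact main.mono (by linarith) fun _ h => h

theorem Test.eval_eq_iff {a b : ℕ} {m : Memory} : (Test.eq a b).eval m = decide (m.reg a = m.reg b) :=
  rfl

theorem Test.eval_lt_iff {a b : ℕ} {m : Memory} : (Test.lt a b).eval m = decide (m.reg a < m.reg b) :=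
  rfl

theorem Test.eval_qlt_iff {a b : ℕ} {m : Memory} :
    (Test.qlt a b).eval m = decide (m.qreg a < m.qreg b) :=
  rfl

/-- Evaluating a test expression and branching on its outcome. -/
theorem Run.branch {P : Program} {n d T : ℕ} {s : Store} {m m₀ : Memory} {v : Bool} {c₁ c₂ : Com}
    {Q : Memory → Prop} (hs : Sim n s m) (hk : Keep d m₀ m) (hv : Holds (τ := .bool) d v m)
    (h₁ : ∀ m', Sim n s m' → Keep d m₀ m' → v = true → Run P c₁ m' T Q)
    (h₂ : ∀ m', Sim n s m' → Keep d m₀ m' → v = false → Run P c₂ m' T Q) :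
    Run P (.seq (.op (.const (2 * (d + 1) + 2) 1)) (.cond (.eq (2 * d + 2) (2 * (d + 1) + 2)) c₁ c₂))
      m (1 + (T + 1) + 1) Q := by
  refine Run.seq (R := fun m' => Sim n s m' ∧ Keep d m₀ m' ∧ Holds (τ := .bool) d v m' ∧
      m'.reg (2 * (d + 1) + 2) = 1)
    (Run.op ⟨hs.tmp _, hk.tmp (by omega) _, ?_, by simp [Op.apply]⟩) ?_
  · simpa [Holds, Op.apply] using hv
  · rintro m' ⟨s', k', v', o'⟩
    refine Run.cond (fun h => h₁ m' s' k' ?_) (fun h => h₂ m' s' k' ?_)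
    · simp only [Holds] at v'
      rw [Test.eval_eq_iff, o', v'] at h
      cases v <;> simp_all
    · simp only [Holds] at v'
      rw [Test.eval_eq_iff, o', v'] at h
      cases v <;> simp_all

/-- Induction on the expression. `Keep d` is the strengthening that makes it work: the second
operand is evaluated from temporary `d + 1` on and cannot destroy the first result in `d`. -/
theorem Expr.run_comp (P : Program) (n : ℕ) {τ : Ty} (e : Expr τ) : ∀ (d : ℕ) (s : Store) (m : Memory),
    Sim n s m → Run P (e.comp d) m (e.cost n)
      (fun m' => Sim n s m' ∧ Keep d m m' ∧ Holds d (e.eval n s) m') := by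
  have bin : ∀ {τ₁ τ₂ : Ty} {e₁ : Expr τ₁} {e₂ : Expr τ₂} {c : Com} {T d : ℕ} {s : Store}
      {m : Memory} {Q : Memory → Prop},
      (∀ (d : ℕ) (s : Store) (m : Memory), Sim n s m → Run P (e₁.comp d) m (e₁.cost n)
        (fun m' => Sim n s m' ∧ Keep d m m' ∧ Holds d (e₁.eval n s) m')) →
      (∀ (d : ℕ) (s : Store) (m : Memory), Sim n s m → Run P (e₂.comp d) m (e₂.cost n)
        (fun m' => Sim n s m' ∧ Keep d m m' ∧ Holds d (e₂.eval n s) m')) →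
      Sim n s m →
      (∀ m', Sim n s m' → Keep d m m' → Holds d (e₁.eval n s) m' → Holds (d + 1) (e₂.eval n s) m' →
        Run P c m' T Q) →
      Run P (.seq (e₁.comp d) (.seq (e₂.comp (d + 1)) c)) m
        (e₁.cost n + (e₂.cost n + T + 1) + 1) Q := by
    intro τ₁ τ₂ e₁ e₂ c T d s m Q ih₁ ih₂ hm hc
    refine Run.seq (ih₁ d s m hm) ?_
    rintro m₁ ⟨s₁, k₁, v₁⟩
    refine Run.seq (ih₂ (d + 1) s m₁ s₁) ?_
    rintro m₂ ⟨s₂, k₂, v₂⟩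
    refine hc m₂ s₂ (k₁.trans k₂ (by omega)) ?_ v₂
    cases τ₁
    · exact (k₂.reg d (by omega)).trans v₁
    · exact (k₂.reg d (by omega)).trans v₁
    · exact (k₂.qreg d (by omega)).trans v₁
  induction e with
  | const c =>
    intro d s m hm
    exact Run.op ⟨hm.tmp _, (Keep.refl d m).tmp le_rfl _, by simp [Holds, Op.apply, Expr.eval]⟩
  | len =>
    intro d s m hm
    exact Run.op ⟨hm.tmp _, (Keep.refl d m).tmp le_rfl _,
      by simp [Holds, Op.apply, Expr.eval, hm.len]⟩
  | reg r =>
    intro d s m hm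
    exact Run.op ⟨hm.tmp _, (Keep.refl d m).tmp le_rfl _,
      by simp [Holds, Op.apply, Expr.eval, hm.reg]⟩
  | arr A e ih =>
    intro d s m hm
    refine (Run.seq (ih d s m hm) (T₂ := 1) ?_).mono (by simp [Expr.cost]) fun _ h => h
    rintro m₁ ⟨s₁, k₁, v₁⟩
    simp only [Holds] at v₁
    exact Run.op ⟨s₁.tmp _, k₁.tmp le_rfl _, by simp [Holds, Op.apply, Expr.eval, v₁, s₁.arr]⟩
  | add e₁ e₂ ih₁ ih₂ =>
    intro d s m hm
    refine (bin ih₁ ih₂ hm (T := 1) ?_).mono (by simp only [Expr.cost]; omega) fun _ h => h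
    intro m₁ s₁ k₁ v₁ v₂
    simp only [Holds] at v₁ v₂
    exact Run.op ⟨s₁.tmp _, k₁.tmp le_rfl _, by simp [Holds, Op.apply, Expr.eval, v₁, v₂]⟩
  | find i b ih =>
    intro d s m hm
    have := run_loopCom (P := P) (n := n) (d := d) (i := i) (s := s) (m := m)
      (init := .op (.const (2 * (d + 3) + 2) 0))
      (body := .seq (b.comp (d + 4)) (.seq (.op (.const (2 * (d + 5) + 2) 1))
        (.cond (.eq (2 * (d + 4) + 2) (2 * (d + 5) + 2))
          (.op (.copy (2 * (d + 3) + 2) (2 * (d + 1) + 2))) .skip)))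
      (T := b.cost n + (1 + (1 + 1) + 1) + 1) (fun _ => s)
      -- After `j` rounds the indices below `j` have been tested. Truncated subtraction turns `j =
      -- 0` into the initial accumulator `0`, which is also what `Nat.findGreatest` returns when
      -- nothing is found.
      (fun j m' => m'.reg (2 * (d + 3) + 2) =
        Nat.findGreatest (fun l => b.eval n (s.set i l) = true) (j - 1)) rfl ?_ ?_ ?_ ?_ hm
    · refine (Run.seq this (T₂ := 1) ?_).mono (by simp only [Expr.cost]; nlinarith) fun _ h => h
      rintro m₁ ⟨s₁, k₁, v₁⟩
      rw [Store.set_self] at s₁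
      exact Run.op ⟨s₁.tmp _, k₁.tmp le_rfl _, by simpa [Holds, Op.apply, Expr.eval] using v₁⟩
    · intro j m₁ v d' hd' h
      simp only [Function.update_apply]
      rw [if_neg (by omega), h]
    · intro j m₁ v h
      simp only [Function.update_apply]
      rw [if_neg (by omega), h]
    · intro m₁ s₁
      refine Run.op ⟨s₁.tmp _, (Keep.refl d _).tmp (by omega) _, ?_, by simp [Op.apply]⟩
      intro d' hd'
      simp only [Op.apply, Function.update_apply]
      rw [if_neg (by omega)]
    · intro j m₁ hj s₁ a₁ z₁
      refine Run.seq (ih (d + 4) _ m₁ s₁) ?_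
      rintro m₂ ⟨s₂, k₂, v₂⟩
      have z₂ : m₂.reg (2 * (d + 1) + 2) = j := (k₂.reg (d + 1) (by omega)).trans z₁
      have a₂ := (k₂.reg (d + 3) (by omega)).trans a₁
      refine Run.seq (T₁ := 1) (T₂ := 1 + 1) (R := fun m₃ => Sim n (s.set i j) m₃ ∧ Keep (d + 4) m₂ m₃ ∧
          Holds (τ := .bool) (d + 4) (b.eval n (s.set i j)) m₃ ∧ m₃.reg (2 * (d + 5) + 2) = 1)
        (Run.op (o := .const (2 * (d + 5) + 2) 1)
          ⟨s₂.tmp _, (Keep.refl _ _).tmp (by omega) _, ?_, by simp [Op.apply]⟩) ?_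
      · simpa [Holds, Op.apply] using v₂
      rintro m₃ ⟨s₃, k₃, v₃, o₃⟩
      have z₃ : m₃.reg (2 * (d + 1) + 2) = j := (k₃.reg (d + 1) (by omega)).trans z₂
      have a₃ := (k₃.reg (d + 3) (by omega)).trans a₂
      have kk := k₂.trans k₃ le_rfl
      simp only [Holds] at v₃
      have step : Nat.findGreatest (fun l => b.eval n (s.set i l) = true) (j + 1 - 1) =
          if b.eval n (s.set i j) = true then j else
            Nat.findGreatest (fun l => b.eval n (s.set i l) = true) (j - 1) := by
        cases j with
        | zero => simp
        | succ j => simp only [Nat.add_sub_cancel]; rw [Nat.findGreatest_succ]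
      refine Run.cond (fun h => ?_) (fun h => ?_)
      · rw [Test.eval_eq_iff, o₃, v₃] at h
        have hb : b.eval n (s.set i j) = true := by
          by_contra hb
          rw [if_neg hb] at h
          simp at h
        refine Run.op ⟨⟨j, s₃.tmp _⟩, ?_, ?_, ?_⟩
        · exact ((Keep.refl d m₁).trans kk (by omega)).tmp (by omega) _
        · intro d' hd'
          simp only [Op.apply, Function.update_apply]
          rw [if_neg (by omega)]
          exact kk.reg d' (by omega)
        · rw [step, if_pos hb]
          simp [Op.apply, z₃]
      · rw [Test.eval_eq_iff, o₃, v₃] at h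
        have hb : ¬ b.eval n (s.set i j) = true := by
          intro hb
          rw [if_pos hb] at h
          simp at h
        refine Run.skip ⟨⟨j, s₃⟩, (Keep.refl d m₁).trans kk (by omega),
          fun d' hd' => kk.reg d' (by omega), ?_⟩
        rw [step, if_neg hb, a₃]
  | eq e₁ e₂ ih₁ ih₂ =>
    intro d s m hm
    refine (bin ih₁ ih₂ hm (T := 1 + 1) ?_).mono (by simp only [Expr.cost]; omega) fun _ h => h
    intro m₁ s₁ k₁ v₁ v₂
    simp only [Holds] at v₁ v₂
    refine Run.cond (fun h => Run.op ⟨s₁.tmp _, k₁.tmp le_rfl _, ?_⟩)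
      (fun h => Run.op ⟨s₁.tmp _, k₁.tmp le_rfl _, ?_⟩)
    · rw [Test.eval_eq_iff, v₁, v₂] at h
      simpa [Holds, Op.apply, Expr.eval] using h
    · rw [Test.eval_eq_iff, v₁, v₂] at h
      simpa [Holds, Op.apply, Expr.eval] using h
  | lt e₁ e₂ ih₁ ih₂ =>
    intro d s m hm
    refine (bin ih₁ ih₂ hm (T := 1 + 1) ?_).mono (by simp only [Expr.cost]; omega) fun _ h => h
    intro m₁ s₁ k₁ v₁ v₂
    simp only [Holds] at v₁ v₂
    refine Run.cond (fun h => Run.op ⟨s₁.tmp _, k₁.tmp le_rfl _, ?_⟩)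
      (fun h => Run.op ⟨s₁.tmp _, k₁.tmp le_rfl _, ?_⟩)
    · rw [Test.eval_lt_iff, v₁, v₂] at h
      simpa [Holds, Op.apply, Expr.eval] using h
    · rw [Test.eval_lt_iff, v₁, v₂] at h
      simpa [Holds, Op.apply, Expr.eval] using h
  | qlt e₁ e₂ ih₁ ih₂ =>
    intro d s m hm
    refine (bin ih₁ ih₂ hm (T := 1 + 1) ?_).mono (by simp only [Expr.cost]; omega) fun _ h => h
    intro m₁ s₁ k₁ v₁ v₂
    simp only [Holds] at v₁ v₂
    refine Run.cond (fun h => Run.op ⟨s₁.tmp _, k₁.tmp le_rfl _, ?_⟩)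
      (fun h => Run.op ⟨s₁.tmp _, k₁.tmp le_rfl _, ?_⟩)
    · rw [Test.eval_qlt_iff, v₁, v₂] at h
      simpa [Holds, Op.apply, Expr.eval] using h
    · rw [Test.eval_qlt_iff, v₁, v₂] at h
      simpa [Holds, Op.apply, Expr.eval] using h
  | and b₁ b₂ ih₁ ih₂ =>
    intro d s m hm
    refine (bin ih₁ ih₂ hm (T := 1 + 1) ?_).mono (by simp only [Expr.cost]; omega) fun _ h => h
    intro m₁ s₁ k₁ v₁ v₂
    simp only [Holds] at v₁ v₂
    refine Run.cond (fun h => Run.skip ⟨s₁, k₁, ?_⟩)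
      (fun h => Run.op ⟨s₁.tmp _, k₁.tmp le_rfl _, ?_⟩)
    · rw [Test.eval_lt_iff, v₁, v₂] at h
      simp only [Holds, Expr.eval, v₁]
      rcases Bool.eq_false_or_eq_true (b₁.eval n s) with h₁ | h₁ <;>
        rcases Bool.eq_false_or_eq_true (b₂.eval n s) with h₂ | h₂ <;> simp_all
    · rw [Test.eval_lt_iff, v₁, v₂] at h
      simp only [Holds, Expr.eval, Op.apply, Function.update_self, v₂]
      rcases Bool.eq_false_or_eq_true (b₁.eval n s) with h₁ | h₁ <;>
        rcases Bool.eq_false_or_eq_true (b₂.eval n s) with h₂ | h₂ <;> simp_all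
  | not b ih =>
    intro d s m hm
    refine (Run.seq (ih d s m hm) (T₂ := 1 + 1 + 1) ?_).mono (by simp only [Expr.cost]; omega)
      fun _ h => h
    rintro m₁ ⟨s₁, k₁, v₁⟩
    refine Run.seq (T₁ := 1) (T₂ := 1) (R := fun m' => Sim n s m' ∧ Keep d m m' ∧
        Holds (τ := .bool) d (b.eval n s) m' ∧ m'.reg (2 * (d + 1) + 2) = 1)
      (Run.op ⟨s₁.tmp _, k₁.tmp (by omega) _, ?_, by simp [Op.apply]⟩) ?_
    · simpa [Holds, Op.apply] using v₁
    · rintro m₂ ⟨s₂, k₂, v₂, o₂⟩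
      simp only [Holds] at v₂
      refine Run.op ⟨s₂.tmp _, k₂.tmp le_rfl _, ?_⟩
      simp only [Holds, Expr.eval, Op.apply, Function.update_self, v₂, o₂]
      rcases Bool.eq_false_or_eq_true (b.eval n s) with h | h <;> simp [h]
  | ex i b ih =>
    intro d s m hm
    have := run_loopCom (P := P) (n := n) (d := d) (i := i) (s := s) (m := m)
      (init := .op (.const (2 * (d + 3) + 2) 0))
      (body := .seq (b.comp (d + 4)) (.seq (.op (.const (2 * (d + 5) + 2) 1))
        (.cond (.eq (2 * (d + 4) + 2) (2 * (d + 5) + 2))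
          (.op (.const (2 * (d + 3) + 2) 1)) .skip)))
      (T := b.cost n + (1 + (1 + 1) + 1) + 1) (fun _ => s)
      (fun j m' => m'.reg (2 * (d + 3) + 2) =
        if ∃ l, l < j ∧ b.eval n (s.set i l) = true then 1 else 0) rfl ?_ ?_ ?_ ?_ hm
    · refine (Run.seq this (T₂ := 1) ?_).mono (by simp only [Expr.cost]; nlinarith) fun _ h => h
      rintro m₁ ⟨s₁, k₁, v₁⟩
      rw [Store.set_self] at s₁
      exact Run.op ⟨s₁.tmp _, k₁.tmp le_rfl _, by simpa [Holds, Op.apply, Expr.eval] using v₁⟩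
    · intro j m₁ v d' hd' h
      simp only [Function.update_apply]
      rw [if_neg (by omega), h]
    · intro j m₁ v h
      simp only [Function.update_apply]
      rw [if_neg (by omega), h]
    · intro m₁ s₁
      refine Run.op ⟨s₁.tmp _, (Keep.refl d _).tmp (by omega) _, ?_, by simp [Op.apply]⟩
      intro d' hd'
      simp only [Op.apply, Function.update_apply]
      rw [if_neg (by omega)]
    · intro j m₁ hj s₁ a₁ z₁
      refine Run.seq (ih (d + 4) _ m₁ s₁) ?_
      rintro m₂ ⟨s₂, k₂, v₂⟩
      have a₂ := (k₂.reg (d + 3) (by omega)).trans a₁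
      have step : (∃ l, l < j + 1 ∧ b.eval n (s.set i l) = true) ↔
          (b.eval n (s.set i j) = true ∨ ∃ l, l < j ∧ b.eval n (s.set i l) = true) := by
        constructor
        · rintro ⟨l, hl, h⟩
          rcases Nat.lt_succ_iff_lt_or_eq.1 hl with hl | rfl
          · exact Or.inr ⟨l, hl, h⟩
          · exact Or.inl h
        · rintro (h | ⟨l, hl, h⟩)
          · exact ⟨j, by omega, h⟩
          · exact ⟨l, by omega, h⟩
      have K : ∀ {m'}, Keep (d + 4) m₁ m' → Keep d m₁ m' := fun h =>
        (Keep.refl d m₁).trans h (by omega)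
      refine Run.seq (T₁ := 1) (T₂ := 1 + 1) (R := fun m₃ => Sim n (s.set i j) m₃ ∧ Keep (d + 4) m₂ m₃ ∧
          Holds (τ := .bool) (d + 4) (b.eval n (s.set i j)) m₃ ∧ m₃.reg (2 * (d + 5) + 2) = 1)
        (Run.op (o := .const (2 * (d + 5) + 2) 1)
          ⟨s₂.tmp _, (Keep.refl _ _).tmp (by omega) _, ?_, by simp [Op.apply]⟩) ?_
      · simpa [Holds, Op.apply] using v₂
      rintro m₃ ⟨s₃, k₃, v₃, o₃⟩
      have a₃ := (k₃.reg (d + 3) (by omega)).trans a₂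
      have kk := k₂.trans k₃ le_rfl
      simp only [Holds] at v₃
      refine Run.cond (fun h => ?_) (fun h => ?_)
      · rw [Test.eval_eq_iff, o₃, v₃] at h
        have hb : b.eval n (s.set i j) = true := by
          by_contra hb
          rw [if_neg hb] at h
          simp at h
        refine Run.op ⟨⟨j, s₃.tmp _⟩, (K kk).tmp (by omega) _, ?_, ?_⟩
        · intro d' hd'
          simp only [Op.apply, Function.update_apply]
          rw [if_neg (by omega)]
          exact kk.reg d' (by omega)
        · rw [if_pos (step.2 (Or.inl hb))]
          simp [Op.apply]
      · rw [Test.eval_eq_iff, o₃, v₃] at h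
        have hb : ¬ b.eval n (s.set i j) = true := by
          intro hb
          rw [if_pos hb] at h
          simp at h
        refine Run.skip ⟨⟨j, s₃⟩, K kk, fun d' hd' => kk.reg d' (by omega), ?_⟩
        rw [a₃]
        simp only [step, hb, false_or, Bool.false_eq_true]
  | qzero =>
    intro d s m hm
    exact Run.op ⟨hm.qtmp _, (Keep.refl d m).qtmp le_rfl _, by simp [Holds, Op.apply, Expr.eval]⟩
  | qarr A e ih =>
    intro d s m hm
    refine (Run.seq (ih d s m hm) (T₂ := 1) ?_).mono (by simp [Expr.cost]) fun _ h => h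
    rintro m₁ ⟨s₁, k₁, v₁⟩
    simp only [Holds] at v₁
    exact Run.op ⟨s₁.qtmp _, k₁.qtmp le_rfl _, by simp [Holds, Op.apply, Expr.eval, v₁, s₁.qarr]⟩
  | qadd e₁ e₂ ih₁ ih₂ =>
    intro d s m hm
    refine (bin ih₁ ih₂ hm (T := 1) ?_).mono (by simp only [Expr.cost]; omega) fun _ h => h
    intro m₁ s₁ k₁ v₁ v₂
    simp only [Holds] at v₁ v₂
    exact Run.op ⟨s₁.qtmp _, k₁.qtmp le_rfl _, by simp [Holds, Op.apply, Expr.eval, v₁, v₂]⟩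
  | qmax e₁ e₂ ih₁ ih₂ =>
    intro d s m hm
    refine (bin ih₁ ih₂ hm (T := 1 + 1) ?_).mono (by simp only [Expr.cost]; omega) fun _ h => h
    intro m₁ s₁ k₁ v₁ v₂
    simp only [Holds] at v₁ v₂
    refine Run.cond (fun h => Run.op ⟨s₁.qtmp _, k₁.qtmp le_rfl _, ?_⟩)
      (fun h => Run.skip ⟨s₁, k₁, ?_⟩)
    · rw [Test.eval_qlt_iff, v₁, v₂] at h
      simp only [Holds, Op.apply, Function.update_self, Expr.eval, v₂]
      exact (max_eq_right (of_decide_eq_true h).le).symm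
    · rw [Test.eval_qlt_iff, v₁, v₂] at h
      simp only [Holds, Expr.eval, v₁]
      exact (max_eq_left (not_lt.1 (of_decide_eq_false h))).symm
  | qite b e₁ e₂ ih ih₁ ih₂ =>
    intro d s m hm
    refine (Run.seq (ih d s m hm) (T₂ := 1 + ((e₁.cost n + e₂.cost n) + 1) + 1) ?_).mono
      (by simp only [Expr.cost]; omega) fun _ h => h
    rintro m₁ ⟨s₁, k₁, v₁⟩
    refine Run.branch s₁ k₁ v₁ (fun m' s' k' hv => ?_) (fun m' s' k' hv => ?_)
    · refine (ih₁ d s m' s').mono (by omega) fun m₂ ⟨s₂, k₂, v₂⟩ => ⟨s₂, k'.trans k₂ le_rfl, ?_⟩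
      simpa [Expr.eval, hv] using v₂
    · refine (ih₂ d s m' s').mono (by omega) fun m₂ ⟨s₂, k₂, v₂⟩ => ⟨s₂, k'.trans k₂ le_rfl, ?_⟩
      simpa [Expr.eval, hv] using v₂
  | qsum i e ih =>
    intro d s m hm
    have := run_loopCom (P := P) (n := n) (d := d) (i := i) (s := s) (m := m)
      (init := .op (.qconst d 0)) (body := .seq (e.comp (d + 4)) (.op (.qadd d d (d + 4))))
      (T := e.cost n + 1 + 1) (fun _ => s)
      (fun j m' => m'.qreg d = ∑ l ∈ Finset.range j, (e.eval n (s.set i l) : ℚ))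
      rfl (fun _ _ _ _ _ h => h) (fun _ _ _ h => h) ?_ ?_ hm
    · refine this.mono (by simp only [Expr.cost]; nlinarith) ?_
      rintro m₁ ⟨s₁, k₁, v₁⟩
      rw [Store.set_self] at s₁
      exact ⟨s₁, k₁, v₁⟩
    · intro m₁ s₁
      exact Run.op ⟨s₁.qtmp _, (Keep.refl d _).qtmp (by omega) _, fun _ _ => rfl,
        by simp [Op.apply]⟩
    · intro j m₁ hj s₁ a₁ z₁
      refine Run.seq (ih (d + 4) _ m₁ s₁) ?_
      rintro m₂ ⟨s₂, k₂, v₂⟩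
      have a₂ := (k₂.qreg d (by omega)).trans a₁
      simp only [Holds] at v₂
      refine Run.op ⟨⟨j, s₂.qtmp _⟩, ((Keep.refl d m₁).trans k₂ (by omega)).qtmp le_rfl _,
        fun d' hd' => k₂.reg d' (by omega), ?_⟩
      rw [Finset.sum_range_succ]
      simp [Op.apply, v₂, a₂]
  | qsup i e ih =>
    intro d s m hm
    have := run_loopCom (P := P) (n := n) (d := d) (i := i) (s := s) (m := m)
      (init := .op (.qconst d 0)) (body := .seq (e.comp (d + 4))
        (.cond (.qlt d (d + 4)) (.op (.qcopy d (d + 4))) .skip))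
      (T := e.cost n + (1 + 1) + 1) (fun _ => s)
      (fun j m' => m'.qreg d = supUpto (fun l => (e.eval n (s.set i l) : ℚ)) j)
      rfl (fun _ _ _ _ _ h => h) (fun _ _ _ h => h) ?_ ?_ hm
    · refine this.mono (by simp only [Expr.cost]; nlinarith) ?_
      rintro m₁ ⟨s₁, k₁, v₁⟩
      rw [Store.set_self] at s₁
      exact ⟨s₁, k₁, v₁⟩
    · intro m₁ s₁
      exact Run.op ⟨s₁.qtmp _, (Keep.refl d _).qtmp (by omega) _, fun _ _ => rfl,
        by simp [Op.apply, supUpto]⟩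
    · intro j m₁ hj s₁ a₁ z₁
      refine Run.seq (ih (d + 4) _ m₁ s₁) ?_
      rintro m₂ ⟨s₂, k₂, v₂⟩
      have a₂ := (k₂.qreg d (by omega)).trans a₁
      simp only [Holds] at v₂
      have k₃ : Keep d m₁ m₂ := (Keep.refl d m₁).trans k₂ (by omega)
      refine Run.cond (fun h => Run.op ⟨⟨j, s₂.qtmp _⟩, k₃.qtmp le_rfl _,
        fun d' hd' => k₂.reg d' (by omega), ?_⟩) (fun h => Run.skip ⟨⟨j, s₂⟩, k₃,
        fun d' hd' => k₂.reg d' (by omega), ?_⟩)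
      · rw [Test.eval_qlt_iff, v₂, a₂] at h
        simp only [Op.apply, Function.update_self, v₂, supUpto]
        exact (max_eq_right (of_decide_eq_true h).le).symm
      · rw [Test.eval_qlt_iff, v₂, a₂] at h
        simp only [a₂, supUpto]
        exact (max_eq_left (not_lt.1 (of_decide_eq_false h))).symm

theorem Stmt.run_comp (P : Program) (n : ℕ) (p : Stmt) : ∀ (d : ℕ) (s : Store) (m : Memory),
    Sim n s m → Run P (p.comp d) m (p.cost n)
      (fun m' => Sim n (p.den n s) m' ∧ Keep d m m') := by
  induction p with
  | skip => exact fun d s m hm => Run.skip ⟨hm, Keep.refl d m⟩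
  | setA A i e =>
    intro d s m hm
    refine (Run.seq (i.run_comp P n d s m hm) (T₂ := e.cost n + 1 + 1) ?_).mono
      (by simp only [Stmt.cost]; omega) fun _ h => h
    rintro m₁ ⟨s₁, k₁, v₁⟩
    refine Run.seq (e.run_comp P n (d + 1) s m₁ s₁) ?_
    rintro m₂ ⟨s₂, k₂, v₂⟩
    simp only [Holds] at v₁ v₂
    have v₃ := (k₂.reg d (by omega)).trans v₁
    refine Run.op ⟨⟨s₂.len, s₂.reg, ?_, s₂.qarr⟩, ⟨?_, ?_⟩⟩
    · simp [Op.apply, Stmt.den, Store.setA, s₂.arr, v₂, v₃]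
    · exact (k₁.trans k₂ (by omega)).reg
    · exact (k₁.trans k₂ (by omega)).qreg
  | setQ A i e =>
    intro d s m hm
    refine (Run.seq (i.run_comp P n d s m hm) (T₂ := e.cost n + 1 + 1) ?_).mono
      (by simp only [Stmt.cost]; omega) fun _ h => h
    rintro m₁ ⟨s₁, k₁, v₁⟩
    refine Run.seq (e.run_comp P n (d + 1) s m₁ s₁) ?_
    rintro m₂ ⟨s₂, k₂, v₂⟩
    simp only [Holds] at v₁ v₂
    have v₃ := (k₂.reg d (by omega)).trans v₁
    refine Run.op ⟨⟨s₂.len, s₂.reg, s₂.arr, ?_⟩, ⟨?_, ?_⟩⟩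
    · simp [Op.apply, Stmt.den, Store.setQ, s₂.qarr, v₂, v₃]
    · exact (k₁.trans k₂ (by omega)).reg
    · exact (k₁.trans k₂ (by omega)).qreg
  | seq p q ihp ihq =>
    intro d s m hm
    refine Run.seq (ihp d s m hm) ?_
    rintro m₁ ⟨s₁, k₁⟩
    exact (ihq d _ m₁ s₁).mono le_rfl fun m₂ ⟨s₂, k₂⟩ => ⟨s₂, k₁.trans k₂ le_rfl⟩
  | ite b p q ihp ihq =>
    intro d s m hm
    refine (Run.seq (b.run_comp P n d s m hm) (T₂ := 1 + ((p.cost n + q.cost n) + 1) + 1) ?_).mono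
      (by simp only [Stmt.cost]; omega) fun _ h => h
    rintro m₁ ⟨s₁, k₁, v₁⟩
    refine Run.branch s₁ k₁ v₁ (fun m' s' k' hv => ?_) (fun m' s' k' hv => ?_)
    · refine (ihp d s m' s').mono (by omega) fun m₂ ⟨s₂, k₂⟩ => ⟨?_, k'.trans k₂ le_rfl⟩
      simpa [Stmt.den, hv] using s₂
    · refine (ihq d s m' s').mono (by omega) fun m₂ ⟨s₂, k₂⟩ => ⟨?_, k'.trans k₂ le_rfl⟩
      simpa [Stmt.den, hv] using s₂
  | forN i p ih =>
    intro d s m hm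
    have := run_loopCom (P := P) (n := n) (d := d) (i := i) (s := s) (m := m)
      (init := .skip) (body := p.comp (d + 4)) (T := p.cost n)
      (iter (fun j s' => p.den n (s'.set i j)) · s) (fun _ _ => True) rfl
      (fun _ _ _ _ _ h => h) (fun _ _ _ h => h) ?_ ?_ hm
    · exact this.mono (by simp only [Stmt.cost]; nlinarith) fun m' h => ⟨h.1, h.2.1⟩
    · exact fun m₁ s₁ => Run.skip ⟨s₁, Keep.refl _ _, fun _ _ => rfl, trivial⟩
    · intro j m₁ hj s₁ a₁ z₁
      refine (ih (d + 4) _ m₁ s₁).mono le_rfl ?_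
      rintro m₂ ⟨s₂, k₂⟩
      refine ⟨⟨(p.den n ((iter (fun j s' => p.den n (s'.set i j)) j s).set i j)).reg i, ?_⟩,
        (Keep.refl d m₁).trans k₂ (by omega), fun d' hd' => k₂.reg d' (by omega), trivial⟩
      simp only [iter]
      rw [Store.set_self]
      exact s₂

/-! ### Modules, four-vertex paths, and maximal connected sets missed by a vertex -/

section Structure

variable {V : Type*} {G : SimpleGraph V}

/-- Every vertex outside `S` is adjacent to all of `S` or to nothing in `S`. -/
def IsModule (G : SimpleGraph V) (S : Set V) : Prop :=
  ∀ v ∉ S, (∀ x ∈ S, G.Adj v x) ∨ (∀ x ∈ S, ¬ G.Adj v x)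

/-- All modules are trivial. -/
def IsPrimeGraph (G : SimpleGraph V) : Prop :=
  ∀ S, IsModule G S → S.Subsingleton ∨ S = Set.univ

/-- The subgraph induced on `S` is connected. -/
def ConnSet (G : SimpleGraph V) (S : Set V) : Prop :=
  ∀ T ⊆ S, T.Nonempty → (∀ x ∈ T, ∀ y ∈ S, G.Adj x y → y ∈ T) → S ⊆ T

/-- No chair with centre `a`, leaves `b`, `c` and long leg `d e`. -/
def ChairFree (G : SimpleGraph V) : Prop :=
  ∀ a b c d e, G.Adj a b → G.Adj a c → G.Adj a d → G.Adj d e → ¬ G.Adj b c → ¬ G.Adj b d →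
    ¬ G.Adj c d → ¬ G.Adj a e → ¬ G.Adj b e → ¬ G.Adj c e → b = c

/-- No bull with triangle `a b c` and horns `d` at `a` and `e` at `b`. -/
def BullFree (G : SimpleGraph V) : Prop :=
  ∀ a b c d e, G.Adj a b → G.Adj a c → G.Adj b c → G.Adj a d → G.Adj b e → ¬ G.Adj d b →
    ¬ G.Adj d c → ¬ G.Adj e a → ¬ G.Adj e c → G.Adj d e

/-- `b a x w` is an induced path. -/
structure IsP4 (G : SimpleGraph V) (b a x w : V) : Prop where
  ba : G.Adj b a
  ax : G.Adj a x
  xw : G.Adj x w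
  bx : ¬ G.Adj b x
  bw : ¬ G.Adj b w
  aw : ¬ G.Adj a w

/-- Suppose `v` misses `b`. If `v` sees `x`, the triangle `a x v` with horns `b` and `w` is a bull;
otherwise `a` with leaves `b`, `v` and the long leg `x w` is a chair. -/
theorem IsP4.adj_of_adj_second {b a x w v : V} (h : IsP4 G b a x w) (hc : ChairFree G)
    (hb : BullFree G) (va : G.Adj v a) (vw : ¬ G.Adj v w) (ne : v ≠ b) : G.Adj v b := by
  by_contra vb
  by_cases vx : G.Adj v x
  · exact h.bw (hb a x v b w h.ax va.symm vx.symm h.ba.symm h.xw h.bx (fun e => vb e.symm)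
      (fun e => h.aw e.symm) (fun e => vw e.symm))
  · exact ne (hc a b v x w h.ba.symm va.symm h.ax h.xw (fun e => vb e.symm) h.bx vx h.aw h.bw vw).symm

/-- If `v` also sees `a`, this is the previous case. Otherwise missing `b` would give a chair with
centre `x`, leaves `w`, `v` and long leg `a b`. -/
theorem IsP4.adj_of_adj_third {b a x w v : V} (h : IsP4 G b a x w) (hc : ChairFree G)
    (hb : BullFree G) (vx : G.Adj v x) (vw : ¬ G.Adj v w) (ne : v ≠ w) : G.Adj v b := by
  by_cases va : G.Adj v a
  · exact h.adj_of_adj_second hc hb va vw (by rintro rfl; exact h.bx vx)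
  · by_contra vb
    exact ne (hc x w v a b h.xw vx.symm h.ax.symm h.ba.symm (fun e => vw e.symm)
      (fun e => h.aw e.symm) va (fun e => h.bx e.symm) (fun e => h.bw e.symm) vb).symm

theorem connSet_singleton (a : V) : ConnSet G {a} := by
  rintro T hT ⟨x, hx⟩ - y rfl
  obtain rfl := hT hx
  exact hx

theorem ConnSet.insert {S : Set V} (h : ConnSet G S) {x p : V} (hp : p ∈ S) (hx : G.Adj x p) :
    ConnSet G (insert x S) := by
  intro T hT hne hcl
  have key : (T ∩ S).Nonempty → S ⊆ T := by
    intro hne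
    have := h (T ∩ S) Set.inter_subset_right hne
      (fun u hu v hv huv => ⟨hcl u hu.1 v (Or.inr hv) huv, hv⟩)
    exact fun v hv => (this hv).1
  have hS : S ⊆ T := by
    obtain ⟨t, ht⟩ := hne
    rcases hT ht with rfl | hs
    · exact key ⟨p, hcl _ ht p (Or.inr hp) hx, hp⟩
    · exact key ⟨t, ht, hs⟩
  rintro v (rfl | hv)
  · exact hcl p (hS hp) _ (Or.inl rfl) hx.symm
  · exact hS hv

/-- Otherwise the neighbours of `x` in `S` would be closed under adjacency inside `S`, hence all of
`S`. -/
theorem ConnSet.exists_mixed_edge {S : Set V} (h : ConnSet G S) {x p q : V} (hp : p ∈ S)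
    (hq : q ∈ S) (xp : G.Adj x p) (xq : ¬ G.Adj x q) :
    ∃ a ∈ S, ∃ b ∈ S, G.Adj x a ∧ ¬ G.Adj x b ∧ G.Adj a b := by
  by_contra hcon
  push Not at hcon
  have := h {v ∈ S | G.Adj x v} (fun v hv => hv.1) ⟨p, hp, xp⟩ (fun u hu v hv huv =>
    ⟨hv, by by_contra hxv; exact hcon u hu.1 v hv hu.2 hxv huv⟩)
  exact xq (this hq).2

theorem IsPrimeGraph.exists_mixed (h : IsPrimeGraph G) {S : Set V} {a b z : V} (ha : a ∈ S)
    (hb : b ∈ S) (hab : a ≠ b) (hz : z ∉ S) :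
    ∃ x ∉ S, ∃ p ∈ S, ∃ q ∈ S, G.Adj x p ∧ ¬ G.Adj x q := by
  by_contra hcon
  push Not at hcon
  have hm : IsModule G S := by
    intro v hv
    by_cases hex : ∃ x ∈ S, G.Adj v x
    · obtain ⟨p, hp, hvp⟩ := hex
      exact Or.inl fun x hx => hcon v hv p hp x hx hvp
    · push Not at hex
      exact Or.inr hex
  rcases h S hm with h | h
  · exact hab (h ha hb)
  · exact hz (h ▸ Set.mem_univ z)

/-- The vertices outside `B` without neighbours in `B`. -/
def antiNbhd (G : SimpleGraph V) (B : Set V) : Set V := {v | v ∉ B ∧ ∀ p ∈ B, ¬ G.Adj v p}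

/-- The situation studied below: a connected set `B`, maximal with the property that some vertex
outside has no neighbour in it. -/
structure IsMaxAnti (G : SimpleGraph V) (B : Set V) (z : V) : Prop where
  conn : ConnSet G B
  mem : z ∈ antiNbhd G B
  complete : ∀ v ∉ B, ∀ p ∈ B, G.Adj v p → ∀ m ∈ antiNbhd G B, G.Adj v m

/-- Adding to a maximal `B` a vertex `v` with a neighbour in `B` keeps it connected, so by
maximality no member of `antiNbhd G B` may survive: `v` must see all of them. -/
theorem exists_isMaxAnti [Finite V] {Q : Set V} {z : V} (hQ : ConnSet G Q)
    (hz : z ∈ antiNbhd G Q) : ∃ B z, Q ⊆ B ∧ IsMaxAnti G B z := by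
  obtain ⟨B, hB, hmax⟩ := (Set.toFinite {B : Set V | ConnSet G B ∧ (antiNbhd G B).Nonempty}).exists_le_maximal
    (a := Q) ⟨hQ, z, hz⟩
  obtain ⟨hconn, z', hz'⟩ := hmax.prop
  refine ⟨B, z', hB, hconn, hz', fun v hv p hp hvp m hm => ?_⟩
  by_contra hvm
  have : insert v B ≤ B := hmax.le_of_ge ⟨hconn.insert hp hvp, m, ?_, ?_⟩ (Set.subset_insert v B)
  · exact hv (this (Set.mem_insert v B))
  · rintro (rfl | h)
    · exact hm.2 p hp hvp
    · exact hm.1 h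
  · rintro q (rfl | hq)
    · exact fun h => hvm h.symm
    · exact hm.2 q hq

/-- A prime chair-free graph with a co-diamond has an induced path on four vertices together with
a vertex that has no neighbour on it. -/
theorem exists_isP4_anti [Finite V] (hp : IsPrimeGraph G) (hc : ChairFree G) {u v w₁ w₂ : V}
    (uv : G.Adj u v) (hw : ¬ G.Adj w₁ w₂) (hne : w₁ ≠ w₂) (h₁ : ¬ G.Adj w₁ u) (h₂ : ¬ G.Adj w₁ v)
    (h₃ : ¬ G.Adj w₂ u) (h₄ : ¬ G.Adj w₂ v) :
    ∃ b a x w z, IsP4 G b a x w ∧ z ∈ antiNbhd G {b, a, x, w} := by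
  have hu₁ : w₁ ≠ u := by rintro rfl; exact h₂ uv
  have hv₁ : w₁ ≠ v := by rintro rfl; exact h₁ uv.symm
  have hu₂ : w₂ ≠ u := by rintro rfl; exact h₄ uv
  have hv₂ : w₂ ≠ v := by rintro rfl; exact h₃ uv.symm
  -- Take `A` maximal among the connected sets containing the edge whose antineighbourhood still has
  -- two nonadjacent vertices, and an outside vertex `x` mixed on an edge `a b` of `A`. It sees one
  -- of the two, or it could be added to `A`, and not both, or there is a chair with centre `x` and
  -- long leg `a b`. The one that it sees completes the path, the other one misses it.
  obtain ⟨A, hA, hmax⟩ := (Set.toFinite {A : Set V | ConnSet G A ∧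
      ∃ w₁ ∈ antiNbhd G A, ∃ w₂ ∈ antiNbhd G A, w₁ ≠ w₂ ∧ ¬ G.Adj w₁ w₂}).exists_le_maximal
    (a := {u, v}) ⟨(connSet_singleton v).insert rfl uv, w₁, by simp [antiNbhd, *], w₂,
      by simp [antiNbhd, *], hne, hw⟩
  obtain ⟨hconn, w₁, m₁, w₂, m₂, hne, hw⟩ := hmax.prop
  obtain ⟨x, hx, p, hpA, q, hq, xp, xq⟩ := hp.exists_mixed (hA (Or.inl rfl)) (hA (Or.inr rfl))
    uv.ne m₁.1
  obtain ⟨a, ha, b, hb, xa, xb, ab⟩ := hconn.exists_mixed_edge hpA hq xp xq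
  have key : ∀ w₁ ∈ antiNbhd G A, ∀ w₂ ∈ antiNbhd G A, w₁ ≠ w₂ → ¬ G.Adj w₁ w₂ → G.Adj x w₁ →
      ∃ b a x w z, IsP4 G b a x w ∧ z ∈ antiNbhd G {b, a, x, w} := by
    intro w₁ m₁ w₂ m₂ hne hw xw₁
    have xw₂ : ¬ G.Adj x w₂ := fun xw₂ =>
      hne (hc x w₁ w₂ a b xw₁ xw₂ xa ab hw (m₁.2 a ha) (m₂.2 a ha) xb (m₁.2 b hb) (m₂.2 b hb))
    refine ⟨b, a, x, w₁, w₂, ⟨ab.symm, xa.symm, xw₁, fun h => xb h.symm,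
      fun h => m₁.2 b hb h.symm, fun h => m₁.2 a ha h.symm⟩, ?_, ?_⟩
    · rintro (rfl | rfl | rfl | rfl)
      · exact m₂.1 hb
      · exact m₂.1 ha
      · exact m₂.2 a ha xa
      · exact hne rfl
    · rintro q (rfl | rfl | rfl | rfl)
      · exact m₂.2 _ hb
      · exact m₂.2 _ ha
      · exact fun h => xw₂ h.symm
      · exact fun h => hw h.symm
  by_cases xw₁ : G.Adj x w₁
  · exact key w₁ m₁ w₂ m₂ hne hw xw₁
  · by_cases xw₂ : G.Adj x w₂
    · exact key w₂ m₂ w₁ m₁ hne.symm (fun h => hw h.symm) xw₂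
    · exfalso
      have aux : ∀ w ∈ antiNbhd G A, ¬ G.Adj x w → w ∈ antiNbhd G (insert x A) := by
        intro w m xw
        refine ⟨?_, ?_⟩
        · rintro (rfl | h)
          · exact m.2 p hpA xp
          · exact m.1 h
        · rintro q (rfl | hq)
          · exact fun h => xw h.symm
          · exact m.2 q hq
      have : insert x A ≤ A := hmax.le_of_ge ⟨hconn.insert hpA xp, w₁, aux _ m₁ xw₁, w₂,
        aux _ m₂ xw₂, hne, hw⟩ (Set.subset_insert x A)
      exact hx (this (Set.mem_insert x A))

namespace IsMaxAnti

variable {B : Set V} {z : V}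

theorem isP4 (h : IsMaxAnti G B z) {y a b : V} (hy : y ∉ B) (ha : a ∈ B) (hb : b ∈ B)
    (ya : G.Adj y a) (yb : ¬ G.Adj y b) (ab : G.Adj a b) : IsP4 G b a y z :=
  ⟨ab.symm, ya.symm, h.complete y hy a ha ya z h.mem, fun e => yb e.symm,
    fun e => h.mem.2 b hb e.symm, fun e => h.mem.2 a ha e.symm⟩

theorem adj_of_adj_mixed (h : IsMaxAnti G B z) (hc : ChairFree G) (hbf : BullFree G) {y a b c : V}
    (hy : y ∉ B) (ha : a ∈ B) (hb : b ∈ B) (hcB : c ∈ B) (ya : G.Adj y a) (yb : ¬ G.Adj y b)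
    (ab : G.Adj a b) (yc : G.Adj y c) : G.Adj c b :=
  (h.isP4 hy ha hb ya yb ab).adj_of_adj_third hc hbf yc.symm (fun e => h.mem.2 c hcB e.symm)
    (by rintro rfl; exact h.mem.1 hcB)

theorem adj_of_adj_inner (h : IsMaxAnti G B z) (hc : ChairFree G) (hbf : BullFree G) {y a b c : V}
    (hy : y ∉ B) (ha : a ∈ B) (hb : b ∈ B) (hcB : c ∈ B) (ya : G.Adj y a) (yb : ¬ G.Adj y b)
    (ab : G.Adj a b) (ca : G.Adj c a) (ne : c ≠ b) : G.Adj c b :=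
  (h.isP4 hy ha hb ya yb ab).adj_of_adj_second hc hbf ca (fun e => h.mem.2 c hcB e.symm) ne

/-- In a prime graph, a maximal set `B` that contains an induced four-vertex path induces a
subgraph without universal vertices. -/
theorem not_universal (h : IsMaxAnti G B z) (hp : IsPrimeGraph G) (hc : ChairFree G)
    (hbf : BullFree G) {q₁ q₂ q₃ q₄ : V} (hQ : IsP4 G q₁ q₂ q₃ q₄) (h₁ : q₁ ∈ B) (h₂ : q₂ ∈ B)
    (h₃ : q₃ ∈ B) (h₄ : q₄ ∈ B) {e : V} (he : e ∈ B) : ∃ g ∈ B, g ≠ e ∧ ¬ G.Adj g e := by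
  by_contra huniv
  push Not at huniv
  -- `U` collects the universal vertices of `B`; by assumption `e` is one of them.
  let U : Set V := {u ∈ B | ∀ g ∈ B, g ≠ u → G.Adj g u}
  -- On a mixed edge of `B`, the end that the outside vertex misses is universal. Thus adjacency to
  -- an outside vertex spreads along edges of `B` to nonuniversal vertices.
  have memU : ∀ {y a b : V}, y ∉ B → a ∈ B → b ∈ B → G.Adj y a → ¬ G.Adj y b → G.Adj a b →
      b ∈ U := by
    intro y a b hy ha hb ya yb ab
    refine ⟨hb, fun g hg hgb => ?_⟩
    by_cases yg : G.Adj y g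
    · exact h.adj_of_adj_mixed hc hbf hy ha hb hg ya yb ab yg
    by_cases ga : G.Adj g a
    · exact h.adj_of_adj_inner hc hbf hy ha hb hg ya yb ab ga hgb
    have hea : a ≠ e := by
      rintro rfl
      exact ga (huniv g hg (by rintro rfl; exact yg ya))
    by_cases ye : G.Adj y e
    · have hge : G.Adj g e := huniv g hg (by rintro rfl; exact yg ye)
      have heb : G.Adj e b := (huniv b hb (by rintro rfl; exact yb ye)).symm
      exact h.adj_of_adj_inner hc hbf hy he hb hg ye yb heb hge hgb
    · by_cases hbe : b = e
      · rw [hbe]; exact huniv g hg (by rintro rfl; exact hgb hbe.symm)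
      by_cases hge : g = e
      · rw [hge]; exact (huniv b hb hbe).symm
      have P : IsP4 G g e a y := ⟨huniv g hg hge, (huniv a ha hea).symm, ya.symm, ga,
        fun e => yg e.symm, fun h' => ye h'.symm⟩
      exact (P.adj_of_adj_second hc hbf (huniv b hb hbe) (fun h' => yb h'.symm)
        (fun h' => hgb h'.symm)).symm
  -- If `y` misses the universal vertex `e`, then `g' e a y` is an induced path, and `g` sees its
  -- second vertex.
  have clique : ∀ {y a g g' : V}, y ∉ B → a ∈ B → G.Adj y a → g ∈ B → g ∉ U → g' ∈ B → g' ∉ U →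
      ¬ G.Adj y g → ¬ G.Adj y g' → g ≠ g' → G.Adj g g' := by
    intro y a g g' hy ha ya hg gU hg' gU' yg yg' hne
    have hge : g ≠ e := by rintro rfl; exact gU ⟨he, huniv⟩
    have hge' : g' ≠ e := by rintro rfl; exact gU' ⟨he, huniv⟩
    by_cases ye : G.Adj y e
    · exact absurd (memU hy he hg ye yg (huniv g hg hge).symm) gU
    · have hae : a ≠ e := by rintro rfl; exact ye ya
      have ga : ¬ G.Adj g a := fun ga => gU (memU hy ha hg ya yg ga.symm)
      have ga' : ¬ G.Adj g' a := fun ga => gU' (memU hy ha hg' ya yg' ga.symm)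
      have P : IsP4 G g' e a y := ⟨huniv g' hg' hge', (huniv a ha hae).symm, ya.symm, ga',
        fun e => yg' e.symm, fun h' => ye h'.symm⟩
      exact P.adj_of_adj_second hc hbf (huniv g hg hge) (fun h' => yg h'.symm) hne
  have q₁₃ : q₁ ≠ q₃ := by rintro rfl; exact hQ.bw hQ.xw
  have q₁₄ : q₁ ≠ q₄ := by rintro rfl; exact hQ.aw hQ.ba.symm
  have q₂₄ : q₂ ≠ q₄ := by rintro rfl; exact hQ.bw hQ.ba
  have U₁ : q₁ ∉ U := fun hu => hQ.bx (hu.2 q₃ h₃ q₁₃.symm).symm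
  have U₂ : q₂ ∉ U := fun hu => hQ.aw (hu.2 q₄ h₄ q₂₄.symm).symm
  have U₃ : q₃ ∉ U := fun hu => hQ.bx (hu.2 q₁ h₁ q₁₃)
  have U₄ : q₄ ∉ U := fun hu => hQ.bw (hu.2 q₁ h₁ q₁₄)
  -- `J` is designed to be a module: universal vertices of `B` see all of it, other vertices of `B`
  -- outside `J` see none of it by `memU`, and a vertex outside `B` sees all of `J` or nothing in
  -- `B`. It contains the path but not `z`, against primality.
  let J : Set V := {v ∈ B | v ∉ U ∧ ∀ y ∉ B, ∀ a ∈ B, G.Adj y a → G.Adj y v}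
  -- By `clique`, `y` cannot miss both of the nonadjacent vertices `q₁` and `q₃`. From the one it
  -- sees, adjacency spreads along the path, whose vertices are all nonuniversal.
  have QJ : ∀ {y a : V}, y ∉ B → a ∈ B → G.Adj y a →
      G.Adj y q₁ ∧ G.Adj y q₂ ∧ G.Adj y q₃ ∧ G.Adj y q₄ := by
    intro y a hy ha ya
    have prop : ∀ {p q : V}, p ∈ B → q ∈ B → q ∉ U → G.Adj p q → G.Adj y p → G.Adj y q := by
      intro p q hp hq qU pq yp
      by_contra yq
      exact qU (memU hy hp hq yp yq pq)
    have hex : G.Adj y q₁ ∨ G.Adj y q₃ := by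
      by_contra hcon
      push Not at hcon
      exact hQ.bx (clique hy ha ya h₁ U₁ h₃ U₃ hcon.1 hcon.2 q₁₃)
    have y₂ : G.Adj y q₂ := by
      rcases hex with h' | h'
      · exact prop h₁ h₂ U₂ hQ.ba h'
      · exact prop h₃ h₂ U₂ hQ.ax.symm h'
    have y₃ := prop h₂ h₃ U₃ hQ.ax y₂
    exact ⟨prop h₂ h₁ U₁ hQ.ba.symm y₂, y₂, y₃, prop h₃ h₄ U₄ hQ.xw y₃⟩
  have mod : IsModule G J := by
    intro v hv
    by_cases hvB : v ∈ B
    · by_cases hvU : v ∈ U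
      · left
        intro x hx
        exact (hvU.2 x hx.1 (by rintro rfl; exact hx.2.1 hvU)).symm
      · right
        intro x hx hvx
        apply hv
        refine ⟨hvB, hvU, fun y hy a ha ya => ?_⟩
        by_contra yv
        exact hvU (memU hy hx.1 hvB (hx.2.2 y hy a ha ya) yv hvx.symm)
    · by_cases hex : ∃ a ∈ B, G.Adj v a
      · obtain ⟨a, ha, va⟩ := hex
        exact Or.inl fun x hx => hx.2.2 v hvB a ha va
      · push Not at hex
        exact Or.inr fun x hx => hex x hx.1
  rcases hp J mod with hJ | hJ
  · exact q₁₃ (hJ ⟨h₁, U₁, fun y hy a ha ya => (QJ hy ha ya).1⟩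
      ⟨h₃, U₃, fun y hy a ha ya => (QJ hy ha ya).2.2.1⟩)
  · have : z ∈ J := hJ ▸ Set.mem_univ z
    exact h.mem.1 this.1

end IsMaxAnti

end Structure

/-! ### Distance levels, and the degree bound for prime graphs with a co-diamond -/

section Levels

variable {V : Type*} {G : SimpleGraph V}

/-- A distance function from `z` on the connected set `E`, where `y` is the only neighbour
of `z`. -/
structure IsLevel (G : SimpleGraph V) (E : Set V) (z y : V) (l : V → ℕ) : Prop where
  zero : ∀ v ∈ E, l v = 0 → v = z
  one : ∀ v ∈ E, l v = 1 → v = y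
  le : ∀ u ∈ E, ∀ v ∈ E, G.Adj u v → l v ≤ l u + 1
  pred : ∀ v ∈ E, ∀ m, l v = m + 1 → ∃ u ∈ E, G.Adj u v ∧ l u = m

theorem exists_isLevel {B : Set V} {z y a : V} (hB : ConnSet G B) (hz : z ∉ B)
    (hzB : ∀ p ∈ B, ¬ G.Adj z p) (yz : G.Adj y z) (ha : a ∈ B) (ya : G.Adj y a) :
    ∃ l, IsLevel G (insert z (insert y B)) z y l ∧ l z = 0 ∧ l y = 1 ∧ ∀ v ∈ B, v ≠ y → 2 ≤ l v := by
  set E : Set V := insert z (insert y B) with hE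
  -- Only the edges inside `E` are kept; distances from `z` in this graph are the levels, and `y` is
  -- the only neighbour of `z` because `z` misses `B`.
  let H : SimpleGraph V :=
    { Adj := fun u v => G.Adj u v ∧ u ∈ E ∧ v ∈ E
      symm := ⟨fun u v h => ⟨h.1.symm, h.2.2, h.2.1⟩⟩
      loopless := ⟨fun u h => G.loopless.irrefl u h.1⟩ }
  have hzE : z ∈ E := Or.inl rfl
  have hyE : y ∈ E := Or.inr (Or.inl rfl)
  have hBE : ∀ v ∈ B, v ∈ E := fun v hv => Or.inr (Or.inr hv)
  have hzy : H.Adj z y := ⟨yz.symm, hzE, hyE⟩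
  have hreachB : ∀ v ∈ B, H.Reachable z v := by
    have := hB {v ∈ B | H.Reachable z v} (fun v hv => hv.1)
      ⟨a, ha, hzy.reachable.trans (SimpleGraph.Adj.reachable ⟨ya, hyE, hBE a ha⟩)⟩
      (fun u hu v hv huv => ⟨hv, hu.2.trans (SimpleGraph.Adj.reachable
        ⟨huv, hBE u hu.1, hBE v hv⟩)⟩)
    exact fun v hv => (this hv).2
  have hreach : ∀ v ∈ E, H.Reachable z v := by
    rintro v (rfl | rfl | hv)
    · exact SimpleGraph.Reachable.refl _
    · exact hzy.reachable
    · exact hreachB v hv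
  have hle : ∀ u ∈ E, ∀ v ∈ E, G.Adj u v → H.dist z v ≤ H.dist z u + 1 := by
    intro u hu v hv huv
    obtain ⟨p, hp⟩ := (hreach u hu).exists_walk_length_eq_dist
    have := SimpleGraph.dist_le (p.concat (show H.Adj u v from ⟨huv, hu, hv⟩))
    rwa [SimpleGraph.Walk.length_concat, hp] at this
  have hpred : ∀ v ∈ E, ∀ m, H.dist z v = m + 1 → ∃ u ∈ E, G.Adj u v ∧ H.dist z u = m := by
    intro v hv m hm
    obtain ⟨p, hp⟩ := (hreach v hv).symm.exists_walk_length_eq_dist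
    rw [SimpleGraph.dist_comm, hm] at hp
    cases p with
    | nil => simp at hp
    | @cons _ u _ h q =>
      rw [SimpleGraph.Walk.length_cons] at hp
      refine ⟨u, h.2.2, h.1.symm, ?_⟩
      have h₁ := SimpleGraph.dist_le q
      have h₂ := hle u h.2.2 v hv h.1.symm
      rw [SimpleGraph.dist_comm] at h₁
      omega
  have hzero : ∀ v ∈ E, H.dist z v = 0 → v = z := fun v hv h =>
    ((hreach v hv).dist_eq_zero_iff.1 h).symm
  have hone : ∀ v ∈ E, H.dist z v = 1 → v = y := by
    intro v hv h
    obtain ⟨u, hu, huv, h0⟩ := hpred v hv 0 h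
    obtain rfl := hzero u hu h0
    rcases hv with rfl | rfl | hv
    · exact absurd huv (G.loopless.irrefl _)
    · rfl
    · exact absurd huv (hzB v hv)
  refine ⟨fun v => H.dist z v, ⟨hzero, hone, hle, hpred⟩, SimpleGraph.dist_self,
    SimpleGraph.dist_eq_one_iff_adj.2 hzy, fun v hv hvy => ?_⟩
  by_contra hlt
  have : H.dist z v = 0 ∨ H.dist z v = 1 := by
    have : ¬ 2 ≤ H.dist z v := hlt
    omega
  rcases this with h | h
  · exact hz (hzero v (hBE v hv) h ▸ hv)
  · exact hvy (hone v (hBE v hv) h)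

namespace IsLevel

variable {E : Set V} {z y : V} {l : V → ℕ}

theorem not_adj (h : IsLevel G E z y l) {u v : V} (hu : u ∈ E) (hv : v ∈ E) (huv : l u + 2 ≤ l v) :
    ¬ G.Adj u v := by
  intro e
  have := h.le u hu v hv e
  omega

theorem not_adj' (h : IsLevel G E z y l) {u v : V} (hu : u ∈ E) (hv : v ∈ E) (huv : l u + 2 ≤ l v) :
    ¬ G.Adj v u :=
  fun e => h.not_adj hu hv huv e.symm

/-- Consecutive levels are completely joined. -/
theorem adj_succ (h : IsLevel G E z y l) (hc : ChairFree G) (hb : BullFree G) :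
    ∀ m, ∀ u ∈ E, ∀ v ∈ E, l u = m + 1 → l v = m + 2 → G.Adj u v := by
  intro m
  induction m with
  | zero =>
    intro u hu v hv lu lv
    obtain ⟨w, hw, wv, lw⟩ := h.pred v hv 1 lv
    rw [h.one u hu lu, ← h.one w hw lw]
    exact wv
  | succ m ih =>
    intro u hu v hv lu lv
    obtain ⟨a, ha, av, la⟩ := h.pred v hv (m + 2) lv
    obtain ⟨x, hx, xa, lx⟩ := h.pred a ha (m + 1) la
    obtain ⟨w, hw, wx, lw⟩ := h.pred x hx m lx
    -- The path descends one level per step from `v`. By induction `u`, which lies on the level of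
    -- `a`, sees `x`, the third vertex, and it misses `w` for distance reasons; so it sees `v`.
    have P : IsP4 G v a x w := ⟨av.symm, xa.symm, wx.symm, h.not_adj' hx hv (by omega),
      h.not_adj' hw hv (by omega), h.not_adj' hw ha (by omega)⟩
    exact P.adj_of_adj_third hc hb (ih x hx u hu lx lu).symm (h.not_adj' hw hu (by omega))
      (by rintro rfl; omega)

/-- Levels from the third on are cliques. -/
theorem adj_same (h : IsLevel G E z y l) (hc : ChairFree G) (hb : BullFree G) {u v : V}
    (hu : u ∈ E) (hv : v ∈ E) (huv : l u = l v) (h3 : 3 ≤ l v) (ne : u ≠ v) : G.Adj u v := by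
  obtain ⟨m, hm⟩ : ∃ m, l v = m + 3 := ⟨l v - 3, by omega⟩
  obtain ⟨a, ha, av, la⟩ := h.pred v hv (m + 2) hm
  obtain ⟨x, hx, xa, lx⟩ := h.pred a ha (m + 1) la
  obtain ⟨w, hw, wx, lw⟩ := h.pred x hx m lx
  have P : IsP4 G v a x w := ⟨av.symm, xa.symm, wx.symm, h.not_adj' hx hv (by omega),
    h.not_adj' hw hv (by omega), h.not_adj' hw ha (by omega)⟩
  exact P.adj_of_adj_second hc hb (h.adj_succ hc hb (m + 1) a ha u hu la (by omega)).symm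
    (h.not_adj' hw hu (by omega)) ne

theorem exists_level (h : IsLevel G E z y l) {v : V} (hv : v ∈ E) {m : ℕ} (hm : m ≤ l v) :
    ∃ u ∈ E, l u = m := by
  obtain ⟨d, hd⟩ := Nat.exists_eq_add_of_le hm
  induction d generalizing v with
  | zero => exact ⟨v, hv, by omega⟩
  | succ d ih =>
    obtain ⟨u, hu, -, lu⟩ := h.pred v hv (m + d) (by omega)
    exact ih hu (by omega) lu

end IsLevel

/-- A prime (bull, chair)-free graph with a co-diamond has maximum degree at most two. -/
theorem degree_le_two [Finite V] (hp : IsPrimeGraph G) (hc : ChairFree G) (hbf : BullFree G)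
    {u v w₁ w₂ : V} (uv : G.Adj u v) (hw : ¬ G.Adj w₁ w₂) (hne : w₁ ≠ w₂) (hu₁ : ¬ G.Adj w₁ u)
    (hv₁ : ¬ G.Adj w₁ v) (hu₂ : ¬ G.Adj w₂ u) (hv₂ : ¬ G.Adj w₂ v) {c x₁ x₂ x₃ : V}
    (cx₁ : G.Adj c x₁) (cx₂ : G.Adj c x₂) (cx₃ : G.Adj c x₃) (h₁₂ : x₁ ≠ x₂) (h₁₃ : x₁ ≠ x₃)
    (h₂₃ : x₂ ≠ x₃) : False := by
  obtain ⟨q₁, q₂, q₃, q₄, z₀, hQ, hz₀⟩ := exists_isP4_anti hp hc uv hw hne hu₁ hv₁ hu₂ hv₂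
  have hQc : ConnSet G {q₁, q₂, q₃, q₄} :=
    (((connSet_singleton q₄).insert rfl hQ.xw).insert (Or.inl rfl) hQ.ax).insert (Or.inl rfl) hQ.ba
  obtain ⟨B, z, hQB, hB⟩ := exists_isMaxAnti hQc hz₀
  have h₁ : q₁ ∈ B := hQB (by simp)
  have h₂ : q₂ ∈ B := hQB (by simp)
  have h₃ : q₃ ∈ B := hQB (by simp)
  have h₄ : q₄ ∈ B := hQB (by simp)
  have nouniv : ∀ e ∈ B, ∃ g ∈ B, g ≠ e ∧ ¬ G.Adj g e := fun e he =>
    hB.not_universal hp hc hbf hQ h₁ h₂ h₃ h₄ he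
  obtain ⟨y, hy, a₀, ha₀, b₀, hb₀, ya₀, yb₀⟩ := hp.exists_mixed h₁ h₂ hQ.ba.ne hB.mem.1
  have yz := hB.complete y hy a₀ ha₀ ya₀ z hB.mem
  obtain ⟨l, hl, lz, ly, hl2'⟩ := exists_isLevel hB.conn hB.mem.1 hB.mem.2 yz ha₀ ya₀
  set E : Set V := insert z (insert y B) with hE
  have hBE : ∀ {v}, v ∈ B → v ∈ E := fun hv => Or.inr (Or.inr hv)
  have hyE : y ∈ E := Or.inr (Or.inl rfl)
  have hl2 : ∀ {v}, v ∈ B → 2 ≤ l v := fun hv => hl2' _ hv (by rintro rfl; exact hy hv)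
  have hEB : ∀ {v}, v ∈ E → 2 ≤ l v → v ∈ B := by
    rintro v (rfl | rfl | hv) hlv
    · omega
    · omega
    · exact hv
  have hyl : ∀ {p}, p ∈ B → (G.Adj y p ↔ l p = 2) := by
    intro p hpB
    constructor
    · intro e
      have := hl.le y hyE p (hBE hpB) e
      have := hl2 hpB
      omega
    · exact fun e => hl.adj_succ hc hbf 0 y hyE p (hBE hpB) ly e
  have succAdj : ∀ {p q}, p ∈ B → q ∈ B → l q = l p + 1 → G.Adj p q := by
    intro p q hp' hq h
    have := hl2 hp'
    exact hl.adj_succ hc hbf (l p - 1) p (hBE hp') q (hBE hq) (by omega) (by omega)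
  have farAdj : ∀ {p q}, p ∈ B → q ∈ B → l p + 2 ≤ l q → ¬ G.Adj p q := fun hp' hq h =>
    hl.not_adj (hBE hp') (hBE hq) h
  obtain ⟨r, hr, hmax⟩ := Set.exists_max_image B l B.toFinite ⟨q₁, h₁⟩
  set R := l r with hR
  have lev : ∀ m, 2 ≤ m → m ≤ R → ∃ u ∈ B, l u = m := by
    intro m h2 hm
    obtain ⟨u, hu, hlu⟩ := hl.exists_level (hBE hr) hm
    exact ⟨u, hEB hu (by omega), hlu⟩
  -- The nonneighbour `b₀` of `y` lies on level `3` or beyond. A vertex on level `3` sees everything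
  -- else on levels `2`, `3`, `4`, so a vertex that it misses is on level at least `5`.
  have R5 : 5 ≤ R := by
    have h3 : 3 ≤ l b₀ := by
      have := hl2 hb₀
      have := mt (hyl hb₀).2 yb₀
      omega
    obtain ⟨e, he, le⟩ := lev 3 (by omega) (h3.trans (hmax b₀ hb₀))
    obtain ⟨g, hg, hge, ge⟩ := nouniv e he
    have := hmax g hg
    have hg2 := hl2 hg
    by_contra hlt
    obtain h | h | h : l g = 2 ∨ l g = 3 ∨ l g = 4 := by omega
    · exact ge (succAdj hg he (by omega))
    · exact ge (hl.adj_same hc hbf (hBE hg) (hBE he) (by omega) (by omega) hge)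
    · exact ge (succAdj he hg (by omega)).symm
  -- the vertices that are mixed on `B` are attached to the first or to the last level
  have up : ∀ {x a b}, x ∉ B → a ∈ B → b ∈ B → G.Adj x a → ¬ G.Adj x b → l b = l a + 1 →
      l a = 2 := by
    intro x a b hx ha hb xa xb hab
    by_contra hne
    have := hl2 ha
    obtain ⟨a', ha', la'⟩ := lev (l a - 1) (by omega) (by have := hmax a ha; omega)
    exact farAdj ha' hb (by omega) (hB.adj_of_adj_inner hc hbf hx ha hb ha' xa xb
      (succAdj ha hb hab) (succAdj ha' ha (by omega)) (by rintro rfl; omega))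
  have down : ∀ {x a b}, x ∉ B → a ∈ B → b ∈ B → G.Adj x a → ¬ G.Adj x b → l a = l b + 1 →
      l a = R := by
    intro x a b hx ha hb xa xb hab
    by_contra hne
    have := hmax a ha
    obtain ⟨a', ha', la'⟩ := lev (l a + 1) (by omega) (by omega)
    exact farAdj hb ha' (by omega) (hB.adj_of_adj_inner hc hbf hx ha hb ha' xa xb
      (succAdj hb ha hab).symm (succAdj ha ha' (by omega)).symm (by rintro rfl; omega)).symm
  -- An outside vertex cannot tell vertices of one level apart. On inner levels this follows from
  -- `up` and `down`, applied to the two neighbouring levels.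
  have same : ∀ {x a b}, x ∉ B → a ∈ B → b ∈ B → G.Adj x a → l a = l b → G.Adj x b := by
    intro x a b hx ha hb xa hab
    by_contra xb
    have hab' : a ≠ b := by rintro rfl; exact xb xa
    have := hl2 ha
    have := hmax a ha
    -- On an extreme level, let `c` and `d` be one and two levels further inside. If `a` and `b` are
    -- adjacent, the triangle `a c b` with horns `x` and `d` is a bull; otherwise `c` with leaves
    -- `b`, `d` and long leg `a x` is a chair.
    have fin : ∀ {c d}, l d ≠ l b → ¬ G.Adj x c → ¬ G.Adj x d → G.Adj a c → G.Adj b c →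
        G.Adj d c → ¬ G.Adj d a → ¬ G.Adj d b → False := by
      intro c d hdb xc xd ac bc dc da db
      by_cases e : G.Adj a b
      · exact xd (hbf a c b x d ac e bc.symm xa.symm dc.symm xc xb da db)
      · exact hdb (congrArg l (hc c b d a x bc.symm dc.symm ac.symm xa.symm (fun e => db e.symm)
          (fun h => e h.symm) da (fun e => xc e.symm) (fun e => xb e.symm)
          (fun e => xd e.symm)).symm)
    rcases Nat.lt_or_ge 2 (l a) with h2 | h2
    · rcases Nat.lt_or_ge (l a) R with h3 | h3
      · obtain ⟨c, hcB, lc⟩ := lev (l a + 1) (by omega) (by omega)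
        obtain ⟨c', hcB', lc'⟩ := lev (l a - 1) (by omega) (by omega)
        by_cases xc : G.Adj x c
        · have := down hx hcB hb xc xb (by omega)
          by_cases xc' : G.Adj x c'
          · have := up hx hcB' hb xc' xb (by omega)
            omega
          · have := down hx ha hcB' xa xc' (by omega)
            omega
        · have := up hx ha hcB xa xc lc
          omega
      · obtain ⟨c, hcB, lc⟩ := lev (R - 1) (by omega) (by omega)
        obtain ⟨d, hd, ld⟩ := lev (R - 2) (by omega) (by omega)
        have xc : ¬ G.Adj x c := fun xc => by
          have := up hx hcB hb xc xb (by omega)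
          omega
        have xd : ¬ G.Adj x d := fun xd => by
          have := up hx hd hcB xd xc (by omega)
          omega
        exact fin (by omega) xc xd (succAdj hcB ha (by omega)).symm
          (succAdj hcB hb (by omega)).symm (succAdj hd hcB (by omega)) (farAdj hd ha (by omega))
          (farAdj hd hb (by omega))
    · obtain ⟨c, hcB, lc⟩ := lev 3 (by omega) (by omega)
      obtain ⟨d, hd, ld⟩ := lev 4 (by omega) (by omega)
      have xc : ¬ G.Adj x c := fun xc => by
        have := down hx hcB hb xc xb (by omega)
        omega
      have xd : ¬ G.Adj x d := fun xd => by
        have := down hx hd hcB xd xc (by omega)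
        omega
      exact fin (by omega) xc xd (succAdj ha hcB (by omega)) (succAdj hb hcB (by omega))
        (succAdj hcB hd (by omega)).symm (fun e => farAdj ha hd (by omega) e.symm)
        (fun e => farAdj hb hd (by omega) e.symm)
  -- By `same`, a mixed edge `a b` changes the level, so `a` lies on level `2` or `R`. Any further
  -- neighbour `s` of `x` in `B` sees `b`; it is not on the level of `b`, and beyond `b` it would
  -- have to lie on the opposite extreme level, which is too far away since `5 ≤ R`.
  have classify : ∀ {x p q}, x ∉ B → p ∈ B → q ∈ B → G.Adj x p → ¬ G.Adj x q →
      (∀ p ∈ B, G.Adj x p ↔ l p = 2) ∨ (∀ p ∈ B, G.Adj x p ↔ l p = R) := by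
    intro x p q hx hp' hq xp xq
    obtain ⟨a, ha, b, hb, xa, xb, ab⟩ := hB.conn.exists_mixed_edge hp' hq xp xq
    have lab : l a ≠ l b := fun h => xb (same hx ha hb xa h)
    have near : ∀ {u v}, u ∈ B → v ∈ B → G.Adj u v → l v ≤ l u + 1 := fun hu hv e =>
      hl.le _ (hBE hu) _ (hBE hv) e
    have := near ha hb ab
    have := near hb ha ab.symm
    obtain h | h : l b = l a + 1 ∨ l a = l b + 1 := by omega
    · left
      have la := up hx ha hb xa xb h
      refine fun s hs => ⟨fun xs => ?_, fun ls => same hx ha hs xa (by omega)⟩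
      have sb := hB.adj_of_adj_mixed hc hbf hx ha hb hs xa xb ab xs
      have := near hs hb sb
      have := near hb hs sb.symm
      have : l s ≠ l b := fun h => xb (same hx hs hb xs h)
      by_contra hne
      have := down hx hs hb xs xb (by omega)
      omega
    · right
      have la := down hx ha hb xa xb h
      refine fun s hs => ⟨fun xs => ?_, fun ls => same hx ha hs xa (by omega)⟩
      have sb := hB.adj_of_adj_mixed hc hbf hx ha hb hs xa xb ab xs
      have := near hs hb sb
      have := near hb hs sb.symm
      have : l s ≠ l b := fun h => xb (same hx hs hb xs h)
      by_contra hne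
      have := up hx hs hb xs xb (by omega)
      omega
  -- Each level of `B` is a module missing `z`, so it is a single vertex.
  have inj : ∀ {p q}, p ∈ B → q ∈ B → l p = l q → p = q := by
    intro p q hp' hq hpq
    have mod : IsModule G {s ∈ B | l s = l p} := by
      intro x hx
      by_cases hxB : x ∈ B
      · have hxp : l x ≠ l p := fun h => hx ⟨hxB, h⟩
        by_cases h1 : l x = l p + 1
        · exact Or.inl fun s hs => (succAdj hs.1 hxB (by have := hs.2; omega)).symm
        by_cases h2 : l p = l x + 1
        · exact Or.inl fun s hs => succAdj hxB hs.1 (by have := hs.2; omega)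
        right
        intro s hs e
        have := hs.2
        have := hl.le _ (hBE hxB) _ (hBE hs.1) e
        have := hl.le _ (hBE hs.1) _ (hBE hxB) e.symm
        omega
      · by_cases xp : G.Adj x p
        · exact Or.inl fun s hs => same hxB hp' hs.1 xp hs.2.symm
        · exact Or.inr fun s hs xs => xp (same hxB hs.1 hp' xs hs.2)
    rcases hp _ mod with h | h
    · exact h ⟨hp', rfl⟩ ⟨hq, hpq.symm⟩
    · have : z ∈ {s ∈ B | l s = l p} := h ▸ Set.mem_univ z
      exact absurd this.1 hB.mem.1
  -- `Att t x`: the vertex `x` is attached to the level `t`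
  let Att : ℕ → V → Prop := fun t x => x ∉ B ∧ ∀ p ∈ B, G.Adj x p ↔ l p = t
  -- Four consecutive levels going inwards from either end. Because `5 ≤ R`, the level `R - 3` still
  -- belongs to `B`; this lets both ends be treated alike.
  have ends : ∀ t, t = 2 ∨ t = R → ∃ p₀ ∈ B, ∃ p₁ ∈ B, ∃ p₂ ∈ B, ∃ p₃ ∈ B, l p₀ = t ∧
      l p₁ ≠ 2 ∧ l p₁ ≠ R ∧ l p₂ ≠ t ∧ l p₃ ≠ t ∧ G.Adj p₀ p₁ ∧
      G.Adj p₁ p₂ ∧ ¬ G.Adj p₀ p₂ ∧ ¬ G.Adj p₃ p₀ ∧ ¬ G.Adj p₃ p₁ := by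
    rintro t (rfl | rfl)
    · obtain ⟨p₀, h₀, l₀⟩ := lev 2 (by omega) (by omega)
      obtain ⟨p₁, h₁, l₁⟩ := lev 3 (by omega) (by omega)
      obtain ⟨p₂, h₂, l₂⟩ := lev 4 (by omega) (by omega)
      obtain ⟨p₃, h₃, l₃⟩ := lev 5 (by omega) (by omega)
      exact ⟨p₀, h₀, p₁, h₁, p₂, h₂, p₃, h₃, l₀, by omega, by omega, by omega, by omega,
        succAdj h₀ h₁ (by omega), succAdj h₁ h₂ (by omega), farAdj h₀ h₂ (by omega),
        fun e => farAdj h₀ h₃ (by omega) e.symm, fun e => farAdj h₁ h₃ (by omega) e.symm⟩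
    · obtain ⟨p₀, h₀, l₀⟩ := lev R (by omega) (by omega)
      obtain ⟨p₁, h₁, l₁⟩ := lev (R - 1) (by omega) (by omega)
      obtain ⟨p₂, h₂, l₂⟩ := lev (R - 2) (by omega) (by omega)
      obtain ⟨p₃, h₃, l₃⟩ := lev (R - 3) (by omega) (by omega)
      exact ⟨p₀, h₀, p₁, h₁, p₂, h₂, p₃, h₃, l₀, by omega, by omega, by omega, by omega,
        (succAdj h₁ h₀ (by omega)).symm, (succAdj h₂ h₁ (by omega)).symm,
        fun e => farAdj h₂ h₀ (by omega) e.symm, farAdj h₃ h₀ (by omega), farAdj h₃ h₁ (by omega)⟩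
  have cases3 : ∀ x, x ∉ B → (∀ p ∈ B, G.Adj x p) ∨ x ∈ antiNbhd G B ∨ Att 2 x ∨ Att R x := by
    intro x hx
    by_cases h1 : ∀ p ∈ B, G.Adj x p
    · exact Or.inl h1
    by_cases h2 : ∀ p ∈ B, ¬ G.Adj x p
    · exact Or.inr (Or.inl ⟨hx, h2⟩)
    push Not at h1 h2
    obtain ⟨p, hp', xp⟩ := h1
    obtain ⟨q, hq, xq⟩ := h2
    rcases classify hx hq hp' xq xp with h | h
    · exact Or.inr (Or.inr (Or.inl ⟨hx, h⟩))
    · exact Or.inr (Or.inr (Or.inr ⟨hx, h⟩))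
  -- The vertices complete to `B` see everything else: if such an `x` missed a vertex `s` attached
  -- to an end, the triangle `p₀ x p₁` with horns `s` and `p₃` would be a bull. Hence the remaining
  -- vertices form a module with at least two elements, which must be everything.
  have noC : ∀ x ∉ B, ¬ ∀ p ∈ B, G.Adj x p := by
    have mod : IsModule G {x | ¬ (x ∉ B ∧ ∀ p ∈ B, G.Adj x p)} := by
      intro x hx
      simp only [Set.mem_ofPred_eq, not_not] at hx
      obtain ⟨hxB, hx⟩ := hx
      left
      intro s hs
      have hs' : s ∉ B → ¬ ∀ p ∈ B, G.Adj s p := fun h1 h2 => hs ⟨h1, h2⟩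
      by_cases hsB : s ∈ B
      · exact hx s hsB
      have att : ∀ t, (t = 2 ∨ t = R) → Att t s → G.Adj x s := by
        intro t ht hst
        obtain ⟨p₀, h₀, p₁, h₁, p₂, h₂, p₃, h₃, l₀, l₁, l₁', l₂, l₃, e₀₁, e₁₂, e₀₂, e₃₀, e₃₁⟩ :=
          ends t ht
        by_contra xs
        have s₀ : G.Adj s p₀ := (hst.2 p₀ h₀).2 l₀
        have s₁ : ¬ G.Adj s p₁ := fun e => by
          have := (hst.2 p₁ h₁).1 e
          rcases ht with rfl | rfl
          · exact l₁ this
          · exact l₁' this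
        have s₃ : ¬ G.Adj s p₃ := fun e => l₃ ((hst.2 p₃ h₃).1 e)
        exact s₃ (hbf p₀ x p₁ s p₃ (hx p₀ h₀).symm e₀₁ (hx p₁ h₁) s₀.symm (hx p₃ h₃)
          (fun e => xs e.symm) s₁ e₃₀ e₃₁)
      rcases cases3 s hsB with h | h | h | h
      · exact absurd h (hs' hsB)
      · exact hB.complete x hxB q₁ h₁ (hx q₁ h₁) s h
      · exact att 2 (Or.inl rfl) h
      · exact att R (Or.inr rfl) h
    rcases hp _ mod with h | h
    · exact absurd (h (show q₁ ∈ _ from fun hh => hh.1 h₁) (show q₂ ∈ _ from fun hh => hh.1 h₂))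
        hQ.ba.ne
    · intro x hx hall
      have : x ∈ {x | ¬ (x ∉ B ∧ ∀ p ∈ B, G.Adj x p)} := h ▸ Set.mem_univ x
      exact this ⟨hx, hall⟩
  -- By the maximality of `B`, every vertex outside `B` with a neighbour in `B` sees all of
  -- `antiNbhd G B`, and `B` sees none of it: this is a module.
  have Mz : ∀ x ∈ antiNbhd G B, x = z := by
    have mod : IsModule G (antiNbhd G B) := by
      intro x hx
      by_cases hxB : x ∈ B
      · exact Or.inr fun m hm e => hm.2 x hxB e.symm
      · left
        have : ∃ p ∈ B, G.Adj x p := by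
          by_contra hcon
          push Not at hcon
          exact hx ⟨hxB, hcon⟩
        obtain ⟨p, hp', xp⟩ := this
        exact fun m hm => hB.complete x hxB p hp' xp m hm
    intro x hx
    rcases hp _ mod with h | h
    · exact h hx hB.mem
    · have : q₁ ∈ antiNbhd G B := h ▸ Set.mem_univ q₁
      exact absurd h₁ this.1
  have attz : ∀ {t x}, (t = 2 ∨ t = R) → Att t x → G.Adj x z := by
    intro t x ht hx
    obtain ⟨p₀, h₀, -, -, -, -, -, -, l₀, -⟩ := ends t ht
    exact hB.complete x hx.1 p₀ h₀ ((hx.2 p₀ h₀).2 l₀) z hB.mem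
  -- The vertices attached to one end form a clique, since a nonadjacent pair would be the leaves of
  -- a chair with centre `p₀` and long leg `p₁ p₂`. They form a module, since a mixed vertex `s`
  -- attached to the other end would be a horn of a bull whose other horn is `p₁`.
  have attUnique : ∀ {t x x'}, (t = 2 ∨ t = R) → Att t x → Att t x' → x = x' := by
    intro t x x' ht hx hx'
    obtain ⟨p₀, h₀, p₁, h₁, p₂, h₂, -, -, l₀, l₁, l₁', l₂, -, e₀₁, e₁₂, e₀₂, -, -⟩ := ends t ht
    have att₁ : ∀ {t x}, (t = 2 ∨ t = R) → Att t x → ¬ G.Adj x p₁ := by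
      rintro t x (rfl | rfl) hx e
      · exact l₁ ((hx.2 p₁ h₁).1 e)
      · exact l₁' ((hx.2 p₁ h₁).1 e)
    have clq : ∀ {u v}, Att t u → Att t v → u ≠ v → G.Adj u v := by
      intro u v hu hv huv
      by_contra e
      exact huv (hc p₀ u v p₁ p₂ ((hu.2 p₀ h₀).2 l₀).symm ((hv.2 p₀ h₀).2 l₀).symm e₀₁ e₁₂ e
        (att₁ ht hu) (att₁ ht hv) e₀₂ (fun e => l₂ ((hu.2 p₂ h₂).1 e))
        (fun e => l₂ ((hv.2 p₂ h₂).1 e)))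
    have mod : IsModule G {u | Att t u} := by
      intro s hs
      by_cases hsB : s ∈ B
      · by_cases lst : l s = t
        · exact Or.inl fun u hu => ((hu.2 s hsB).2 lst).symm
        · exact Or.inr fun u hu e => lst ((hu.2 s hsB).1 e.symm)
      have aux : ∀ t', (t' = 2 ∨ t' = R) → Att t' s → (∀ u ∈ {u | Att t u}, G.Adj s u) ∨
          (∀ u ∈ {u | Att t u}, ¬ G.Adj s u) := by
        intro t' ht' hst
        have htt' : l p₀ ≠ t' := by
          rintro rfl
          exact hs (l₀ ▸ hst)
        by_contra hcon
        push Not at hcon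
        obtain ⟨⟨u, hu, su⟩, v, hv, sv⟩ := hcon
        have huv : v ≠ u := by rintro rfl; exact su sv
        have := hbf v p₀ u s p₁ ((hv.2 p₀ h₀).2 l₀) (clq hv hu huv) ((hu.2 p₀ h₀).2 l₀).symm
          sv.symm e₀₁ (fun e => htt' ((hst.2 p₀ h₀).1 e)) su (fun e => att₁ ht hv e.symm)
          (fun e => att₁ ht hu e.symm)
        exact att₁ ht' hst this
      rcases cases3 s hsB with h | h | h | h
      · exact absurd h (noC s hsB)
      · rw [Mz s h]
        exact Or.inl fun u hu => (attz ht hu).symm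
      · exact aux 2 (Or.inl rfl) h
      · exact aux R (Or.inr rfl) h
    rcases hp _ mod with h | h
    · exact h hx hx'
    · have : p₁ ∈ {u | Att t u} := h ▸ Set.mem_univ p₁
      exact absurd h₁ this.1
  -- Together with `z` they would form the triangle of a bull with horns on the two extreme levels.
  have att2R : ∀ {x x'}, Att 2 x → Att R x' → ¬ G.Adj x x' := by
    intro x x' hx hx' e
    obtain ⟨p₀, h₀, l₀⟩ := lev 2 (by omega) (by omega)
    obtain ⟨pR, hR', lR⟩ := lev R (by omega) (by omega)
    exact farAdj h₀ hR' (by omega) (hbf x x' z p₀ pR e (attz (Or.inl rfl) hx)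
      (attz (Or.inr rfl) hx') ((hx.2 p₀ h₀).2 l₀) ((hx'.2 pR hR').2 lR)
      (fun e => by have := (hx'.2 p₀ h₀).1 e.symm; omega) (fun e => hB.mem.2 p₀ h₀ e.symm)
      (fun e => by have := (hx.2 pR hR').1 e.symm; omega) (fun e => hB.mem.2 pR hR' e.symm))
  -- the label of a vertex on the resulting path or cycle
  let lab : V → ℕ := fun x => by
    classical exact if x ∈ B then l x else if Att 2 x then 1 else if Att R x then R + 1 else 0
  have labB : ∀ {x}, x ∈ B → lab x = l x := fun h => if_pos h
  have lab2 : ∀ {x}, Att 2 x → lab x = 1 := fun h => by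
    simp only [lab]; rw [if_neg h.1, if_pos h]
  have labR : ∀ {x}, Att R x → lab x = R + 1 := fun h => by
    simp only [lab]
    rw [if_neg h.1, if_neg, if_pos h]
    intro h'
    obtain ⟨p₀, h₀, l₀⟩ := lev 2 (by omega) (by omega)
    have := (h.2 p₀ h₀).1 ((h'.2 p₀ h₀).2 l₀)
    omega
  have labz : lab z = 0 := by
    simp only [lab]
    rw [if_neg hB.mem.1, if_neg, if_neg]
    · intro h
      obtain ⟨p₀, h₀, l₀⟩ := lev R (by omega) (by omega)
      exact hB.mem.2 p₀ h₀ ((h.2 p₀ h₀).2 l₀)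
    · intro h
      obtain ⟨p₀, h₀, l₀⟩ := lev 2 (by omega) (by omega)
      exact hB.mem.2 p₀ h₀ ((h.2 p₀ h₀).2 l₀)
  have four : ∀ x, x ∈ B ∨ x = z ∨ Att 2 x ∨ Att R x := by
    intro x
    by_cases hx : x ∈ B
    · exact Or.inl hx
    rcases cases3 x hx with h | h | h | h
    · exact absurd h (noC x hx)
    · exact Or.inr (Or.inl (Mz x h))
    · exact Or.inr (Or.inr (Or.inl h))
    · exact Or.inr (Or.inr (Or.inr h))
  have labInj : ∀ {x x'}, lab x = lab x' → x = x' := by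
    intro x x' h
    rcases four x with hx | rfl | hx | hx <;> rcases four x' with hx' | rfl | hx' | hx'
    · exact inj hx hx' (by rwa [labB hx, labB hx'] at h)
    · rw [labB hx, labz] at h; have := hl2 hx; omega
    · rw [labB hx, lab2 hx'] at h; have := hl2 hx; omega
    · rw [labB hx, labR hx'] at h; have := hmax x hx; omega
    · rw [labB hx', labz] at h; have := hl2 hx'; omega
    · rfl
    · rw [labz, lab2 hx'] at h; omega
    · rw [labz, labR hx'] at h; omega
    · rw [labB hx', lab2 hx] at h; have := hl2 hx'; omega
    · rw [labz, lab2 hx] at h; omega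
    · exact attUnique (Or.inl rfl) hx hx'
    · rw [lab2 hx, labR hx'] at h; omega
    · rw [labB hx', labR hx] at h; have := hmax x' hx'; omega
    · rw [labz, labR hx] at h; omega
    · rw [labR hx, lab2 hx'] at h; omega
    · exact attUnique (Or.inr rfl) hx hx'
  -- Arrange the labels `0, …, R + 1` on a circle: edges join only consecutive labels. As labels are
  -- injective, a vertex has at most two neighbours.
  have labAdj : ∀ {x x'}, G.Adj x x' → lab x' = lab x + 1 ∨ lab x = lab x' + 1 ∨
      (lab x = 0 ∧ lab x' = R + 1) ∨ (lab x = R + 1 ∧ lab x' = 0) := by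
    intro x x' e
    rcases four x with hx | rfl | hx | hx <;> rcases four x' with hx' | rfl | hx' | hx'
    · rw [labB hx, labB hx']
      have := hl.le _ (hBE hx) _ (hBE hx') e
      have := hl.le _ (hBE hx') _ (hBE hx) e.symm
      have : l x ≠ l x' := fun h => e.ne (inj hx hx' h)
      omega
    · exact absurd e.symm (hB.mem.2 x hx)
    · rw [labB hx, lab2 hx']; have := (hx'.2 x hx).1 e.symm; omega
    · rw [labB hx, labR hx']; have := (hx'.2 x hx).1 e.symm; omega
    · exact absurd e (hB.mem.2 x' hx')
    · exact absurd rfl e.ne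
    · rw [labz, lab2 hx']; omega
    · rw [labz, labR hx']; omega
    · rw [labB hx', lab2 hx]; have := (hx.2 x' hx').1 e; omega
    · rw [labz, lab2 hx]; omega
    · exact absurd (attUnique (Or.inl rfl) hx hx') e.ne
    · exact absurd e (att2R hx hx')
    · rw [labB hx', labR hx]; have := (hx.2 x' hx').1 e; omega
    · rw [labz, labR hx]; omega
    · exact absurd e.symm (att2R hx' hx)
    · exact absurd (attUnique (Or.inr rfl) hx hx') e.ne
  have n₁₂ : lab x₁ ≠ lab x₂ := fun h => h₁₂ (labInj h)
  have n₁₃ : lab x₁ ≠ lab x₃ := fun h => h₁₃ (labInj h)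
  have n₂₃ : lab x₂ ≠ lab x₃ := fun h => h₂₃ (labInj h)
  have labLe : ∀ x, lab x ≤ R + 1 := by
    intro x
    rcases four x with hx | rfl | hx | hx
    · rw [labB hx]; have := hmax x hx; omega
    · omega
    · rw [lab2 hx]; omega
    · rw [labR hx]
  have := labAdj cx₁
  have := labAdj cx₂
  have := labAdj cx₃
  have := labLe x₁
  have := labLe x₂
  have := labLe x₃
  omega

end Levels

/-! ### Assignments of color sets: contraction, witnesses, segments, minimal modules -/

section Assignments

variable {k : ℕ} {Γ : SimpleGraph ℕ} {H : SimpleGraph (Fin k)}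

/-- Every color of `S` is adjacent to every color of `T`. -/
def Comp (H : SimpleGraph (Fin k)) (S T : Finset (Fin k)) : Prop :=
  ∀ c ∈ S, ∀ d ∈ T, H.Adj c d

/-- `s` assigns to every vertex of `B` a set of colors from `A`, and the colors at adjacent vertices
are adjacent. -/
structure IsAssign (Γ : SimpleGraph ℕ) (H : SimpleGraph (Fin k)) (B : Finset ℕ)
    (A : Finset (Fin k)) (s : ℕ → Finset (Fin k)) : Prop where
  subset : ∀ v ∈ B, s v ⊆ A
  comp : ∀ u ∈ B, ∀ v ∈ B, Γ.Adj u v → Comp H (s u) (s v)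

/-- `q` is the maximum of `∑ v ∈ B, f (s v) v` over all assignments `s`. -/
def IsBest (Γ : SimpleGraph ℕ) (H : SimpleGraph (Fin k)) (f : Finset (Fin k) → ℕ → ℚ)
    (B : Finset ℕ) (A : Finset (Fin k)) (q : ℚ) : Prop :=
  IsGreatest {r | ∃ s, IsAssign Γ H B A s ∧ r = ∑ v ∈ B, f (s v) v} q

theorem comp_empty_left (T : Finset (Fin k)) : Comp H ∅ T := by simp [Comp]

theorem Comp.mono {S S' T T' : Finset (Fin k)} (h : Comp H S T) (hS : S' ⊆ S) (hT : T' ⊆ T) :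
    Comp H S' T' :=
  fun c hc d hd => h c (hS hc) d (hT hd)

theorem Comp.symm {S T : Finset (Fin k)} (h : Comp H S T) : Comp H T S :=
  fun c hc d hd => (h d hd c hc).symm

theorem IsAssign.empty (B : Finset ℕ) (A : Finset (Fin k)) : IsAssign Γ H B A fun _ => ∅ :=
  ⟨fun _ _ => Finset.empty_subset A, fun _ _ _ _ _ => comp_empty_left _⟩

/-- The properties of a table of optimum values. -/
structure IsTable (f : Finset (Fin k) → ℕ → ℚ) (B : Finset ℕ) : Prop where
  empty : ∀ v ∈ B, f ∅ v = 0
  mono : ∀ v ∈ B, ∀ S T, S ⊆ T → f S v ≤ f T v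

theorem IsTable.nonneg {f : Finset (Fin k) → ℕ → ℚ} {B : Finset ℕ} (h : IsTable f B) {v : ℕ}
    (hv : v ∈ B) (S : Finset (Fin k)) : 0 ≤ f S v :=
  (h.empty v hv).symm.le.trans (h.mono v hv _ _ (Finset.empty_subset S))

/-- A partition of `N` into modules, represented by the elements of `Act`, together with the
optimum values for the parts. -/
def IsBlocks (Γ : SimpleGraph ℕ) (H : SimpleGraph (Fin k)) (f₀ : Finset (Fin k) → ℕ → ℚ)
    (N Act : Finset ℕ) (f : Finset (Fin k) → ℕ → ℚ) : Prop :=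
  ∃ blk : ℕ → Finset ℕ, Act.biUnion blk = N ∧
    (∀ u ∈ Act, ∀ v ∈ Act, u ≠ v → Disjoint (blk u) (blk v)) ∧
    (∀ u ∈ Act, ∀ v ∈ Act, u ≠ v → ∀ x ∈ blk u, ∀ y ∈ blk v, Γ.Adj x y ↔ Γ.Adj u v) ∧
    ∀ v ∈ Act, ∀ S, IsBest Γ H f₀ (blk v) S (f S v)

/-- `B` is a module of the graph induced on `Act`. -/
def IsMod (Γ : SimpleGraph ℕ) (Act B : Finset ℕ) : Prop :=
  B ⊆ Act ∧ ∀ x ∈ Act, x ∉ B → (∀ b ∈ B, Γ.Adj x b) ∨ (∀ b ∈ B, ¬ Γ.Adj x b)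

theorem IsBlocks.isTable {f₀ f : Finset (Fin k) → ℕ → ℚ} {N Act : Finset ℕ}
    (h : IsBlocks Γ H f₀ N Act f) (h₀ : ∀ v ∈ N, f₀ ∅ v = 0) : IsTable f Act := by
  obtain ⟨blk, hN, -, -, hbest⟩ := h
  refine ⟨fun v hv => ?_, fun v hv S T hST => ?_⟩
  · obtain ⟨⟨s, hs, h1⟩, -⟩ := hbest v hv ∅
    rw [h1]
    refine Finset.sum_eq_zero fun x hx => ?_
    rw [Finset.subset_empty.1 (hs.subset x hx)]
    exact h₀ x (hN ▸ Finset.mem_biUnion.2 ⟨v, hv, hx⟩)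
  · obtain ⟨⟨s, hs, h1⟩, -⟩ := hbest v hv S
    rw [h1]
    exact (hbest v hv T).2 ⟨s, ⟨fun x hx => (hs.subset x hx).trans hST, hs.comp⟩, rfl⟩

theorem IsBlocks.init {f₀ : Finset (Fin k) → ℕ → ℚ} {N : Finset ℕ} (h₀ : IsTable f₀ N) :
    IsBlocks Γ H f₀ N N f₀ := by
  refine ⟨fun v => {v}, by ext; simp, fun u _ v _ huv => by simpa using huv,
    fun u _ v _ _ x hx y hy => by
      rw [Finset.mem_singleton.1 hx, Finset.mem_singleton.1 hy], fun v hv S => ⟨⟨fun _ => S, ?_, ?_⟩, ?_⟩⟩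
  · refine ⟨fun _ _ => le_rfl, fun u hu v hv h => ?_⟩
    rw [Finset.mem_singleton.1 hu, Finset.mem_singleton.1 hv] at h
    exact absurd h (Γ.loopless.irrefl _)
  · simp
  · rintro _ ⟨s, hs, rfl⟩
    simpa using h₀.mono v hv _ _ (hs.subset v (Finset.mem_singleton_self v))

/-- The optimum value on a union of blocks is the optimum value of the contracted instance. -/
theorem IsBest.biUnion {f₀ f : Finset (Fin k) → ℕ → ℚ} {B : Finset ℕ} {blk : ℕ → Finset ℕ}
    (hdisj : ∀ u ∈ B, ∀ v ∈ B, u ≠ v → Disjoint (blk u) (blk v))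
    (hadj : ∀ u ∈ B, ∀ v ∈ B, u ≠ v → ∀ x ∈ blk u, ∀ y ∈ blk v, Γ.Adj x y ↔ Γ.Adj u v)
    (hbest : ∀ v ∈ B, ∀ S, IsBest Γ H f₀ (blk v) S (f S v)) {A : Finset (Fin k)} {q : ℚ}
    (hq : IsBest Γ H f B A q) : IsBest Γ H f₀ (B.biUnion blk) A q := by
  have hsum : ∀ g : ℕ → ℚ, ∑ x ∈ B.biUnion blk, g x = ∑ v ∈ B, ∑ x ∈ blk v, g x := fun g =>
    Finset.sum_biUnion fun u hu v hv huv => hdisj u hu v hv huv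
  refine ⟨?_, ?_⟩
  · obtain ⟨⟨s, hs, rfl⟩, -⟩ := hq
    -- Expand each block by an optimum assignment with colors from `s v`. Compatibility across
    -- blocks is inherited from `s`, because smaller sets remain completely joined.
    have : ∀ v, ∃ t, v ∈ B → IsAssign Γ H (blk v) (s v) t ∧
        f (s v) v = ∑ x ∈ blk v, f₀ (t x) x := by
      intro v
      by_cases hv : v ∈ B
      · obtain ⟨⟨t, ht, h1⟩, -⟩ := hbest v hv (s v)
        exact ⟨t, fun _ => ⟨ht, h1⟩⟩
      · exact ⟨fun _ => ∅, fun h => absurd h hv⟩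
    choose t ht using this
    have hrep : ∀ x, ∃ v, x ∈ B.biUnion blk → v ∈ B ∧ x ∈ blk v := by
      intro x
      by_cases hx : x ∈ B.biUnion blk
      · obtain ⟨v, hv, hxv⟩ := Finset.mem_biUnion.1 hx
        exact ⟨v, fun _ => ⟨hv, hxv⟩⟩
      · exact ⟨0, fun h => absurd h hx⟩
    choose rep hrep using hrep
    have repEq : ∀ v ∈ B, ∀ x ∈ blk v, rep x = v := by
      intro v hv x hx
      obtain ⟨h1, h2⟩ := hrep x (Finset.mem_biUnion.2 ⟨v, hv, hx⟩)
      by_contra hne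
      exact Finset.disjoint_left.1 (hdisj _ h1 v hv hne) h2 hx
    refine ⟨fun x => t (rep x) x, ⟨fun x hx => ?_, fun x hx y hy hxy => ?_⟩, ?_⟩
    · obtain ⟨h1, h2⟩ := hrep x hx
      exact ((ht _ h1).1.subset x h2).trans (hs.subset _ h1)
    · obtain ⟨h1, h2⟩ := hrep x hx
      obtain ⟨h3, h4⟩ := hrep y hy
      by_cases he : rep x = rep y
      · have := (ht _ h1).1.comp x h2 y (he ▸ h4) hxy
        simpa [he] using this
      · exact (hs.comp _ h1 _ h3 ((hadj _ h1 _ h3 he x h2 y h4).1 hxy)).mono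
          ((ht _ h1).1.subset x h2) ((ht _ h3).1.subset y h4)
    · rw [hsum]
      refine Finset.sum_congr rfl fun v hv => ?_
      rw [(ht v hv).2]
      refine Finset.sum_congr rfl fun x hx => ?_
      simp only [repEq v hv x hx]
  · rintro _ ⟨t, ht, rfl⟩
    rw [hsum]
    have hin : ∀ v ∈ B, ∀ x ∈ blk v, x ∈ B.biUnion blk := fun v hv x hx =>
      Finset.mem_biUnion.2 ⟨v, hv, hx⟩
    -- Conversely, give each block the union of the colors used in it. Adjacent blocks are
    -- completely joined, so compatibility of all pairs of vertices is compatibility of the unions.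
    refine le_trans (Finset.sum_le_sum (g := fun v => f ((blk v).biUnion t) v) fun v hv => ?_)
      (hq.2 ⟨fun v => (blk v).biUnion t, ⟨fun v hv => ?_, fun u hu v hv huv => ?_⟩, rfl⟩)
    · exact (hbest v hv _).2 ⟨t, ⟨fun x hx c hc => Finset.mem_biUnion.2 ⟨x, hx, hc⟩,
        fun x hx y hy => ht.comp x (hin v hv x hx) y (hin v hv y hy)⟩, rfl⟩
    · exact Finset.biUnion_subset.2 fun x hx => ht.subset x (hin v hv x hx)
    · intro c hc d hd
      obtain ⟨x, hx, hcx⟩ := Finset.mem_biUnion.1 hc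
      obtain ⟨y, hy, hdy⟩ := Finset.mem_biUnion.1 hd
      exact ht.comp x (hin u hu x hx) y (hin v hv y hy)
        ((hadj u hu v hv huv.ne x hx y hy).2 huv) c hcx d hdy

/-- Contracting a module. -/
theorem IsBlocks.contract {f₀ f f' : Finset (Fin k) → ℕ → ℚ} {N Act B : Finset ℕ}
    (h : IsBlocks Γ H f₀ N Act f) (hB : IsMod Γ Act B) {b : ℕ} (hb : b ∈ B)
    (hf' : ∀ S, IsBest Γ H f B S (f' S b)) (hf : ∀ S, ∀ v ≠ b, f' S v = f S v) :
    IsBlocks Γ H f₀ N {v ∈ Act | v ∉ B ∨ v = b} f' := by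
  obtain ⟨blk, hN, hdisj, hadj, hbest⟩ := h
  have hsub := hB.1
  refine ⟨fun v => if v = b then B.biUnion blk else blk v, ?_, ?_, ?_, ?_⟩
  · rw [← hN]
    ext x
    simp only [Finset.mem_biUnion, Finset.mem_filter]
    constructor
    · rintro ⟨v, ⟨hv, -⟩, hx⟩
      split_ifs at hx with h
      · obtain ⟨w, hw, hx⟩ := Finset.mem_biUnion.1 hx
        exact ⟨w, hsub hw, hx⟩
      · exact ⟨v, hv, hx⟩
    · rintro ⟨v, hv, hx⟩
      by_cases hvB : v ∈ B
      · exact ⟨b, ⟨hsub hb, Or.inr rfl⟩, by simpa using ⟨v, hvB, hx⟩⟩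
      · have : v ≠ b := by rintro rfl; exact hvB hb
        exact ⟨v, ⟨hv, Or.inl hvB⟩, by simpa [this] using hx⟩
  · have aux : ∀ v ∈ Act, v ∉ B → Disjoint (B.biUnion blk) (blk v) := fun v hv hvB =>
      (Finset.disjoint_biUnion_left _ _ _).2 fun u hu => hdisj u (hsub hu) v hv
        (by rintro rfl; exact hvB hu)
    intro u hu v hv huv
    rw [Finset.mem_filter] at hu hv
    by_cases hub : u = b <;> by_cases hvb : v = b
    · exact absurd (hub.trans hvb.symm) huv
    · simp only [hub, hvb, if_true, if_false]
      exact aux v hv.1 (hv.2.resolve_right hvb)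
    · simp only [hub, hvb, if_true, if_false]
      exact (aux u hu.1 (hu.2.resolve_right hub)).symm
    · simp only [hub, hvb, if_false]
      exact hdisj u hu.1 v hv.1 huv
  · have aux : ∀ v ∈ Act, v ∉ B → ∀ x ∈ B.biUnion blk, ∀ y ∈ blk v, Γ.Adj x y ↔ Γ.Adj b v := by
      intro v hv hvB x hx y hy
      obtain ⟨u, hu, hx⟩ := Finset.mem_biUnion.1 hx
      rw [hadj u (hsub hu) v hv (by rintro rfl; exact hvB hu) x hx y hy]
      rcases hB.2 v hv hvB with h | h
      · exact ⟨fun _ => (h b hb).symm, fun _ => (h u hu).symm⟩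
      · exact ⟨fun e => absurd e.symm (h u hu), fun e => absurd e.symm (h b hb)⟩
    intro u hu v hv huv x hx y hy
    rw [Finset.mem_filter] at hu hv
    by_cases hub : u = b <;> by_cases hvb : v = b
    · exact absurd (hub.trans hvb.symm) huv
    · simp only [hub, hvb, if_true, if_false] at hx hy ⊢
      exact aux v hv.1 (hv.2.resolve_right hvb) x hx y hy
    · simp only [hub, hvb, if_true, if_false] at hx hy ⊢
      rw [Γ.adj_comm, aux u hu.1 (hu.2.resolve_right hub) y hy x hx, Γ.adj_comm]
    · simp only [hub, hvb, if_false] at hx hy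
      exact hadj u hu.1 v hv.1 huv x hx y hy
  · intro v hv S
    rw [Finset.mem_filter] at hv
    by_cases hvb : v = b
    · simp only [hvb, if_true]
      exact IsBest.biUnion (fun u hu v hv => hdisj u (hsub hu) v (hsub hv))
        (fun u hu v hv => hadj u (hsub hu) v (hsub hv)) (fun v hv => hbest v (hsub hv)) (hf' S)
    · simp only [hvb, if_false, hf S v hvb]
      exact hbest v hv.1 S

/-! ### Graphs without co-diamonds -/

/-- `u`, `v`, `w`, `x` induce an edge and two isolated vertices. -/
def IsCoDiamond (Γ : SimpleGraph ℕ) (u v w x : ℕ) : Prop :=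
  Γ.Adj u v ∧ w ≠ x ∧ ¬ Γ.Adj w x ∧ ¬ Γ.Adj w u ∧ ¬ Γ.Adj w v ∧ ¬ Γ.Adj x u ∧ ¬ Γ.Adj x v

/-- The witnesses `p c` and `q c` for the color `c` are distinct and nonadjacent. -/
def Consistent (Γ : SimpleGraph ℕ) (B : Finset ℕ) (p q : Fin k → ℕ) : Prop :=
  ∀ c, p c ∈ B → q c ∈ B → p c ≠ q c ∧ ¬ Γ.Adj (p c) (q c)

/-- The color `c` is possible at `v`, given the witnesses. -/
def Allowed (Γ : SimpleGraph ℕ) (H : SimpleGraph (Fin k)) (B : Finset ℕ) (p q : Fin k → ℕ)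
    (v : ℕ) (c : Fin k) : Prop :=
  ((p c ∈ B ∧ q c ∈ B) ∨ v = p c ∨ v = q c) ∧ ∀ d, ¬ H.Adj c d →
    (p d ∈ B → ¬ Γ.Adj (p d) v) ∧ (q d ∈ B → ¬ Γ.Adj (q d) v)

open Classical in
/-- The colors of `A` that are possible at `v`. -/
noncomputable def allowedSet (Γ : SimpleGraph ℕ) (H : SimpleGraph (Fin k)) (B : Finset ℕ)
    (p q : Fin k → ℕ) (A : Finset (Fin k)) (v : ℕ) : Finset (Fin k) :=
  A.filter (Allowed Γ H B p q v)

theorem mem_allowedSet {B : Finset ℕ} {p q : Fin k → ℕ} {A : Finset (Fin k)} {v : ℕ} {c : Fin k} :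
    c ∈ allowedSet Γ H B p q A v ↔ c ∈ A ∧ Allowed Γ H B p q v c := by
  simp [allowedSet]

/-- Let `u v` be an edge with nonadjacent allowed colors `c` at `u` and `d` at `v`. The witnesses of
`c` in `B` miss `v` because of `d`, and miss `u` because `c` has no loop. If both exist, they form a
co-diamond with `u v`; otherwise `u` is itself a witness of `c` and sees `v`. -/
theorem isAssign_allowedSet {B : Finset ℕ} (hB : ∀ u ∈ B, ∀ v ∈ B, ∀ w ∈ B, ∀ x ∈ B,
    ¬ IsCoDiamond Γ u v w x) {p q : Fin k → ℕ} (h : Consistent Γ B p q) (A : Finset (Fin k)) :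
    IsAssign Γ H B A (allowedSet Γ H B p q A) := by
  refine ⟨fun v _ c hc => (mem_allowedSet.1 hc).1, fun u hu v hv huv c hc d hd => ?_⟩
  by_contra hcd
  rw [mem_allowedSet] at hc hd
  have h1 := hd.2.2 c fun h => hcd h.symm
  have h2 := hc.2.2 c (H.loopless.irrefl c)
  by_cases hfull : p c ∈ B ∧ q c ∈ B
  · obtain ⟨hne, hna⟩ := h c hfull.1 hfull.2
    exact hB u hu v hv _ hfull.1 _ hfull.2
      ⟨huv, hne, hna, h2.1 hfull.1, h1.1 hfull.1, h2.2 hfull.2, h1.2 hfull.2⟩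
  · rcases hc.2.1.resolve_left hfull with rfl | rfl
    · exact h1.1 hu huv
    · exact h1.2 hu huv

/-- For each color take two vertices of `B` that carry it, or the only one, or none. The value `n`,
which is not in `B`, stands for a missing witness. Every color that `s` uses is then allowed, so
monotone tables lose nothing in passing to the allowed sets. -/
theorem exists_witnesses {B : Finset ℕ} {A : Finset (Fin k)} {s : ℕ → Finset (Fin k)}
    (hs : IsAssign Γ H B A s) {n : ℕ} (hn : ∀ v ∈ B, v < n) :
    ∃ p q : Fin k → ℕ, (∀ c, p c ≤ n) ∧ (∀ c, q c ≤ n) ∧ Consistent Γ B p q ∧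
      ∀ v ∈ B, s v ⊆ allowedSet Γ H B p q A v := by
  have hnB : n ∉ B := fun h => lt_irrefl n (hn n h)
  have : ∀ c, ∃ p q : ℕ, (p = n ∨ p ∈ B ∧ c ∈ s p) ∧ (q = n ∨ q ∈ B ∧ c ∈ s q) ∧
      (p ∈ B → q ∈ B → p ≠ q) ∧ ∀ v ∈ B, c ∈ s v → (p ∈ B ∧ q ∈ B) ∨ v = p ∨ v = q := by
    intro c
    by_cases h1 : ∃ p ∈ B, c ∈ s p
    · obtain ⟨p, hp, hcp⟩ := h1
      by_cases h2 : ∃ q ∈ B, c ∈ s q ∧ p ≠ q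
      · obtain ⟨q, hq, hcq, hpq⟩ := h2
        exact ⟨p, q, Or.inr ⟨hp, hcp⟩, Or.inr ⟨hq, hcq⟩, fun _ _ => hpq,
          fun _ _ _ => Or.inl ⟨hp, hq⟩⟩
      · push Not at h2
        exact ⟨p, n, Or.inr ⟨hp, hcp⟩, Or.inl rfl, fun _ h => absurd h hnB,
          fun v hv hcv => Or.inr (Or.inl (h2 v hv hcv).symm)⟩
    · push Not at h1
      exact ⟨n, n, Or.inl rfl, Or.inl rfl, fun h => absurd h hnB,
        fun v hv hcv => absurd hcv (h1 v hv)⟩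
  choose p q hp hq hne hfull using this
  refine ⟨p, q, fun c => ?_, fun c => ?_, fun c hpB hqB => ⟨hne c hpB hqB, fun h => ?_⟩,
    fun v hv c hc => mem_allowedSet.2 ⟨hs.subset v hv hc, hfull c v hv hc, fun d hcd =>
      ⟨fun h e => ?_, fun h e => ?_⟩⟩⟩
  · rcases hp c with h | h
    · exact h.le
    · exact (hn _ h.1).le
  · rcases hq c with h | h
    · exact h.le
    · exact (hn _ h.1).le
  · have h1 := (hp c).resolve_left (hn _ hpB).ne
    have h2 := (hq c).resolve_left (hn _ hqB).ne
    exact H.loopless.irrefl c (hs.comp _ h1.1 _ h2.1 h c h1.2 c h2.2)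
  · have h1 := (hp d).resolve_left (hn _ h).ne
    exact hcd (hs.comp _ h1.1 _ hv e d h1.2 c hc).symm
  · have h1 := (hq d).resolve_left (hn _ h).ne
    exact hcd (hs.comp _ h1.1 _ hv e d h1.2 c hc).symm

/-! ### Paths and cycles -/

/-- `V S T` is the optimum value on `Z`, with colors from `A`, where the colors at `u` are taken
from `S` and those at `v` from `T`. -/
structure IsSegTable (Γ : SimpleGraph ℕ) (H : SimpleGraph (Fin k)) (f : Finset (Fin k) → ℕ → ℚ)
    (A : Finset (Fin k)) (Z : Finset ℕ) (u v : ℕ) (V : Finset (Fin k) → Finset (Fin k) → ℚ) :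
    Prop where
  left : u ∈ Z
  right : v ∈ Z
  greatest : ∀ S T, IsGreatest {r | ∃ s, IsAssign Γ H Z A s ∧ s u ⊆ S ∧ s v ⊆ T ∧
    r = ∑ x ∈ Z, f (s x) x} (V S T)

theorem isSegTable_singleton {f : Finset (Fin k) → ℕ → ℚ} {x : ℕ} (hf : IsTable f {x})
    (A : Finset (Fin k)) : IsSegTable Γ H f A {x} x x fun S T => f (S ∩ T ∩ A) x := by
  refine ⟨by simp, by simp, fun S T => ⟨⟨fun _ => S ∩ T ∩ A, ⟨fun v _ => Finset.inter_subset_right,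
    fun u hu v hv e => ?_⟩, ?_, ?_, by simp⟩, ?_⟩⟩
  · rw [Finset.mem_singleton.1 hu, Finset.mem_singleton.1 hv] at e
    exact absurd e (Γ.loopless.irrefl _)
  · exact Finset.inter_subset_left.trans Finset.inter_subset_left
  · exact Finset.inter_subset_left.trans Finset.inter_subset_right
  · rintro _ ⟨s, hs, hS, hT, rfl⟩
    simpa using hf.mono x (by simp) _ _ (Finset.subset_inter (Finset.subset_inter hS hT)
      (hs.subset x (by simp)))

theorem IsSegTable.isBest {f : Finset (Fin k) → ℕ → ℚ} {A : Finset (Fin k)} {Z : Finset ℕ}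
    {u v : ℕ} {V : Finset (Fin k) → Finset (Fin k) → ℚ} (h : IsSegTable Γ H f A Z u v V) :
    IsBest Γ H f Z A (V Finset.univ Finset.univ) := by
  obtain ⟨⟨s, hs, -, -, h1⟩, h2⟩ := h.greatest Finset.univ Finset.univ
  exact ⟨⟨s, hs, h1⟩, fun r ⟨s, hs, hr⟩ => h2 ⟨s, hs, Finset.subset_univ _, Finset.subset_univ _, hr⟩⟩

/-- The conditions on the sets `R` at the new vertex `x` and `S₁`, `T₁` at the old ends `u`, `v`. -/
structure IsCand (Γ : SimpleGraph ℕ) (H : SimpleGraph (Fin k)) (A : Finset (Fin k)) (x u v : ℕ)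
    (S T R S₁ T₁ : Finset (Fin k)) : Prop where
  sub : R ⊆ S ∩ A
  left : Γ.Adj x u → Comp H R S₁
  right : Γ.Adj x v → Comp H R T₁
  -- The new ends are `x` and the old end away from `x`. When `x` sees both old ends, `v` is
  -- retained by convention.
  keep : (Γ.Adj x u ∧ T₁ ⊆ T) ∨ (¬ Γ.Adj x u ∧ S₁ ⊆ T)

-- The new vertex sees the old segment at most in its ends, so the old table, indexed by the colors
-- permitted at these ends, contains all that is needed about the interior. Bounding the end sets by
-- `S₁` and `T₁` is enough, since completeness to a larger set passes to subsets.
open Classical in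
theorem IsSegTable.extend {f : Finset (Fin k) → ℕ → ℚ} {A : Finset (Fin k)} {Z : Finset ℕ}
    {u v x : ℕ} {V V' : Finset (Fin k) → Finset (Fin k) → ℚ} (h : IsSegTable Γ H f A Z u v V)
    (hx : x ∉ Z) (hadj : ∀ p ∈ Z, Γ.Adj x p → p = u ∨ p = v)
    (hV' : ∀ S T, IsGreatest {r | ∃ R S₁ T₁, IsCand Γ H A x u v S T R S₁ T₁ ∧
      r = f R x + V S₁ T₁} (V' S T)) :
    IsSegTable Γ H f A (insert x Z) x (if Γ.Adj x u then v else u) V' := by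
  refine ⟨Finset.mem_insert_self x Z, ?_, fun S T => ⟨?_, ?_⟩⟩
  · split_ifs
    · exact Finset.mem_insert_of_mem h.right
    · exact Finset.mem_insert_of_mem h.left
  · obtain ⟨⟨R, S₁, T₁, hc, hr⟩, -⟩ := hV' S T
    obtain ⟨⟨s, hs, h1, h2, h3⟩, -⟩ := h.greatest S₁ T₁
    have ne : ∀ {p}, p ∈ Z → p ≠ x := by rintro p hp rfl; exact hx hp
    have hs' : ∀ {p}, p ∈ Z → Function.update s x R p = s p := fun hp =>
      Function.update_of_ne (ne hp) _ _
    have hxp : ∀ p ∈ Z, Γ.Adj x p → Comp H R (s p) := by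
      intro p hp e
      rcases hadj p hp e with rfl | rfl
      · exact (hc.left e).mono le_rfl h1
      · exact (hc.right e).mono le_rfl h2
    refine ⟨Function.update s x R, ⟨fun p hp => ?_, fun p hp q hq e => ?_⟩, ?_, ?_, ?_⟩
    · rcases Finset.mem_insert.1 hp with rfl | hp
      · simpa using hc.sub.trans Finset.inter_subset_right
      · rw [hs' hp]; exact hs.subset p hp
    · rcases Finset.mem_insert.1 hp with hpx | hpZ <;> rcases Finset.mem_insert.1 hq with hqx | hqZ
      · subst hpx hqx
        exact absurd e (Γ.loopless.irrefl _)
      · subst hpx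
        rw [hs' hqZ, Function.update_self]
        exact hxp q hqZ e
      · subst hqx
        rw [hs' hpZ, Function.update_self]
        exact (hxp p hpZ e.symm).symm
      · rw [hs' hpZ, hs' hqZ]
        exact hs.comp p hpZ q hqZ e
    · simpa using hc.sub.trans Finset.inter_subset_left
    · split_ifs with e
      · rw [hs' h.right]
        rcases hc.keep with h' | h'
        · exact h2.trans h'.2
        · exact absurd e h'.1
      · rw [hs' h.left]
        rcases hc.keep with h' | h'
        · exact absurd h'.1 e
        · exact h1.trans h'.2
    · rw [Finset.sum_insert hx, Function.update_self, hr, h3]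
      congr 1
      exact Finset.sum_congr rfl fun p hp => by rw [hs' hp]
  · rintro _ ⟨s, hs, h1, h2, rfl⟩
    rw [Finset.sum_insert hx]
    have hsZ : IsAssign Γ H Z A s := ⟨fun p hp => hs.subset p (Finset.mem_insert_of_mem hp),
      fun p hp q hq => hs.comp p (Finset.mem_insert_of_mem hp) q (Finset.mem_insert_of_mem hq)⟩
    have hxm := Finset.mem_insert_self x Z
    refine le_trans (add_le_add le_rfl ((h.greatest (s u) (s v)).2
      ⟨s, hsZ, le_rfl, le_rfl, rfl⟩)) ((hV' S T).2 ⟨s x, s u, s v, ⟨?_, ?_, ?_, ?_⟩, rfl⟩)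
    · exact Finset.subset_inter h1 (hs.subset x hxm)
    · exact hs.comp x hxm u (Finset.mem_insert_of_mem h.left)
    · exact hs.comp x hxm v (Finset.mem_insert_of_mem h.right)
    · by_cases e : Γ.Adj x u
      · rw [if_pos e] at h2; exact Or.inl ⟨e, h2⟩
      · rw [if_neg e] at h2; exact Or.inr ⟨e, h2⟩

/-- `Z` is a segment of `B` with ends `u` and `v`. -/
structure IsSegment (Γ : SimpleGraph ℕ) (B Z : Finset ℕ) (u v : ℕ) : Prop where
  subset : Z ⊆ B
  closed : ∀ p ∈ Z, p ≠ u → p ≠ v → ∀ q ∈ B, Γ.Adj p q → q ∈ Z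
  ends : (Z = {u} ∧ u = v) ∨ ((∃ q ∈ Z, Γ.Adj u q) ∧ ∃ q ∈ Z, Γ.Adj v q)

theorem isSegment_singleton {B : Finset ℕ} {x : ℕ} (hx : x ∈ B) : IsSegment Γ B {x} x x :=
  ⟨Finset.singleton_subset_iff.2 hx, fun _ hp h => absurd (Finset.mem_singleton.1 hp) h,
    Or.inl ⟨rfl, rfl⟩⟩

-- The end where `x` is attached becomes an inner vertex. Unless the segment was a single vertex, it
-- already has a neighbour inside by `IsSegment.ends`, so with `x` its two permitted neighbours both
-- lie in the new segment.
open Classical in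
theorem IsSegment.extend {B Z : Finset ℕ} {u v x : ℕ} (h : IsSegment Γ B Z u v)
    (hdeg : ∀ c ∈ B, ∀ p ∈ B, ∀ q ∈ B, ∀ r ∈ B, Γ.Adj c p → Γ.Adj c q → Γ.Adj c r → p ≠ q →
      p ≠ r → q = r)
    (hu : u ∈ Z) (hv : v ∈ Z) (hx : x ∈ B) (hxZ : x ∉ Z) (hadj : Γ.Adj x u ∨ Γ.Adj x v) :
    IsSegment Γ B (insert x Z) x (if Γ.Adj x u then v else u) := by
  have hZ : ∀ {p}, p ∈ Z → p ∈ insert x Z := fun h => Finset.mem_insert_of_mem h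
  refine ⟨Finset.insert_subset hx h.subset, fun p hp hpx hpv q hq e => ?_, ?_⟩
  · have hpZ := Finset.mem_of_mem_insert_of_ne hp hpx
    by_cases hc : p ≠ u ∧ p ≠ v
    · exact hZ (h.closed p hpZ hc.1 hc.2 q hq e)
    by_contra hqZ
    have key : Γ.Adj p x → (∃ r ∈ Z, Γ.Adj p r) → False := by
      rintro epx ⟨r, hr, er⟩
      refine hqZ ?_
      rw [Finset.mem_insert]
      left
      by_contra hqx
      exact hqZ (hZ (hdeg p (h.subset hpZ) x hx q hq r (h.subset hr) epx e er (fun h => hqx h.symm)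
        (by rintro rfl; exact hxZ hr) ▸ hr))
    split_ifs at hpv with hxu
    · have hpu : p = u := by tauto
      subst hpu
      rcases h.ends with he | he
      · exact hpv he.2
      · exact key hxu.symm he.1
    · have hpv' : p = v := by tauto
      subst hpv'
      rcases h.ends with he | he
      · exact hpv he.2.symm
      · exact key (hadj.resolve_left hxu).symm he.2
  · right
    refine ⟨?_, ?_⟩
    · rcases hadj with e | e
      · exact ⟨u, hZ hu, e⟩
      · exact ⟨v, hZ hv, e⟩
    · rcases h.ends with he | ⟨⟨q, hq, e⟩, r, hr, e'⟩
      · obtain ⟨-, rfl⟩ := he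
        refine ⟨x, Finset.mem_insert_self x Z, ?_⟩
        rw [ite_self]
        exact (hadj.elim id id).symm
      · split_ifs
        · exact ⟨r, hZ hr, e'⟩
        · exact ⟨q, hZ hq, e⟩

theorem IsSegment.adj_ends {B Z : Finset ℕ} {u v x : ℕ} (h : IsSegment Γ B Z u v) (hx : x ∈ B)
    (hxZ : x ∉ Z) : ∀ p ∈ Z, Γ.Adj x p → p = u ∨ p = v := by
  intro p hp e
  by_contra hcon
  push Not at hcon
  exact hxZ (h.closed p hp hcon.1 hcon.2 x hx e.symm)

/-! ### Minimal modules -/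

/-- `B` is a module of `Act`, and it is contained in every module that has two vertices of `B`. -/
structure IsMinMod (Γ : SimpleGraph ℕ) (Act B : Finset ℕ) : Prop where
  mod : IsMod Γ Act B
  min : ∀ M, IsMod Γ Act M → ∀ u ∈ B, ∀ v ∈ B, u ≠ v → u ∈ M → v ∈ M → B ⊆ M

/-- A module of the graph induced on a module `B` is a module of the whole graph; having two
vertices of `B`, it contains `B` by minimality. -/
theorem IsMinMod.isPrimeGraph {Act B : Finset ℕ} (h : IsMinMod Γ Act B) :
    IsPrimeGraph (Γ.induce (B : Set ℕ)) := by
  classical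
  intro S hS
  by_cases hsub : S.Subsingleton
  · exact Or.inl hsub
  right
  obtain ⟨u, hu, v, hv, huv⟩ := Set.not_subsingleton_iff.1 hsub
  let M : Finset ℕ := B.filter fun x => ∃ hx : x ∈ (B : Set ℕ), (⟨x, hx⟩ : (B : Set ℕ)) ∈ S
  have memM : ∀ x : (B : Set ℕ), (x : ℕ) ∈ M ↔ x ∈ S := by
    intro x
    simp only [M, Finset.mem_filter]
    exact ⟨fun h => h.2.2, fun h => ⟨x.2, x.2, h⟩⟩
  have hM : IsMod Γ Act M := by
    refine ⟨(Finset.filter_subset _ _).trans h.mod.1, fun x hx hxM => ?_⟩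
    by_cases hxB : x ∈ B
    · rcases hS ⟨x, hxB⟩ (fun hh => hxM ((memM ⟨x, hxB⟩).2 hh)) with h1 | h1
      · left
        intro b hb
        exact h1 ⟨b, (Finset.mem_filter.1 hb).1⟩ ((memM ⟨b, (Finset.mem_filter.1 hb).1⟩).1 hb)
      · right
        intro b hb
        exact h1 ⟨b, (Finset.mem_filter.1 hb).1⟩ ((memM ⟨b, (Finset.mem_filter.1 hb).1⟩).1 hb)
    · rcases h.mod.2 x hx hxB with h1 | h1
      · exact Or.inl fun b hb => h1 b (Finset.mem_filter.1 hb).1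
      · exact Or.inr fun b hb => h1 b (Finset.mem_filter.1 hb).1
  have := h.min M hM u u.2 v v.2 (fun h => huv (Subtype.ext h)) ((memM u).2 hu) ((memM v).2 hv)
  exact Set.eq_univ_of_forall fun x => (memM x).1 (this x.2)

theorem ChairFree.induce (h : ChairFree Γ) (B : Set ℕ) : ChairFree (Γ.induce B) :=
  fun a b c d e h1 h2 h3 h4 h5 h6 h7 h8 h9 h10 =>
    Subtype.ext (h a b c d e h1 h2 h3 h4 h5 h6 h7 h8 h9 h10)

theorem BullFree.induce (h : BullFree Γ) (B : Set ℕ) : BullFree (Γ.induce B) :=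
  fun a b c d e h1 h2 h3 h4 h5 h6 h7 h8 h9 => h a b c d e h1 h2 h3 h4 h5 h6 h7 h8 h9

/-- A minimal module with a co-diamond has maximum degree at most two. -/
theorem IsMinMod.degree_le_two {Act B : Finset ℕ} (h : IsMinMod Γ Act B) (hc : ChairFree Γ)
    (hb : BullFree Γ) {u v w x : ℕ} (hu : u ∈ B) (hv : v ∈ B) (hw : w ∈ B) (hx : x ∈ B)
    (hd : IsCoDiamond Γ u v w x) : ∀ c ∈ B, ∀ p ∈ B, ∀ q ∈ B, ∀ r ∈ B, Γ.Adj c p → Γ.Adj c q →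
      Γ.Adj c r → p ≠ q → p ≠ r → q = r := by
  intro c hcB p hp q hq r hr h1 h2 h3 h4 h5
  by_contra h6
  obtain ⟨d1, d2, d3, d4, d5, d6, d7⟩ := hd
  exact HColoring.degree_le_two (G := Γ.induce (B : Set ℕ)) h.isPrimeGraph (hc.induce _) (hb.induce _)
    (u := ⟨u, hu⟩) (v := ⟨v, hv⟩) (w₁ := ⟨w, hw⟩) (w₂ := ⟨x, hx⟩) (c := ⟨c, hcB⟩) (x₁ := ⟨p, hp⟩)
    (x₂ := ⟨q, hq⟩) (x₃ := ⟨r, hr⟩) d1 d3 (fun h => d2 (congrArg Subtype.val h)) d4 d5 d6 d7 h1 h2 h3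
    (fun h => h4 (congrArg Subtype.val h)) (fun h => h5 (congrArg Subtype.val h))
    (fun h => h6 (congrArg Subtype.val h))

/-- A minimal module with at least three vertices is connected. -/
theorem IsMinMod.connected {Act B : Finset ℕ} (h : IsMinMod Γ Act B) {u v w : ℕ} (hu : u ∈ B)
    (hv : v ∈ B) (hw : w ∈ B) (huv : u ≠ v) (huw : u ≠ w) (hvw : v ≠ w) {Z : Finset ℕ}
    (hZB : Z ⊆ B) (hne : Z.Nonempty) (hcl : ∀ p ∈ Z, ∀ q ∈ B, Γ.Adj p q → q ∈ Z) : Z = B := by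
  have mod : ∀ M ⊆ B, (∀ p ∈ M, ∀ q ∈ B, Γ.Adj p q → q ∈ M) → IsMod Γ Act M := by
    intro M hM hcl
    refine ⟨hM.trans h.mod.1, fun x hx hxM => ?_⟩
    by_cases hxB : x ∈ B
    · exact Or.inr fun b hb e => hxM (hcl b hb x hxB e.symm)
    · rcases h.mod.2 x hx hxB with h1 | h1
      · exact Or.inl fun b hb => h1 b (hM hb)
      · exact Or.inr fun b hb => h1 b (hM hb)
  obtain ⟨z, hz⟩ := hne
  by_cases hex : ∃ z' ∈ Z, z' ≠ z
  · obtain ⟨z', hz', hne⟩ := hex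
    exact hZB.antisymm (h.min Z (mod Z hZB hcl) z' (hZB hz') z (hZB hz) hne hz' hz)
  · push Not at hex
    -- If the closed set is `{z}` alone, minimality says nothing about it. But then `z` is isolated
    -- in `B`, so `B.erase z` is also a module; it contains two vertices of `B` and misses `z`,
    -- which is where three vertices are needed.
    have hcl' : ∀ p ∈ B.erase z, ∀ q ∈ B, Γ.Adj p q → q ∈ B.erase z := by
      intro p hp q hq e
      rw [Finset.mem_erase] at hp ⊢
      refine ⟨?_, hq⟩
      rintro rfl
      exact hp.1 (hex p (hcl q hz p hp.2 e.symm))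
    have key : ∀ a ∈ B, ∀ b ∈ B, a ≠ b → a ≠ z → b ≠ z → False := by
      intro a ha b hb hab haz hbz
      have := h.min _ (mod _ (Finset.erase_subset z B) hcl') a ha b hb hab
        (Finset.mem_erase.2 ⟨haz, ha⟩) (Finset.mem_erase.2 ⟨hbz, hb⟩) (hZB hz)
      simp at this
    exfalso
    by_cases h1 : u = z
    · exact key v hv w hw hvw (by rintro rfl; exact huv h1) (by rintro rfl; exact huw h1)
    · by_cases h2 : v = z
      · exact key u hu w hw huw h1 (by rintro rfl; exact hvw h2)
      · exact key u hu v hv huv h1 h2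

end Assignments

/-! ### Correctness of the two prime cases, and computing minimal modules by closure -/

section Modules

variable {k : ℕ} {Γ : SimpleGraph ℕ} {H : SimpleGraph (Fin k)}

/-- The optimum of the contracted instance, when there are no co-diamonds: it suffices to try all
choices of witnesses. -/
theorem isBest_of_witnesses {f : Finset (Fin k) → ℕ → ℚ} {B : Finset ℕ} (hf : IsTable f B)
    (hB : ∀ u ∈ B, ∀ v ∈ B, ∀ w ∈ B, ∀ x ∈ B, ¬ IsCoDiamond Γ u v w x) {n : ℕ}
    (hn : ∀ v ∈ B, v < n) {A : Finset (Fin k)} {r : ℚ}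
    (hle : ∀ p q : Fin k → ℕ, (∀ c, p c ≤ n) → (∀ c, q c ≤ n) → Consistent Γ B p q →
      ∑ v ∈ B, f (allowedSet Γ H B p q A v) v ≤ r)
    (hr : r = 0 ∨ ∃ p q : Fin k → ℕ, Consistent Γ B p q ∧
      r = ∑ v ∈ B, f (allowedSet Γ H B p q A v) v) : IsBest Γ H f B A r := by
  refine ⟨?_, ?_⟩
  · rcases hr with rfl | ⟨p, q, h, hr⟩
    · exact ⟨fun _ => ∅, IsAssign.empty B A, (Finset.sum_eq_zero hf.empty).symm⟩
    · exact ⟨_, isAssign_allowedSet hB h A, hr⟩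
  · rintro _ ⟨s, hs, rfl⟩
    obtain ⟨p, q, hp, hq, hc, h⟩ := exists_witnesses hs hn
    exact (Finset.sum_le_sum fun v hv => hf.mono v hv _ _ (h v hv)).trans (hle p q hp hq hc)

/-- A segment to which nothing can be added is everything. -/
theorem IsSegment.eq_of_maximal {Act B Z : Finset ℕ} {u v a b c : ℕ} (h : IsSegment Γ B Z u v)
    (hB : IsMinMod Γ Act B) (ha : a ∈ B) (hb : b ∈ B) (hc : c ∈ B) (hab : a ≠ b) (hac : a ≠ c)
    (hbc : b ≠ c) (hu : u ∈ Z) (hmax : ∀ x ∈ B, x ∉ Z → ¬ Γ.Adj x u ∧ ¬ Γ.Adj x v) : Z = B := by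
  refine hB.connected ha hb hc hab hac hbc h.subset ⟨u, hu⟩ fun p hp q hq e => ?_
  by_contra hqZ
  rcases h.adj_ends hq hqZ p hp e.symm with rfl | rfl
  · exact (hmax q hq hqZ).1 e.symm
  · exact (hmax q hq hqZ).2 e.symm

open Classical in
/-- Add to `C` the vertices of `Act` that `C` does not look the same to. -/
noncomputable def splitStep (Γ : SimpleGraph ℕ) (Act C : Finset ℕ) : Finset ℕ :=
  {x ∈ Act | x ∈ C ∨ (∃ a ∈ C, Γ.Adj x a) ∧ ∃ b ∈ C, ¬ Γ.Adj x b}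

theorem mem_splitStep {Act C : Finset ℕ} {x : ℕ} : x ∈ splitStep Γ Act C ↔
    x ∈ Act ∧ (x ∈ C ∨ (∃ a ∈ C, Γ.Adj x a) ∧ ∃ b ∈ C, ¬ Γ.Adj x b) := by
  simp [splitStep]

theorem splitStep_subset (Act C : Finset ℕ) : splitStep Γ Act C ⊆ Act :=
  fun _ h => (mem_splitStep.1 h).1

theorem subset_splitStep {Act C : Finset ℕ} (h : C ⊆ Act) : C ⊆ splitStep Γ Act C :=
  fun _ hx => mem_splitStep.2 ⟨h hx, Or.inl hx⟩

theorem splitStep_subset_of_isMod {Act C M : Finset ℕ} (hM : IsMod Γ Act M) (h : C ⊆ M) :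
    splitStep Γ Act C ⊆ M := by
  intro x hx
  obtain ⟨hx, hC | ⟨⟨a, ha, h1⟩, b, hb, h2⟩⟩ := mem_splitStep.1 hx
  · exact h hC
  · by_contra hxM
    rcases hM.2 x hx hxM with h3 | h3
    · exact h2 (h3 b (h hb))
    · exact h3 a (h ha) h1

theorem isMod_of_splitStep_eq {Act C : Finset ℕ} (hC : C ⊆ Act) (h : splitStep Γ Act C = C) :
    IsMod Γ Act C := by
  refine ⟨hC, fun x hx hxC => ?_⟩
  by_contra hcon
  push Not at hcon
  obtain ⟨⟨b, hb, h1⟩, a, ha, h2⟩ := hcon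
  exact hxC (h ▸ mem_splitStep.2 ⟨hx, Or.inr ⟨⟨a, ha, h2⟩, b, hb, h1⟩⟩)

/-- What holds after `j` rounds of the computation of the smallest module that contains `u`, `v`. -/
structure IsPartialClosure (Γ : SimpleGraph ℕ) (Act : Finset ℕ) (u v j : ℕ) (C : Finset ℕ) :
    Prop where
  subset : C ⊆ Act
  left : u ∈ C
  right : v ∈ C
  min : ∀ M, IsMod Γ Act M → u ∈ M → v ∈ M → C ⊆ M
  large : splitStep Γ Act C = C ∨ j + 1 ≤ C.card

theorem isPartialClosure_pair {Act : Finset ℕ} {u v : ℕ} (hu : u ∈ Act) (hv : v ∈ Act) :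
    IsPartialClosure Γ Act u v 0 {u, v} := by
  refine ⟨?_, by simp, by simp, fun M _ h1 h2 => ?_, Or.inr (Finset.card_pos.2 ⟨u, by simp⟩)⟩
  · simp [Finset.insert_subset_iff, hu, hv]
  · simp [Finset.insert_subset_iff, h1, h2]

theorem IsPartialClosure.step {Act C : Finset ℕ} {u v j : ℕ}
    (h : IsPartialClosure Γ Act u v j C) :
    IsPartialClosure Γ Act u v (j + 1) (splitStep Γ Act C) := by
  have hsub := subset_splitStep (Γ := Γ) h.subset
  refine ⟨splitStep_subset _ _, hsub h.left, hsub h.right,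
    fun M hM h1 h2 => splitStep_subset_of_isMod hM (h.min M hM h1 h2), ?_⟩
  by_cases he : splitStep Γ Act C = C
  · exact Or.inl (by rw [he, he])
  · right
    have := h.large.resolve_left he
    have := Finset.card_lt_card (hsub.ssubset_of_ne fun e => he e.symm)
    omega

/-- A round that is not yet stable adds a vertex, so after `Act.card` rounds the set cannot have
grown every time. -/
theorem IsPartialClosure.isMod {Act C : Finset ℕ} {u v j : ℕ}
    (h : IsPartialClosure Γ Act u v j C) (hj : Act.card ≤ j) : IsMod Γ Act C := by
  refine isMod_of_splitStep_eq h.subset (h.large.resolve_right fun hl => ?_)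
  have := Finset.card_le_card h.subset
  omega

/-- A module such that the pairs in `D` do not lie in smaller modules. -/
structure IsMinModFor (Γ : SimpleGraph ℕ) (Act : Finset ℕ) (D : ℕ → ℕ → Prop) (B : Finset ℕ) :
    Prop where
  mod : IsMod Γ Act B
  min : ∀ M, IsMod Γ Act M → ∀ u ∈ B, ∀ v ∈ B, D u v → u ≠ v → u ∈ M → v ∈ M → B ⊆ M
  -- A trivial module is only acceptable when nothing is left to contract; this guarantees progress
  -- later.
  two : B.card ≤ 1 → B = Act

theorem isMinModFor_self (Act : Finset ℕ) {D : ℕ → ℕ → Prop} (hD : ∀ u v, ¬ D u v) :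
    IsMinModFor Γ Act D Act :=
  ⟨⟨le_rfl, fun _ hx hn => absurd hx hn⟩, fun _ _ _ _ _ _ h => absurd h (hD _ _), fun _ => rfl⟩

theorem IsMinModFor.mono {Act B : Finset ℕ} {D D' : ℕ → ℕ → Prop} (h : IsMinModFor Γ Act D B)
    (hD : ∀ u ∈ B, ∀ v ∈ B, u ≠ v → D' u v → D u v) : IsMinModFor Γ Act D' B :=
  ⟨h.mod, fun M hM u hu v hv hd hne => h.min M hM u hu v hv (hD u hu v hv hne hd) hne, h.two⟩

/-- Shrinking `B` to a smaller module does not spoil the pairs already treated: those still inside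
were pairs of the old module, and a module containing one of them contains the old module. Hence one
pass over all pairs suffices. -/
theorem IsMinModFor.closure {Act B C : Finset ℕ} {D : ℕ → ℕ → Prop} {u v j : ℕ}
    (h : IsMinModFor Γ Act D B) (hu : u ∈ B) (hv : v ∈ B) (huv : u ≠ v)
    (hC : IsPartialClosure Γ Act u v j C) (hj : Act.card ≤ j) :
    IsMinModFor Γ Act (fun a b => D a b ∨ a = u ∧ b = v) C := by
  have hCB := hC.min B h.mod hu hv
  refine ⟨hC.isMod hj, ?_, fun hc => ?_⟩
  · rintro M hM a ha b hb (hd | ⟨rfl, rfl⟩) hab haM hbM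
    · exact hCB.trans (h.min M hM a (hCB ha) b (hCB hb) hd hab haM hbM)
    · exact hC.min M hM haM hbM
  · exact absurd (Finset.card_le_one.1 hc u hC.left v hC.right) huv

theorem IsMinModFor.isMinMod {Act B : Finset ℕ} {D : ℕ → ℕ → Prop} (h : IsMinModFor Γ Act D B)
    (hD : ∀ u ∈ B, ∀ v ∈ B, D u v) : IsMinMod Γ Act B :=
  ⟨h.mod, fun M hM u hu v hv => h.min M hM u hu v hv (hD u hu v hv)⟩

end Modules

/-! ### From the optimum value to an optimum solution -/

section SelfReduction

variable {k : ℕ} {Γ : SimpleGraph ℕ} {H : SimpleGraph (Fin k)}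

/-- The largest revenue at `v` with a color from `S`, or `0`. -/
def maxRev (w : Fin k → ℕ → ℚ) (S : Finset (Fin k)) (v : ℕ) : ℚ := S.fold max 0 (w · v)

theorem maxRev_le {w : Fin k → ℕ → ℚ} {S : Finset (Fin k)} {v : ℕ} {a : ℚ} :
    maxRev w S v ≤ a ↔ 0 ≤ a ∧ ∀ c ∈ S, w c v ≤ a :=
  Finset.fold_max_le a

theorem maxRev_nonneg (w : Fin k → ℕ → ℚ) (S : Finset (Fin k)) (v : ℕ) : 0 ≤ maxRev w S v :=
  (maxRev_le.1 le_rfl).1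

theorem le_maxRev {w : Fin k → ℕ → ℚ} {S : Finset (Fin k)} {v : ℕ} {c : Fin k} (hc : c ∈ S) :
    w c v ≤ maxRev w S v :=
  (maxRev_le.1 le_rfl).2 c hc

theorem maxRev_mono {w w' : Fin k → ℕ → ℚ} {S T : Finset (Fin k)} {v : ℕ} (h : S ⊆ T)
    (hw : ∀ c ∈ S, w c v ≤ w' c v) : maxRev w S v ≤ maxRev w' T v :=
  maxRev_le.2 ⟨maxRev_nonneg _ _ _, fun c hc => (hw c hc).trans (le_maxRev (h hc))⟩

theorem isTable_maxRev (w : Fin k → ℕ → ℚ) (N : Finset ℕ) : IsTable (maxRev w) N :=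
  ⟨fun v _ => by simp [maxRev], fun v _ S T h => maxRev_mono h fun _ _ => le_rfl⟩

/-- `q` is the optimum for the revenue function `w` on the vertices `0, …, n - 1`. -/
def IsOpt (Γ : SimpleGraph ℕ) (H : SimpleGraph (Fin k)) (n : ℕ) (w : Fin k → ℕ → ℚ) (q : ℚ) :
    Prop :=
  IsBest Γ H (maxRev w) (Finset.range n) Finset.univ q

theorem IsOpt.le {n : ℕ} {w w' : Fin k → ℕ → ℚ} {q q' : ℚ} (h : IsOpt Γ H n w q)
    (h' : IsOpt Γ H n w' q') (hw : ∀ v < n, ∀ c, w c v ≤ w' c v) : q ≤ q' := by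
  obtain ⟨⟨s, hs, rfl⟩, -⟩ := h
  refine le_trans (Finset.sum_le_sum fun v hv => ?_) (h'.2 ⟨s, hs, rfl⟩)
  exact maxRev_mono le_rfl fun c _ => hw v (Finset.mem_range.1 hv) c

/-- The revenue function with the entry for `c` and `v` set to `0`. -/
def zeroAt (w : Fin k → ℕ → ℚ) (c : Fin k) (v : ℕ) : Fin k → ℕ → ℚ :=
  fun d u => if d = c ∧ u = v then 0 else w d u

theorem zeroAt_of_ne {w : Fin k → ℕ → ℚ} {c d : Fin k} {u v : ℕ} (h : ¬ (d = c ∧ u = v)) :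
    zeroAt w c v d u = w d u := by
  simp [zeroAt, h]

/-- No entry of `w` with an index in `D` can be replaced by `0` without loss. -/
structure IsReduced (Γ : SimpleGraph ℕ) (H : SimpleGraph (Fin k)) (n : ℕ) (w₀ : Fin k → ℕ → ℚ)
    (D : Fin k → ℕ → Prop) (q : ℚ) (w : Fin k → ℕ → ℚ) : Prop where
  nonneg : ∀ c v, 0 ≤ w c v
  le : ∀ c v, w c v ≤ w₀ c v
  opt₀ : IsOpt Γ H n w₀ q
  opt : IsOpt Γ H n w q
  reduced : ∀ v < n, ∀ c, D c v → w c v ≠ 0 → ∀ r, IsOpt Γ H n (zeroAt w c v) r → r < q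

theorem isReduced_init {n : ℕ} {w : Fin k → ℕ → ℚ} {D : Fin k → ℕ → Prop} {q : ℚ}
    (hw : ∀ c v, 0 ≤ w c v) (h : IsOpt Γ H n w q) (hD : ∀ v < n, ∀ c, ¬ D c v) :
    IsReduced Γ H n w D q w :=
  ⟨hw, fun _ _ => le_rfl, h, h, fun v hv c hd => absurd hd (hD v hv c)⟩

theorem IsReduced.mono {n : ℕ} {w w₀ : Fin k → ℕ → ℚ} {D D' : Fin k → ℕ → Prop} {q : ℚ}
    (h : IsReduced Γ H n w₀ D q w) (hD : ∀ v < n, ∀ c, D' c v → D c v) :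
    IsReduced Γ H n w₀ D' q w :=
  ⟨h.nonneg, h.le, h.opt₀, h.opt, fun v hv c hd => h.reduced v hv c (hD v hv c hd)⟩

theorem exists_isBest (f : Finset (Fin k) → ℕ → ℚ) (B : Finset ℕ) (A : Finset (Fin k)) :
    ∃ q, IsBest Γ H f B A q := by
  classical
  have hfin : {r | ∃ s, IsAssign Γ H B A s ∧ r = ∑ v ∈ B, f (s v) v}.Finite := by
    refine (Set.finite_range fun s : B → Finset (Fin k) => ∑ v : B, f (s v) v).subset ?_
    rintro _ ⟨s, -, rfl⟩
    exact ⟨fun v => s v, Finset.sum_coe_sort B fun v => f (s v) v⟩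
  obtain ⟨q, hq⟩ := hfin.exists_maximal ⟨_, _, IsAssign.empty B A, rfl⟩
  exact ⟨q, hq.1, fun r hr => (le_total r q).elim id fun h => hq.2 hr h⟩

theorem IsReduced.keep {n : ℕ} {w w₀ : Fin k → ℕ → ℚ} {D : Fin k → ℕ → Prop} {q r : ℚ}
    (h : IsReduced Γ H n w₀ D q w) {c : Fin k} {v : ℕ} (hr : IsOpt Γ H n (zeroAt w c v) r)
    (hlt : r < q) : IsReduced Γ H n w₀ (fun d u => D d u ∨ d = c ∧ u = v) q w := by
  refine ⟨h.nonneg, h.le, h.opt₀, h.opt, ?_⟩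
  rintro u hu d (hd | ⟨rfl, rfl⟩) hne r' hr'
  · exact h.reduced u hu d hd hne r' hr'
  · exact (hr'.le hr fun _ _ _ => le_rfl).trans_lt hlt

/-- Entries found indispensable earlier stay so: lowering further revenues can only lower the
optimum that remains when such an entry is zeroed. -/
theorem IsReduced.drop {n : ℕ} {w w₀ : Fin k → ℕ → ℚ} {D : Fin k → ℕ → Prop} {q r : ℚ}
    (h : IsReduced Γ H n w₀ D q w) {c : Fin k} {v : ℕ} (hr : IsOpt Γ H n (zeroAt w c v) r)
    (hle : q ≤ r) : IsReduced Γ H n w₀ (fun d u => D d u ∨ d = c ∧ u = v) q (zeroAt w c v) := by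
  have hz : ∀ d u, zeroAt w c v d u ≤ w d u := fun d u => by
    unfold zeroAt
    split_ifs
    · exact h.nonneg d u
    · exact le_rfl
  have hrq : r = q := le_antisymm (hr.le h.opt fun u _ d => hz d u) hle
  refine ⟨fun d u => ?_, fun d u => (hz d u).trans (h.le d u), h.opt₀, hrq ▸ hr, ?_⟩
  · unfold zeroAt
    split_ifs
    · exact le_rfl
    · exact h.nonneg d u
  · rintro u hu d hd hne r' hr'
    have hne' : ¬ (d = c ∧ u = v) := fun e => hne (by simp [zeroAt, e])
    rw [zeroAt_of_ne hne'] at hne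
    obtain ⟨r'', hr''⟩ := exists_isBest (Γ := Γ) (H := H) (maxRev (zeroAt w d u)) (Finset.range n)
      Finset.univ
    refine (hr'.le hr'' fun x _ e => ?_).trans_lt
      (h.reduced u hu d (hd.resolve_right hne') hne r'' hr'')
    by_cases hex : e = d ∧ x = u
    · obtain ⟨rfl, rfl⟩ := hex
      simp [zeroAt]
    · rw [zeroAt_of_ne hex, zeroAt_of_ne hex]
      exact hz e x

/-- The nonzero entries of a reduced revenue function form an optimum solution. -/
theorem IsReduced.exists_assign {n : ℕ} {w w₀ : Fin k → ℕ → ℚ} {D : Fin k → ℕ → Prop} {q : ℚ}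
    (h : IsReduced Γ H n w₀ D q w) (hD : ∀ v < n, ∀ c, D c v) :
    ∃ s, IsAssign Γ H (Finset.range n) Finset.univ s ∧
      (q = ∑ v ∈ Finset.range n, maxRev w (s v) v) ∧
      ∀ v < n, ∀ c, w c v ≠ 0 → c ∈ s v ∧ ∀ d, w d v ≠ 0 → d = c := by
  obtain ⟨⟨s, hs, hq⟩, hmax⟩ := h.opt
  -- Zeroing an indispensable entry must lower the value of the fixed optimum assignment `s`, and it
  -- can do so only in the term of `v`.
  have key : ∀ v < n, ∀ c, w c v ≠ 0 → maxRev (zeroAt w c v) (s v) v < maxRev w (s v) v := by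
    intro v hv c hc
    obtain ⟨r, hr⟩ := exists_isBest (Γ := Γ) (H := H) (maxRev (zeroAt w c v)) (Finset.range n)
      Finset.univ
    have hlt := (hr.2 ⟨s, hs, rfl⟩).trans_lt (h.reduced v hv c (hD v hv c) hc r hr)
    rw [hq] at hlt
    obtain ⟨u, hu, hlt⟩ := Finset.exists_lt_of_sum_lt hlt
    by_cases huv : u = v
    · exact huv ▸ hlt
    · refine absurd hlt (not_lt.2 (maxRev_mono le_rfl fun d _ => ?_))
      rw [zeroAt_of_ne fun e => huv e.2]
  have attained : ∀ v < n, ∀ c, w c v ≠ 0 → c ∈ s v ∧ maxRev w (s v) v ≤ w c v := by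
    intro v hv c hc
    have := key v hv c hc
    constructor
    · by_contra hcs
      refine absurd this (not_lt.2 (maxRev_mono le_rfl fun d hd => ?_))
      rw [zeroAt_of_ne]
      rintro ⟨rfl, -⟩
      exact hcs hd
    · by_contra hlt
      refine absurd this (not_lt.2 ?_)
      rw [not_le] at hlt
      by_contra hcon
      rw [not_le] at hcon
      have h2 : maxRev w (s v) v ≤ max (maxRev (zeroAt w c v) (s v) v) (w c v) := by
        refine maxRev_le.2 ⟨(maxRev_nonneg _ _ _).trans (le_max_left _ _), fun d hd => ?_⟩
        by_cases hdc : d = c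
        · exact hdc ▸ le_max_right _ _
        · refine le_trans ?_ (le_max_left _ _)
          have := le_maxRev (w := zeroAt w c v) (v := v) hd
          rwa [zeroAt_of_ne fun e => hdc e.1] at this
      exact absurd h2 (not_le.2 (max_lt hcon hlt))
  refine ⟨s, hs, hq, fun v hv c hc => ⟨(attained v hv c hc).1, fun d hd => ?_⟩⟩
  -- Two different nonzero colors at `v` would both attain the maximum over `s v`, so zeroing one of
  -- them would not lower it.
  by_contra hdc
  refine absurd (key v hv c hc) (not_lt.2 ?_)
  have h1 := le_maxRev (w := zeroAt w c v) (v := v) (attained v hv d hd).1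
  rw [zeroAt_of_ne fun e => hdc e.1] at h1
  exact (attained v hv d hd).2.trans h1

end SelfReduction

/-! ### Translating the input graph, the revenues and the solution -/

section Input

variable {n k : ℕ} {G : SimpleGraph (Fin n)} {H : SimpleGraph (Fin k)}

/-- The graph on the natural numbers with the same edges. -/
def natGraph (G : SimpleGraph (Fin n)) : SimpleGraph ℕ := G.map Fin.valEmbedding

theorem natGraph_adj {u v : ℕ} : (natGraph G).Adj u v ↔
    ∃ (hu : u < n) (hv : v < n), G.Adj ⟨u, hu⟩ ⟨v, hv⟩ := by
  rw [natGraph, SimpleGraph.map_adj]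
  constructor
  · rintro ⟨a, b, h, rfl, rfl⟩
    exact ⟨a.2, b.2, h⟩
  · rintro ⟨hu, hv, h⟩
    exact ⟨_, _, h, rfl, rfl⟩

theorem natGraph_adj_fin {u v : Fin n} : (natGraph G).Adj u v ↔ G.Adj u v := by
  rw [natGraph_adj]
  exact ⟨fun ⟨_, _, h⟩ => h, fun h => ⟨u.2, v.2, h⟩⟩

/-- The prescribed adjacencies already separate all pairs except the two leaves `b` and `c`, whence
the conclusion `b = c` in `ChairFree`. -/
theorem chairFree_of_inducedFree (h : InducedFree chair G) : ChairFree (natGraph G) := by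
  intro a b c d e ab ac ad de bc bd cd ae be ce
  by_contra hne
  obtain ⟨ha, hb, -⟩ := natGraph_adj.1 ab
  obtain ⟨-, hc, -⟩ := natGraph_adj.1 ac
  obtain ⟨hd, he, -⟩ := natGraph_adj.1 de
  refine h ⟨⟨⟨![⟨a, ha⟩, ⟨b, hb⟩, ⟨c, hc⟩, ⟨d, hd⟩, ⟨e, he⟩], ?_⟩, ?_⟩⟩
  · have n1 := ab.ne
    have n2 := ac.ne
    have n3 := ad.ne
    have n4 := de.ne
    have n5 : b ≠ d := by rintro rfl; exact be de
    have n6 : c ≠ d := by rintro rfl; exact ce de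
    have n7 : a ≠ e := by rintro rfl; exact be ab.symm
    have n8 : b ≠ e := by rintro rfl; exact ae ab
    have n9 : c ≠ e := by rintro rfl; exact ae ac
    intro i j hij
    fin_cases i <;> fin_cases j <;> simp_all
  · have sy : ∀ {x y}, ¬ (natGraph G).Adj x y → ¬ (natGraph G).Adj y x := fun h e => h e.symm
    have i1 := sy bc; have i2 := sy bd; have i3 := sy cd; have i4 := sy ae; have i5 := sy be
    have i6 := sy ce
    have j1 := ab.symm; have j2 := ac.symm; have j3 := ad.symm; have j4 := de.symm
    intro i j
    rw [← natGraph_adj_fin (G := G)]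
    change (natGraph G).Adj ((![⟨a, ha⟩, ⟨b, hb⟩, ⟨c, hc⟩, ⟨d, hd⟩, ⟨e, he⟩] : Fin 5 → Fin n) i)
      ((![⟨a, ha⟩, ⟨b, hb⟩, ⟨c, hc⟩, ⟨d, hd⟩, ⟨e, he⟩] : Fin 5 → Fin n) j) ↔ chair.Adj i j
    fin_cases i <;> fin_cases j <;> simp [chair, *]

theorem bullFree_of_inducedFree (h : InducedFree bull G) : BullFree (natGraph G) := by
  intro a b c d e ab ac bc ad be db dc ea ec
  by_contra de
  obtain ⟨ha, hb, -⟩ := natGraph_adj.1 ab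
  obtain ⟨-, hc, -⟩ := natGraph_adj.1 ac
  obtain ⟨-, hd, -⟩ := natGraph_adj.1 ad
  obtain ⟨-, he, -⟩ := natGraph_adj.1 be
  refine h ⟨⟨⟨![⟨a, ha⟩, ⟨b, hb⟩, ⟨c, hc⟩, ⟨d, hd⟩, ⟨e, he⟩], ?_⟩, ?_⟩⟩
  · have n1 := ab.ne
    have n2 := ac.ne
    have n3 := bc.ne
    have n4 := ad.ne
    have n5 := be.ne
    have n6 : b ≠ d := by rintro rfl; exact dc bc
    have n7 : c ≠ d := by rintro rfl; exact db bc.symm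
    have n8 : a ≠ e := by rintro rfl; exact ec ac
    have n9 : c ≠ e := by rintro rfl; exact ea ac.symm
    have n10 : d ≠ e := by rintro rfl; exact ea ad.symm
    intro i j hij
    fin_cases i <;> fin_cases j <;> simp_all
  · have sy : ∀ {x y}, ¬ (natGraph G).Adj x y → ¬ (natGraph G).Adj y x := fun h e => h e.symm
    have i1 := sy db; have i2 := sy dc; have i3 := sy ea; have i4 := sy ec; have i5 := sy de
    have j1 := ab.symm; have j2 := ac.symm; have j3 := bc.symm; have j4 := ad.symm
    have j5 := be.symm
    intro i j
    rw [← natGraph_adj_fin (G := G)]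
    change (natGraph G).Adj ((![⟨a, ha⟩, ⟨b, hb⟩, ⟨c, hc⟩, ⟨d, hd⟩, ⟨e, he⟩] : Fin 5 → Fin n) i)
      ((![⟨a, ha⟩, ⟨b, hb⟩, ⟨c, hc⟩, ⟨d, hd⟩, ⟨e, he⟩] : Fin 5 → Fin n) j) ↔ bull.Adj i j
    fin_cases i <;> fin_cases j <;> simp [bull, *]

/-- The revenue function, extended by `0`. -/
def natRev (rev : Fin n → Fin k → NNRat) (c : Fin k) (v : ℕ) : ℚ :=
  if h : v < n then rev ⟨v, h⟩ c else 0

theorem natRev_nonneg (rev : Fin n → Fin k → NNRat) (c : Fin k) (v : ℕ) : 0 ≤ natRev rev c v := by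
  unfold natRev
  split_ifs
  · exact NNRat.cast_nonneg _
  · exact le_rfl

/-- A partial coloring is an assignment by singletons and empty sets. -/
theorem Solution.revenue_le {rev : Fin n → Fin k → NNRat} (S : Solution G H) {q : ℚ}
    (hq : IsOpt (natGraph G) H n (natRev rev) q) : (S.revenue rev : ℚ) ≤ q := by
  classical
  let s : ℕ → Finset (Fin k) := fun v =>
    if h : ∃ hv : v < n, (⟨v, hv⟩ : Fin n) ∈ S.X then {S.c ⟨⟨v, h.1⟩, h.2⟩} else ∅
  have sX : ∀ v : Fin n, ∀ hv : v ∈ S.X, s v = {S.c ⟨v, hv⟩} := fun v hv =>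
    dif_pos ⟨v.2, hv⟩
  have mem : ∀ v < n, ∀ c ∈ s v, ∃ (hv : v < n) (hX : (⟨v, hv⟩ : Fin n) ∈ S.X),
      c = S.c ⟨⟨v, hv⟩, hX⟩ := by
    intro v hv c hc
    by_cases hX : (⟨v, hv⟩ : Fin n) ∈ S.X
    · rw [sX ⟨v, hv⟩ hX, Finset.mem_singleton] at hc
      exact ⟨hv, hX, hc⟩
    · have : s v = ∅ := dif_neg fun e => hX e.2
      simp [this] at hc
  refine le_trans ?_ (hq.2 ⟨s, ⟨fun v _ => Finset.subset_univ _, fun u hu v hv e c hc d hd => ?_⟩,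
    rfl⟩)
  · rw [Finset.sum_range fun v => maxRev (natRev rev) (s v) v]
    have h1 : (S.revenue rev : ℚ) = ∑ v : S.X, ((rev v (S.c v) : NNRat) : ℚ) := by
      rw [Solution.revenue, NNRat.cast_sum]
    rw [h1]
    have h2 : ∀ v : S.X, ((rev v (S.c v) : NNRat) : ℚ) ≤ maxRev (natRev rev) (s (v : Fin n)) (v : Fin n) := by
      intro v
      rw [sX v v.2]
      refine le_trans (le_of_eq ?_) (le_maxRev (Finset.mem_singleton_self _))
      simp [natRev]
    refine (Finset.sum_le_sum fun v _ => h2 v).trans ?_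
    rw [Finset.sum_coe_sort S.X fun v : Fin n => maxRev (natRev rev) (s v) v]
    exact Finset.sum_le_sum_of_subset_of_nonneg (Finset.subset_univ _)
      fun v _ _ => maxRev_nonneg _ _ _
  · obtain ⟨h1, h2, rfl⟩ := mem u (Finset.mem_range.1 hu) c hc
    obtain ⟨h3, h4, rfl⟩ := mem v (Finset.mem_range.1 hv) d hd
    obtain ⟨_, _, e⟩ := natGraph_adj.1 e
    exact S.c.map_adj (v := ⟨⟨u, h1⟩, h2⟩) (w := ⟨⟨v, h3⟩, h4⟩) e

/-- Reading off the solution. -/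
theorem IsReduced.exists_solution {rev : Fin n → Fin k → NNRat} {w : Fin k → ℕ → ℚ}
    {D : Fin k → ℕ → Prop} {q : ℚ} (h : IsReduced (natGraph G) H n (natRev rev) D q w)
    (hD : ∀ v < n, ∀ c, D c v) :
    ∃ S : Solution G H, S.IsOptimum rev ∧ (∀ v (hv : v ∈ S.X), 0 < w (S.c ⟨v, hv⟩) v) ∧
      ∀ (v : Fin n) c, 0 < w c v → ∃ hv : v ∈ S.X, S.c ⟨v, hv⟩ = c := by
  classical
  obtain ⟨s, hs, hq, huniq⟩ := h.exists_assign hD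
  have ex : ∀ v : {v : Fin n // ∃ c, 0 < w c v}, ∃ c, 0 < w c v := fun v => v.2
  choose col hcol using ex
  let X : Finset (Fin n) := {v : Fin n | ∃ c, 0 < w c v}
  have hX : ∀ v : Fin n, v ∈ (X : Set (Fin n)) → ∃ c, 0 < w c v := fun v hv => by simpa [X] using hv
  let S : Solution G H := ⟨X, ⟨fun v => col ⟨v, hX v v.2⟩, fun {u v} e => by
    have h1 := hcol ⟨u, hX u u.2⟩
    have h2 := hcol ⟨v, hX v v.2⟩
    exact hs.comp _ (Finset.mem_range.2 u.1.2) _ (Finset.mem_range.2 v.1.2)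
      (natGraph_adj_fin.2 e) _ (huniq _ u.1.2 _ h1.ne').1 _ (huniq _ v.1.2 _ h2.ne').1⟩⟩
  have hpos : ∀ v (hv : v ∈ S.X), 0 < w (S.c ⟨v, hv⟩) v := fun v hv => hcol ⟨v, hX v hv⟩
  refine ⟨S, fun S' => ?_, hpos, fun v c hc => ?_⟩
  · have h1 := S'.revenue_le h.opt₀
    rw [← NNRat.cast_le (K := ℚ)]
    refine h1.trans ?_
    have h2 : (S.revenue rev : ℚ) = ∑ v : S.X, ((rev v (S.c v) : NNRat) : ℚ) := by
      rw [Solution.revenue, NNRat.cast_sum]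
    rw [hq, h2, Finset.sum_range fun v => maxRev w (s v) v]
    have h3 : ∑ v : Fin n, maxRev w (s v) v = ∑ v ∈ S.X, maxRev w (s v) v := by
      refine (Finset.sum_subset (Finset.subset_univ _) fun v _ hv => ?_).symm
      refine le_antisymm (maxRev_le.2 ⟨le_rfl, fun c _ => ?_⟩) (maxRev_nonneg _ _ _)
      by_contra hcon
      exact hv (by simpa [S, X] using ⟨c, not_le.1 hcon⟩)
    rw [h3, ← Finset.sum_coe_sort S.X fun v : Fin n => maxRev w (s v) v]
    refine Finset.sum_le_sum fun v _ => maxRev_le.2 ⟨NNRat.cast_nonneg _, fun c _ => ?_⟩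
    by_cases hc : w c v = 0
    · rw [hc]
      exact NNRat.cast_nonneg _
    · have := (huniq v v.1.2 c hc).2 _ (hpos v v.2).ne'
      rw [← this]
      exact (h.le _ _).trans (le_of_eq (by simp [natRev]))
  · have hv : v ∈ S.X := by simpa [S, X] using ⟨c, hc⟩
    exact ⟨hv, (huniq v v.2 c hc.ne').2 _ (hpos v hv).ne'⟩

end Input

/-! ### Reasoning about statements -/

@[simp] theorem Store.set_arr (s : Store) (i v : ℕ) : (s.set i v).arr = s.arr := rfl

@[simp] theorem Store.set_qarr (s : Store) (i v : ℕ) : (s.set i v).qarr = s.qarr := rfl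

@[simp] theorem Store.set_reg (s : Store) (i v : ℕ) :
    (s.set i v).reg = Function.update s.reg i v := rfl

/-- Assignments touch only arrays, and loops restore their variable. -/
theorem Stmt.den_reg (n : ℕ) (p : Stmt) : ∀ s, (p.den n s).reg = s.reg := by
  induction p with
  | skip => exact fun s => rfl
  | setA => exact fun s => rfl
  | setQ => exact fun s => rfl
  | seq p q ihp ihq => exact fun s => (ihq _).trans (ihp s)
  | ite b p q ihp ihq =>
    intro s
    simp only [Stmt.den]
    split_ifs
    · exact ihp s
    · exact ihq s
  | forN i p ih =>
    intro s
    have key : ∀ m, ∀ r ≠ i, (iter (fun j s' => p.den n (s'.set i j)) m s).reg r = s.reg r := by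
      intro m r hr
      induction m with
      | zero => rfl
      | succ m ihm =>
        simp only [iter, ih, Store.set_reg]
        rw [Function.update_of_ne hr, ihm]
    funext r
    simp only [Stmt.den, Store.set_reg]
    by_cases hr : r = i
    · subst hr
      rw [Function.update_self]
    · rw [Function.update_of_ne hr, key _ r hr]

/-- As statements preserve registers, an invariant needs to speak about arrays only, and each round
may assume the initial registers with `j` in place of the loop variable. -/
theorem Stmt.den_forN {n i : ℕ} {p : Stmt} {s : Store}
    (I : ℕ → (ℕ → ℕ → ℕ) → (ℕ → ℕ → ℚ) → Prop) (h0 : I 0 s.arr s.qarr)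
    (hs : ∀ j ≤ n, ∀ s', s'.reg = Function.update s.reg i j → I j s'.arr s'.qarr →
      I (j + 1) (p.den n s').arr (p.den n s').qarr) :
    I (n + 1) ((Stmt.forN i p).den n s).arr ((Stmt.forN i p).den n s).qarr := by
  have key : ∀ m ≤ n + 1, (∀ r ≠ i, (iter (fun j s' => p.den n (s'.set i j)) m s).reg r = s.reg r) ∧
      I m (iter (fun j s' => p.den n (s'.set i j)) m s).arr
        (iter (fun j s' => p.den n (s'.set i j)) m s).qarr := by
    intro m
    induction m with
    | zero => exact fun _ => ⟨fun _ _ => rfl, h0⟩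
    | succ m ih =>
      intro hm
      obtain ⟨h1, h2⟩ := ih (by omega)
      have hreg : ((iter (fun j s' => p.den n (s'.set i j)) m s).set i m).reg =
          Function.update s.reg i m := by
        funext r
        by_cases hr : r = i
        · subst hr
          simp
        · simp [hr, h1 r hr]
      refine ⟨fun r hr => ?_, hs m (by omega) _ hreg h2⟩
      simp only [iter]
      rw [Stmt.den_reg, hreg, Function.update_of_ne hr]
  exact (key (n + 1) le_rfl).2

/-- The statement may change the array `A`. -/
def Stmt.WritesA : Stmt → ℕ → Prop
  | .skip, _ => False
  | .setA B _ _, A => A = B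
  | .setQ _ _ _, _ => False
  | .seq p q, A => p.WritesA A ∨ q.WritesA A
  | .ite _ p q, A => p.WritesA A ∨ q.WritesA A
  | .forN _ p, A => p.WritesA A

/-- The statement may change the rational array `A`. -/
def Stmt.WritesQ : Stmt → ℕ → Prop
  | .skip, _ => False
  | .setA _ _ _, _ => False
  | .setQ B _ _, A => A = B
  | .seq p q, A => p.WritesQ A ∨ q.WritesQ A
  | .ite _ p q, A => p.WritesQ A ∨ q.WritesQ A
  | .forN _ p, A => p.WritesQ A

theorem Stmt.den_arr {n A : ℕ} {p : Stmt} : ∀ {s}, ¬ p.WritesA A → (p.den n s).arr A = s.arr A := by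
  induction p with
  | skip => exact fun _ => rfl
  | setA B i e =>
    intro s h
    exact Function.update_of_ne h _ _
  | setQ => exact fun _ => rfl
  | seq p q ihp ihq =>
    intro s h
    simp only [WritesA, not_or] at h
    exact (ihq h.2).trans (ihp h.1)
  | ite b p q ihp ihq =>
    intro s h
    simp only [WritesA, not_or] at h
    simp only [Stmt.den]
    split_ifs
    · exact ihp h.1
    · exact ihq h.2
  | forN i p ih =>
    intro s h
    exact Stmt.den_forN (fun _ a _ => a A = s.arr A) rfl fun j _ s' _ h' => (ih h).trans h'

theorem Stmt.den_qarr {n A : ℕ} {p : Stmt} : ∀ {s}, ¬ p.WritesQ A →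
    (p.den n s).qarr A = s.qarr A := by
  induction p with
  | skip => exact fun _ => rfl
  | setA => exact fun _ => rfl
  | setQ B i e =>
    intro s h
    exact Function.update_of_ne h _ _
  | seq p q ihp ihq =>
    intro s h
    simp only [WritesQ, not_or] at h
    exact (ihq h.2).trans (ihp h.1)
  | ite b p q ihp ihq =>
    intro s h
    simp only [WritesQ, not_or] at h
    simp only [Stmt.den]
    split_ifs
    · exact ihp h.1
    · exact ihq h.2
  | forN i p ih =>
    intro s h
    exact Stmt.den_forN (fun _ _ q => q A = s.qarr A) rfl fun j _ s' _ h' => (ih h).trans h'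

/-! ### Derived expressions and statements -/

namespace Expr

def or (a b : Expr .bool) : Expr .bool := .not (.and (.not a) (.not b))

def imp (a b : Expr .bool) : Expr .bool := .not (.and a (.not b))

-- Conditions on `H` and on color sets are decided when the program is written; they become `0 = 0`
-- or `0 = 1`.
open Classical in
noncomputable def ofProp (p : Prop) : Expr .bool := .eq (.const 0) (.const (if p then 0 else 1))

/-- The conjunction over all colors. -/
def allCol {k : ℕ} (l : List (Fin k)) (g : Fin k → Expr .bool) : Expr .bool :=
  l.foldr (fun c b => .and (g c) b) (.eq .len .len)

/-- The maximum of `0` and the values for the colors of `S`. -/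
def maxCol {k : ℕ} (l : List (Fin k)) (S : Finset (Fin k)) (g : Fin k → Expr .rat) : Expr .rat :=
  l.foldr (fun c e => .qmax (if c ∈ S then g c else .qzero) e) .qzero

/-- The maximum over all sets of colors. -/
def maxSub {k : ℕ} : List (Fin k) → (Finset (Fin k) → Expr .rat) → Expr .rat
  | [], f => f ∅
  | c :: l, f => .qmax (maxSub l f) (maxSub l fun S => f (insert c S))

/-- The supremum over the values of several variables. -/
def supNest (l : List ℕ) (e : Expr .rat) : Expr .rat := l.foldr (fun i e => .qsup i e) e

/-- The condition holds. -/
def Sat (n : ℕ) (b : Expr .bool) (s : Store) : Prop := b.eval n s = true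

instance {n : ℕ} {b : Expr .bool} {s : Store} : Decidable (b.Sat n s) :=
  inferInstanceAs (Decidable (b.eval n s = true))

section Eval

variable {n : ℕ} {s : Store} {a b : Expr .bool} {d e : Expr .nat}

@[simp] theorem eval_const {c : ℕ} : (const c).eval n s = c := rfl

@[simp] theorem eval_len : len.eval n s = n := rfl

@[simp] theorem eval_reg {r : ℕ} : (reg r).eval n s = s.reg r := rfl

@[simp] theorem eval_arr {A : ℕ} : (arr A e).eval n s = s.arr A (e.eval n s) := rfl

@[simp] theorem eval_add : (add d e).eval n s = (d.eval n s + e.eval n s : ℕ) := rfl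

@[simp] theorem eval_qzero : qzero.eval n s = (0 : ℚ) := rfl

@[simp] theorem eval_qarr {A : ℕ} : (qarr A e).eval n s = s.qarr A (e.eval n s) := rfl

@[simp] theorem eval_qadd {x y : Expr .rat} :
    (qadd x y).eval n s = (x.eval n s + y.eval n s : ℚ) := rfl

@[simp] theorem eval_qite {x y : Expr .rat} :
    (qite b x y).eval n s = if b.Sat n s then x.eval n s else y.eval n s := rfl

@[simp] theorem eval_qsum {i : ℕ} {x : Expr .rat} :
    (qsum i x).eval n s = ∑ j ∈ Finset.range (n + 1), (x.eval n (s.set i j) : ℚ) := rfl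

@[simp] theorem sat_eq : (eq d e).Sat n s ↔ (d.eval n s : ℕ) = e.eval n s := by
  simp [Sat, eval]

@[simp] theorem sat_lt : (lt d e).Sat n s ↔ (d.eval n s : ℕ) < e.eval n s := by
  simp [Sat, eval]

@[simp] theorem sat_qlt {x y : Expr .rat} :
    (qlt x y).Sat n s ↔ (x.eval n s : ℚ) < y.eval n s := by
  simp [Sat, eval]

@[simp] theorem sat_and :
    (and a b).Sat n s ↔ a.Sat n s ∧ b.Sat n s := by
  simp [Sat, eval]

@[simp] theorem sat_not : (not b).Sat n s ↔ ¬ b.Sat n s := by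
  simp [Sat, eval]

@[simp] theorem sat_or :
    (or a b).Sat n s ↔ a.Sat n s ∨ b.Sat n s := by
  rw [or, sat_not, sat_and, sat_not, sat_not]
  tauto

@[simp] theorem sat_imp :
    (imp a b).Sat n s ↔ (a.Sat n s → b.Sat n s) := by
  rw [imp, sat_not, sat_and, sat_not]
  tauto

@[simp] theorem sat_ofProp {p : Prop} : (ofProp p).Sat n s ↔ p := by
  rw [ofProp, sat_eq, eval_const, eval_const]
  split_ifs <;> simp_all

@[simp] theorem sat_ex {i : ℕ} :
    (ex i b).Sat n s ↔ ∃ j ≤ n, b.Sat n (s.set i j) := by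
  simp [Sat, eval]

theorem sat_find {i j : ℕ} (hj : j ≤ n) (h : b.Sat n (s.set i j)) :
    b.Sat n (s.set i ((find i b).eval n s)) :=
  Nat.findGreatest_spec (P := fun j => b.eval n (s.set i j) = true) hj h

@[simp] theorem sat_allCol {k : ℕ} {l : List (Fin k)} {g : Fin k → Expr .bool} :
    (allCol l g).Sat n s ↔ ∀ c ∈ l, (g c).Sat n s := by
  induction l with
  | nil => exact iff_of_true (sat_eq.2 rfl) (by simp)
  | cons c l ih =>
    rw [allCol, List.foldr_cons, sat_and, ← allCol, ih]
    simp

theorem eval_maxCol {k : ℕ} {l : List (Fin k)} {S : Finset (Fin k)} (hl : ∀ c ∈ S, c ∈ l)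
    {g : Fin k → Expr .rat} :
    (maxCol l S g).eval n s = S.fold max 0 fun c => ((g c).eval n s : ℚ) := by
  have key : ∀ a : ℚ, (maxCol l S g).eval n s ≤ a ↔
      0 ≤ a ∧ ∀ c ∈ l, c ∈ S → ((g c).eval n s : ℚ) ≤ a := by
    intro a
    clear hl
    induction l with
    | nil => simp [maxCol]
    | cons c l ih =>
      have : (maxCol (c :: l) S g).eval n s =
          max ((if c ∈ S then g c else qzero).eval n s : ℚ) ((maxCol l S g).eval n s) := rfl
      rw [this, max_le_iff, ih]
      by_cases hc : c ∈ S
      · simp only [hc, if_true, List.forall_mem_cons, forall_true_left]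
        tauto
      · simp only [hc, if_false, List.forall_mem_cons, eval_qzero]
        tauto
  refine eq_of_forall_ge_iff fun a => ?_
  rw [key, Finset.fold_max_le]
  exact and_congr_right fun _ => ⟨fun h c hc => h c (hl c hc) hc, fun h c _ hc => h c hc⟩

theorem eval_maxSub {k : ℕ} {l : List (Fin k)} : ∀ {f : Finset (Fin k) → Expr .rat},
    IsGreatest {r : ℚ | ∃ S : Finset (Fin k), (∀ c ∈ S, c ∈ l) ∧ r = (f S).eval n s}
      ((maxSub l f).eval n s) := by
  induction l with
  | nil =>
    intro f
    refine ⟨⟨∅, by simp, rfl⟩, ?_⟩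
    rintro _ ⟨S, hS, rfl⟩
    obtain rfl : S = ∅ := Finset.eq_empty_of_forall_notMem fun c hc => List.not_mem_nil (hS c hc)
    exact le_rfl
  | cons c l ih =>
    intro f
    have h1 := ih (f := f)
    have h2 := ih (f := fun S => f (insert c S))
    have he : (maxSub (c :: l) f).eval n s =
      max ((maxSub l f).eval n s : ℚ) ((maxSub l fun S => f (insert c S)).eval n s) := rfl
    rw [he]
    refine ⟨?_, ?_⟩
    · rcases max_choice ((maxSub l f).eval n s : ℚ) ((maxSub l fun S => f (insert c S)).eval n s)
        with h | h
      · rw [h]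
        obtain ⟨S, hS, e⟩ := h1.1
        exact ⟨S, fun d hd => List.mem_cons_of_mem _ (hS d hd), e⟩
      · rw [h]
        obtain ⟨S, hS, e⟩ := h2.1
        refine ⟨insert c S, fun d hd => ?_, e⟩
        rcases Finset.mem_insert.1 hd with rfl | hd
        · exact List.mem_cons_self
        · exact List.mem_cons_of_mem _ (hS d hd)
    · rintro _ ⟨S, hS, rfl⟩
      by_cases hc : c ∈ S
      · refine le_trans ?_ (le_max_right _ _)
        refine h2.2 ⟨S.erase c, fun d hd => ?_, by simp only [Finset.insert_erase hc]⟩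
        exact (List.mem_cons.1 (hS d (Finset.mem_of_mem_erase hd))).resolve_left
          (Finset.ne_of_mem_erase hd)
      · refine le_trans (h1.2 ⟨S, fun d hd => ?_, rfl⟩) (le_max_left _ _)
        exact (List.mem_cons.1 (hS d hd)).resolve_left (by rintro rfl; exact hc hd)

theorem supUpto_le {g : ℕ → ℚ} {m : ℕ} {a : ℚ} :
    supUpto g m ≤ a ↔ 0 ≤ a ∧ ∀ j < m, g j ≤ a := by
  induction m with
  | zero => simp [supUpto]
  | succ m ih =>
    rw [supUpto, max_le_iff, ih, Nat.forall_lt_succ_right]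
    tauto

theorem supUpto_eq (g : ℕ → ℚ) (m : ℕ) : supUpto g m = 0 ∨ ∃ j < m, supUpto g m = g j := by
  induction m with
  | zero => exact Or.inl rfl
  | succ m ih =>
    rw [supUpto]
    rcases max_choice (supUpto g m) (g m) with h | h
    · rw [h]
      rcases ih with ih | ⟨j, hj, ih⟩
      · exact Or.inl ih
      · exact Or.inr ⟨j, by omega, ih⟩
    · rw [h]
      exact Or.inr ⟨m, by omega, rfl⟩

/-- `s'` is `s` with other values at most `n` for the registers in `l`. -/
structure Varies (n : ℕ) (l : List ℕ) (s s' : Store) : Prop where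
  arr : s'.arr = s.arr
  qarr : s'.qarr = s.qarr
  reg : ∀ r ∉ l, s'.reg r = s.reg r
  le : ∀ r ∈ l, s'.reg r ≤ n

theorem Varies.cons {i : ℕ} {l : List ℕ} {s s' : Store} (h : Varies n (i :: l) s s') :
    Varies n l (s.set i (s'.reg i)) s' := by
  refine ⟨h.arr, h.qarr, fun r hr => ?_, fun r hr => h.le r (List.mem_cons_of_mem _ hr)⟩
  by_cases hri : r = i
  · subst hri
    simp
  · simp [hri, h.reg r (by simp [hri, hr])]

theorem eval_le_supNest {l : List ℕ} {x : Expr .rat} : ∀ {s s'}, Varies n l s s' →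
    x.eval n s' ≤ ((supNest l x).eval n s : ℚ) := by
  induction l with
  | nil =>
    intro s s' h
    have : s' = s := by
      obtain ⟨r, a, q⟩ := s
      obtain ⟨r', a', q'⟩ := s'
      obtain ⟨rfl, rfl, h3, -⟩ := h
      simpa using funext fun r => h3 r List.not_mem_nil
    rw [this]
    exact le_rfl
  | cons i l ih =>
    intro s s' h
    refine (ih h.cons).trans ((supUpto_le (g := fun j => ((supNest l x).eval n (s.set i j) : ℚ))
      (m := n + 1)).1 le_rfl |>.2 _ ?_)
    exact Nat.lt_succ_of_le (h.le i List.mem_cons_self)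

theorem supNest_eq {l : List ℕ} (hl : l.Nodup) {x : Expr .rat} : ∀ {s},
    ((supNest l x).eval n s : ℚ) = 0 ∨
      ∃ s', Varies n l s s' ∧ (supNest l x).eval n s = x.eval n s' := by
  induction l with
  | nil => exact fun {s} => Or.inr ⟨s, ⟨rfl, rfl, fun _ _ => rfl, by simp⟩, rfl⟩
  | cons i l ih =>
    intro s
    obtain ⟨hi, hl⟩ := List.nodup_cons.1 hl
    rcases supUpto_eq (fun j => ((supNest l x).eval n (s.set i j) : ℚ)) (n + 1) with h | ⟨j, hj, h⟩
    · exact Or.inl h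
    · rcases ih hl (s := s.set i j) with h' | ⟨s', h1, h2⟩
      · exact Or.inl (h.trans h')
      · refine Or.inr ⟨s', ⟨h1.arr, h1.qarr, fun r hr => ?_, fun r hr => ?_⟩, h.trans h2⟩
        · rw [List.mem_cons, not_or] at hr
          rw [h1.reg r hr.2]
          simp [hr.1]
        · rcases List.mem_cons.1 hr with rfl | hr
          · rw [h1.reg r hi]
            simpa using Nat.lt_succ_iff.1 hj
          · exact h1.le r hr

end Eval

end Expr

/-- The set that the array represents. -/
def members (n : ℕ) (g : ℕ → ℕ) : Finset ℕ := {v ∈ Finset.range n | g v = 1}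

theorem mem_members {n v : ℕ} {g : ℕ → ℕ} : v ∈ members n g ↔ v < n ∧ g v = 1 := by
  simp [members]

namespace Expr

/-- Membership in the set that the array `A` represents. -/
def mem (A : ℕ) (e : Expr .nat) : Expr .bool := .and (.lt e .len) (.eq (.arr A e) (.const 1))

@[simp] theorem sat_mem {n A : ℕ} {e : Expr .nat} {s : Store} :
    (mem A e).Sat n s ↔ (e.eval n s : ℕ) ∈ members n (s.arr A) := by
  rw [mem, sat_and, sat_lt, sat_eq, mem_members]
  rfl

end Expr

namespace Stmt

theorem den_ite {n : ℕ} {b : Expr .bool} {p q : Stmt} {s : Store} :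
    (ite b p q).den n s = if b.Sat n s then p.den n s else q.den n s := rfl

/-- Make `A` represent the set of the numbers that satisfy `b`. -/
def fill (i A : ℕ) (b : Expr .bool) : Stmt :=
  .forN i (.ite b (.setA A (.reg i) (.const 1)) (.setA A (.reg i) (.const 0)))

/-- The test must keep its meaning while `A` is being overwritten, so it may only rely on other
arrays. This is why updated sets are first built in array `7` and then copied. -/
theorem den_fill {n i A : ℕ} {b : Expr .bool} {s : Store} (P : ℕ → Prop)
    (h : ∀ j < n, ∀ s', s'.reg = Function.update s.reg i j → (∀ A' ≠ A, s'.arr A' = s.arr A') →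
      s'.qarr = s.qarr → (b.Sat n s' ↔ P j)) :
    ∀ v, v ∈ members n (((fill i A b).den n s).arr A) ↔ v < n ∧ P v := by
  have := Stmt.den_forN (n := n) (i := i)
    (p := .ite b (.setA A (.reg i) (.const 1)) (.setA A (.reg i) (.const 0))) (s := s)
    (fun j a q => (∀ A' ≠ A, a A' = s.arr A') ∧ q = s.qarr ∧ ∀ v < j, v < n → (a A v = 1 ↔ P v))
    ⟨fun _ _ => rfl, rfl, fun _ h => absurd h (Nat.not_lt_zero _)⟩ ?_
  · intro v
    rw [mem_members]
    exact and_congr_right fun hv => this.2.2 v (by omega) hv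
  · rintro j hj s' hr ⟨h1, h2, h3⟩
    have hrj : s'.reg i = j := by simp [hr]
    have val : ∀ c, ((Stmt.setA A (.reg i) (.const c)).den n s').arr =
        Function.update s'.arr A (Function.update (s'.arr A) j c) := by
      intro c
      simp [Stmt.den, Store.setA, hrj]
    have aux : ∀ c : ℕ, (j < n → (c = 1 ↔ P j)) →
        ((∀ A' ≠ A, ((Stmt.setA A (.reg i) (.const c)).den n s').arr A' = s.arr A') ∧
        ((Stmt.setA A (.reg i) (.const c)).den n s').qarr = s.qarr ∧
        ∀ v < j + 1, v < n → (((Stmt.setA A (.reg i) (.const c)).den n s').arr A v = 1 ↔ P v)) := by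
      intro c hc
      refine ⟨fun A' hA => ?_, h2, fun v hv hvn => ?_⟩
      · rw [val, Function.update_of_ne hA, h1 A' hA]
      · rw [val, Function.update_self]
        rcases Nat.lt_succ_iff_lt_or_eq.1 hv with hv | rfl
        · rw [Function.update_of_ne hv.ne, h3 v hv hvn]
        · rw [Function.update_self, hc hvn]
    rw [den_ite]
    split_ifs with hb
    · exact aux 1 fun hjn => by simp [(h j hjn s' hr h1 h2).1 hb]
    · exact aux 0 fun hjn => by simp [mt (h j hjn s' hr h1 h2).2 hb]

@[simp] theorem fill_writesA {i A A' : ℕ} {b : Expr .bool} : (fill i A b).WritesA A' ↔ A' = A := by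
  simp [fill, WritesA]

@[simp] theorem fill_writesQ {i A A' : ℕ} {b : Expr .bool} : ¬ (fill i A b).WritesQ A' := by
  simp [fill, WritesQ]

/-- Execute a statement for every set of colors. -/
def seqSub {k : ℕ} : List (Fin k) → (Finset (Fin k) → Stmt) → Stmt
  | [], f => f ∅
  | c :: l, f => .seq (seqSub l f) (seqSub l fun S => f (insert c S))

/-- Execute a statement for every color. -/
def seqCol {k : ℕ} (l : List (Fin k)) (p : Fin k → Stmt) : Stmt :=
  l.foldr (fun c q => .seq (p c) q) .skip

theorem seqSub_writesA {k A : ℕ} {l : List (Fin k)} : ∀ {f : Finset (Fin k) → Stmt},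
    (seqSub l f).WritesA A → ∃ S, (f S).WritesA A := by
  induction l with
  | nil => exact fun h => ⟨∅, h⟩
  | cons c l ih => exact fun h => h.elim (fun h => ih h) fun h => (ih h).elim fun S h => ⟨_, h⟩

theorem seqSub_writesQ {k A : ℕ} {l : List (Fin k)} : ∀ {f : Finset (Fin k) → Stmt},
    (seqSub l f).WritesQ A → ∃ S, (f S).WritesQ A := by
  induction l with
  | nil => exact fun h => ⟨∅, h⟩
  | cons c l ih => exact fun h => h.elim (fun h => ih h) fun h => (ih h).elim fun S h => ⟨_, h⟩

theorem den_seqSub_aux {n k : ℕ} {l : List (Fin k)} (r : ℕ → ℕ)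
    (I : (ℕ → ℕ → ℕ) → (ℕ → ℕ → ℚ) → Prop)
    (P : Finset (Fin k) → (ℕ → ℕ → ℕ) → (ℕ → ℕ → ℚ) → Prop) : ∀ (f : Finset (Fin k) → Stmt)
    (g : Finset (Fin k) → Finset (Fin k)),
    (∀ S s, s.reg = r → I s.arr s.qarr → I ((f S).den n s).arr ((f S).den n s).qarr ∧
      P (g S) ((f S).den n s).arr ((f S).den n s).qarr ∧
      ∀ T, P T s.arr s.qarr → P T ((f S).den n s).arr ((f S).den n s).qarr) →
    ∀ s, s.reg = r → I s.arr s.qarr →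
      I ((seqSub l f).den n s).arr ((seqSub l f).den n s).qarr ∧
      (∀ S, (∀ c ∈ S, c ∈ l) → P (g S) ((seqSub l f).den n s).arr ((seqSub l f).den n s).qarr) ∧
      ∀ T, P T s.arr s.qarr → P T ((seqSub l f).den n s).arr ((seqSub l f).den n s).qarr := by
  induction l with
  | nil =>
    intro f g h s hr hI
    obtain ⟨h1, h2, h3⟩ := h ∅ s hr hI
    refine ⟨h1, fun S hS => ?_, h3⟩
    obtain rfl : S = ∅ := Finset.eq_empty_of_forall_notMem fun c hc => List.not_mem_nil (hS c hc)
    exact h2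
  | cons c l ih =>
    intro f g h s hr hI
    obtain ⟨h1, h2, h3⟩ := ih f g h s hr hI
    obtain ⟨h4, h5, h6⟩ := ih (fun S => f (insert c S)) (fun S => g (insert c S))
      (fun S => h (insert c S)) _ ((den_reg n _ _).trans hr) h1
    refine ⟨h4, fun S hS => ?_, fun T hT => h6 T (h3 T hT)⟩
    by_cases hc : c ∈ S
    · have := h5 (S.erase c) fun d hd => (List.mem_cons.1 (hS d (Finset.mem_of_mem_erase hd))).resolve_left
          (Finset.ne_of_mem_erase hd)
      rw [Finset.insert_erase hc] at this
      exact this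
    · exact h6 _ (h2 S fun d hd => (List.mem_cons.1 (hS d hd)).resolve_left
        (by rintro rfl; exact hc hd))

/-- The rule for `seqSub`: `P S` is established for every `S` and never destroyed. -/
theorem den_seqSub {n k : ℕ} {f : Finset (Fin k) → Stmt} {s : Store}
    (I : (ℕ → ℕ → ℕ) → (ℕ → ℕ → ℚ) → Prop)
    (P : Finset (Fin k) → (ℕ → ℕ → ℕ) → (ℕ → ℕ → ℚ) → Prop)
    (h : ∀ S s', s'.reg = s.reg → I s'.arr s'.qarr → I ((f S).den n s').arr ((f S).den n s').qarr ∧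
      P S ((f S).den n s').arr ((f S).den n s').qarr ∧
      ∀ T, P T s'.arr s'.qarr → P T ((f S).den n s').arr ((f S).den n s').qarr)
    (hI : I s.arr s.qarr) :
    I ((seqSub (List.finRange k) f).den n s).arr ((seqSub (List.finRange k) f).den n s).qarr ∧
      ∀ S, P S ((seqSub (List.finRange k) f).den n s).arr
        ((seqSub (List.finRange k) f).den n s).qarr := by
  obtain ⟨h1, h2, -⟩ := den_seqSub_aux (l := List.finRange k) s.reg I P f id h s rfl hI
  exact ⟨h1, fun S => h2 S fun c _ => List.mem_finRange c⟩

theorem den_seqCol_aux {n k : ℕ} {p : Fin k → Stmt} {r : ℕ → ℕ}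
    (I : (Fin k → Prop) → (ℕ → ℕ → ℕ) → (ℕ → ℕ → ℚ) → Prop)
    (h : ∀ c D s, s.reg = r → I D s.arr s.qarr →
      I (fun d => D d ∨ d = c) ((p c).den n s).arr ((p c).den n s).qarr) {l : List (Fin k)} :
    ∀ D s, s.reg = r → I D s.arr s.qarr →
      I (fun d => D d ∨ d ∈ l) ((seqCol l p).den n s).arr ((seqCol l p).den n s).qarr := by
  induction l with
  | nil =>
    intro D s _ hI
    simpa [seqCol, den] using hI
  | cons c l ih =>
    intro D s hr hI
    have := ih _ _ ((den_reg n (p c) s).trans hr) (h c D s hr hI)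
    simpa only [seqCol, List.foldr_cons, den, List.mem_cons, or_assoc] using this

/-- The rule for `seqCol`: `I D` is what holds when the colors in `D` are done. -/
theorem den_seqCol {n k : ℕ} {p : Fin k → Stmt} {s : Store}
    (I : (Fin k → Prop) → (ℕ → ℕ → ℕ) → (ℕ → ℕ → ℚ) → Prop)
    (h : ∀ c D s', s'.reg = s.reg → I D s'.arr s'.qarr →
      I (fun d => D d ∨ d = c) ((p c).den n s').arr ((p c).den n s').qarr)
    (h0 : I (fun _ => False) s.arr s.qarr) :
    I (fun _ => True) ((seqCol (List.finRange k) p).den n s).arr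
      ((seqCol (List.finRange k) p).den n s).qarr := by
  simpa using den_seqCol_aux I h (l := List.finRange k) _ s rfl h0

end Stmt

/-- Names for rational arrays. -/
noncomputable def qName {k : ℕ} (t : ℕ) (S T : Finset (Fin k)) : ℕ := Encodable.encode (t, S, T) + 1

@[simp] theorem qName_inj {k t t' : ℕ} {S T S' T' : Finset (Fin k)} :
    qName t S T = qName t' S' T' ↔ t = t' ∧ S = S' ∧ T = T' := by
  simp [qName]

-- Rational array `0` stays reserved for the revenues.
@[simp] theorem qName_ne_zero {k t : ℕ} {S T : Finset (Fin k)} : qName t S T ≠ 0 := by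
  simp [qName]

/-! ### The program: definitions -/

namespace Prog

/-- The register-like entry of the array `A`. -/
def sc (A : ℕ) : Expr .nat := .arr A (.const 0)

/-- The row offset comes from a table, as the machine does not multiply; the range checks prevent an
index from running into another row. Arrays: `0` adjacency, `1` output, `2` and `3` multiples of `n`
and `k`, `4` vertices not yet contracted away, `5` current module, `6` closure, `7` scratch, `8`
segment, `9` and `10` its ends, `11` next vertex, `12` representative of the module. Kinds of
rational arrays: `0` values of contracted vertices, `1` values of the module, `2` and `3` old and
new segment tables, `4` computed optimum, `5` reference optimum, `6` saved revenue. -/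
def adjE (d e : Expr .nat) : Expr .bool :=
  .and (.lt d .len) (.and (.lt e .len) (.eq (.arr 0 (.add (.arr 2 d) e)) (.const 1)))

/-- One round of the computation of the smallest module of array `4` that contains array `6`. -/
def closeStep : Stmt :=
  .seq (.fill 5 7 (.and (.mem 4 (.reg 5)) (.or (.mem 6 (.reg 5))
      (.and (.ex 6 (.and (.mem 6 (.reg 6)) (adjE (.reg 5) (.reg 6))))
        (.ex 6 (.and (.mem 6 (.reg 6)) (.not (adjE (.reg 5) (.reg 6)))))))))
    (.fill 5 6 (.mem 7 (.reg 5)))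

/-- Replace the module in array `5` by the smallest module that contains two of its elements. -/
def pairStep : Stmt :=
  .ite (.and (.and (.mem 5 (.reg 2)) (.mem 5 (.reg 3))) (.not (.eq (.reg 2) (.reg 3))))
    (.seq (.fill 5 6 (.or (.eq (.reg 5) (.reg 2)) (.eq (.reg 5) (.reg 3))))
      (.seq (.forN 4 closeStep) (.fill 5 5 (.mem 6 (.reg 5))))) .skip

/-- Compute a minimal module of array `4` in array `5`. -/
def minModule : Stmt := .seq (.fill 5 5 (.mem 4 (.reg 5))) (.forN 2 (.forN 3 pairStep))

def coDiamondE : Expr .bool :=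
  .ex 6 (.ex 7 (.ex 8 (.ex 9 (.and (.and (.and (.mem 5 (.reg 6)) (.mem 5 (.reg 7)))
    (.and (.mem 5 (.reg 8)) (.mem 5 (.reg 9))))
    (.and (adjE (.reg 6) (.reg 7)) (.and (.not (.eq (.reg 8) (.reg 9)))
    (.and (.not (adjE (.reg 8) (.reg 9))) (.and (.not (adjE (.reg 8) (.reg 6)))
    (.and (.not (adjE (.reg 8) (.reg 7))) (.and (.not (adjE (.reg 9) (.reg 6)))
    (.not (adjE (.reg 9) (.reg 7)))))))))))))

section

variable {k : ℕ}

/-- Assign to entry `0` of the arrays of kind `t`. -/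
noncomputable def assign₂ (t : ℕ) (e : Finset (Fin k) → Finset (Fin k) → Expr .rat) : Stmt :=
  .seqSub (List.finRange k) fun S => .seqSub (List.finRange k) fun T =>
    .setQ (qName t S T) (.const 0) (e S T)

noncomputable def pathInit (A : Finset (Fin k)) : Stmt :=
  .seq (.setA 9 (.const 0) (sc 12)) (.seq (.setA 10 (.const 0) (sc 12))
    (.seq (.fill 5 8 (.eq (.reg 5) (sc 12)))
      (assign₂ 2 fun S T => .qarr (qName 0 (S ∩ T ∩ A) ∅) (sc 12))))

/-- The vertices by which the segment can be extended. -/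
def nextE : Expr .bool :=
  .and (.and (.mem 5 (.reg 6)) (.not (.mem 8 (.reg 6))))
    (.or (adjE (.reg 6) (sc 9)) (adjE (.reg 6) (sc 10)))

noncomputable def candE (H : SimpleGraph (Fin k)) (A S T R S₁ T₁ : Finset (Fin k)) : Expr .bool :=
  .and (.ofProp (R ⊆ S ∩ A)) (.and (.imp (adjE (sc 11) (sc 9)) (.ofProp (Comp H R S₁)))
    (.and (.imp (adjE (sc 11) (sc 10)) (.ofProp (Comp H R T₁)))
      (.or (.and (adjE (sc 11) (sc 9)) (.ofProp (T₁ ⊆ T)))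
        (.and (.not (adjE (sc 11) (sc 9))) (.ofProp (S₁ ⊆ T))))))

noncomputable def pathUpdateE (H : SimpleGraph (Fin k)) (A S T : Finset (Fin k)) : Expr .rat :=
  .maxSub (List.finRange k) fun R => .maxSub (List.finRange k) fun S₁ =>
    .maxSub (List.finRange k) fun T₁ => .qite (candE H A S T R S₁ T₁)
      (.qadd (.qarr (qName 0 R ∅) (sc 11)) (.qarr (qName 2 S₁ T₁) (.const 0))) .qzero

noncomputable def pathExtend (H : SimpleGraph (Fin k)) (A : Finset (Fin k)) : Stmt :=
  -- Each new entry may depend on the entire old table, so the update goes through the arrays of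
  -- kind `3`.
  .seq (.setA 11 (.const 0) (.find 6 nextE)) (.seq (assign₂ 3 (pathUpdateE H A))
    (.seq (assign₂ 2 fun S T : Finset (Fin k) => .qarr (qName 3 S T) (.const 0))
      -- The second end is updated first, because it may take over the old first end.
      (.seq (.ite (adjE (sc 11) (sc 9)) .skip (.setA 10 (.const 0) (sc 9)))
        (.seq (.setA 9 (.const 0) (sc 11)) (.setA 8 (sc 11) (.const 1))))))

/-- The optimum for the module in array `5`, if it induces a path or a cycle. -/
noncomputable def path (H : SimpleGraph (Fin k)) (A : Finset (Fin k)) : Stmt :=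
  .seq (pathInit A) (.seq (.forN 4 (.ite (.ex 6 nextE) (pathExtend H A) .skip))
    (.setQ (qName 1 A ∅) (.const 0) (.qarr (qName 2 (Finset.univ : Finset (Fin k)) Finset.univ)
      (.const 0))))

/-- Witnesses live in the registers from `10` on; the smaller ones serve as variables of loops and
quantifiers. -/
def wit₁ (c : Fin k) : Expr .nat := .reg (2 * c + 10)

def wit₂ (c : Fin k) : Expr .nat := .reg (2 * c + 11)

def consistentE (k : ℕ) : Expr .bool :=
  .allCol (List.finRange k) fun c => .imp (.and (.mem 5 (wit₁ c)) (.mem 5 (wit₂ c)))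
    (.and (.not (.eq (wit₁ c) (wit₂ c))) (.not (adjE (wit₁ c) (wit₂ c))))

noncomputable def allowedE (H : SimpleGraph (Fin k)) (c : Fin k) : Expr .bool :=
  .and (.or (.and (.mem 5 (wit₁ c)) (.mem 5 (wit₂ c)))
      (.or (.eq (.reg 6) (wit₁ c)) (.eq (.reg 6) (wit₂ c))))
    (.allCol (List.finRange k) fun d => .or (.ofProp (H.Adj c d))
      (.and (.imp (.mem 5 (wit₁ d)) (.not (adjE (wit₁ d) (.reg 6))))
        (.imp (.mem 5 (wit₂ d)) (.not (adjE (wit₂ d) (.reg 6))))))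

/-- The optimum value at the vertex in register `6`, given the witnesses. -/
noncomputable def vertexE (H : SimpleGraph (Fin k)) (A : Finset (Fin k)) : Expr .rat :=
  .maxSub (List.finRange k) fun S => .qite (.and (.ofProp (S ⊆ A))
    (.allCol (List.finRange k) fun c => .or (.ofProp (c ∉ S)) (allowedE H c)))
    (.qarr (qName 0 S ∅) (.reg 6)) .qzero

/-- The optimum for the module in array `5`, if it has no co-diamond. -/
noncomputable def witnessE (H : SimpleGraph (Fin k)) (A : Finset (Fin k)) : Expr .rat :=
  .supNest ((List.range (2 * k)).map (· + 10)) (.qite (consistentE k)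
    (.qsum 6 (.qite (.mem 5 (.reg 6)) (vertexE H A) .qzero)) .qzero)

/-- The optimum values for the module in array `5`. -/
noncomputable def moduleValues (H : SimpleGraph (Fin k)) : Stmt :=
  .ite coDiamondE (.seqSub (List.finRange k) (path H))
    (.seqSub (List.finRange k) fun A => .setQ (qName 1 A ∅) (.const 0) (witnessE H A))

/-- Contract a minimal module. -/
noncomputable def contract (H : SimpleGraph (Fin k)) : Stmt :=
  .seq minModule (.seq (.setA 12 (.const 0) (.find 6 (.mem 5 (.reg 6))))
    (.seq (moduleValues H) (.seq (.seqSub (List.finRange k) fun A : Finset (Fin k) =>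
        .setQ (qName 0 A ∅) (sc 12) (.qarr (qName 1 A ∅) (.const 0)))
      (.seq (.fill 5 7 (.and (.mem 4 (.reg 5)) (.or (.not (.mem 5 (.reg 5)))
        (.eq (.reg 5) (sc 12))))) (.fill 5 4 (.mem 7 (.reg 5)))))))

/-- The revenue of the color `c` at `e`. -/
def revE (c : Fin k) (e : Expr .nat) : Expr .rat := .qarr 0 (.add (.arr 3 e) (.const c))

noncomputable def initTables (k : ℕ) : Stmt :=
  .forN 5 (.seqSub (List.finRange k) fun S : Finset (Fin k) => .setQ (qName 0 S ∅) (.reg 5)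
    (.maxCol (List.finRange k) S fun c => revE c (.reg 5)))

/-- Compute the optimum value for the current revenue function. -/
noncomputable def solve (H : SimpleGraph (Fin k)) : Stmt :=
  .seq (initTables k) (.seq (.fill 5 4 (.lt (.reg 5) .len)) (.seq (.forN 1 (contract H))
    (.setQ (qName 4 (∅ : Finset (Fin k)) ∅) (.const 0) (.qsum 6 (.qite (.mem 4 (.reg 6))
      (.qarr (qName 0 (Finset.univ : Finset (Fin k)) ∅) (.reg 6)) .qzero)))))

/-- Replace the revenue of `c` at the vertex in register `0` by `0`, if this does not change the
optimum. -/
noncomputable def tryZero (H : SimpleGraph (Fin k)) (c : Fin k) : Stmt :=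
  .seq (.setQ (qName 6 (∅ : Finset (Fin k)) ∅) (.const 0) (revE c (.reg 0)))
    (.seq (.setQ 0 (.add (.arr 3 (.reg 0)) (.const c)) .qzero) (.seq (solve H)
      (.ite (.qlt (.qarr (qName 4 (∅ : Finset (Fin k)) ∅) (.const 0))
          (.qarr (qName 5 (∅ : Finset (Fin k)) ∅) (.const 0)))
        (.setQ 0 (.add (.arr 3 (.reg 0)) (.const c))
          (.qarr (qName 6 (∅ : Finset (Fin k)) ∅) (.const 0))) .skip)))

/-- Tables of multiples of `n` and `k`. -/
def multiples (k : ℕ) : Stmt :=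
  .seq (.setA 2 (.const 0) (.const 0)) (.seq (.setA 3 (.const 0) (.const 0))
    (.forN 0 (.seq (.setA 2 (.add (.reg 0) (.const 1)) (.add (.arr 2 (.reg 0)) .len))
      (.setA 3 (.add (.reg 0) (.const 1)) (.add (.arr 3 (.reg 0)) (.const k))))))

noncomputable def output (k : ℕ) : Stmt :=
  .forN 0 (.seq (.setA 1 (.reg 0) (.const 0)) (.seqCol (List.finRange k) fun c =>
    .ite (.qlt .qzero (revE c (.reg 0))) (.setA 1 (.reg 0) (.const (c + 1))) .skip))

noncomputable def main (H : SimpleGraph (Fin k)) : Stmt :=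
  .seq (multiples k) (.seq (solve H) (.seq (.setQ (qName 5 (∅ : Finset (Fin k)) ∅) (.const 0)
      (.qarr (qName 4 (∅ : Finset (Fin k)) ∅) (.const 0)))
    (.seq (.forN 0 (.ite (.lt (.reg 0) .len) (.seqCol (List.finRange k) (tryZero H)) .skip))
      (output k))))

end

/-! ### The program: minimal modules -/

/-- The arrays with the input graph and the tables of multiples. -/
structure Env (n k : ℕ) (Γ : SimpleGraph ℕ) (a : ℕ → ℕ → ℕ) : Prop where
  row : ∀ i ≤ n, a 2 i = n * i
  rk : ∀ i ≤ n, a 3 i = k * i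
  adj : ∀ u < n, ∀ v < n, a 0 (n * u + v) = 1 ↔ Γ.Adj u v
  lt : ∀ u v, Γ.Adj u v → u < n

section

variable {n k : ℕ} {Γ : SimpleGraph ℕ} {s : Store}

theorem Env.congr {a a' : ℕ → ℕ → ℕ} (h : Env n k Γ a) (h0 : ∀ A < 4, A ≠ 1 → a' A = a A) :
    Env n k Γ a' := by
  obtain ⟨h1, h2, h3, h4⟩ := h
  refine ⟨?_, ?_, ?_, h4⟩
  · rwa [h0 2 (by omega) (by omega)]
  · rwa [h0 3 (by omega) (by omega)]
  · rwa [h0 0 (by omega) (by omega)]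

/-- The meaning of `adjE`. -/
def AdjIn (n : ℕ) (a : ℕ → ℕ → ℕ) (u v : ℕ) : Prop := u < n ∧ v < n ∧ a 0 (a 2 u + v) = 1

@[simp] theorem sat_adjE {d e : Expr .nat} :
    (adjE d e).Sat n s ↔ AdjIn n s.arr (d.eval n s) (e.eval n s) := by
  simp only [adjE, Expr.sat_and, Expr.sat_lt, Expr.sat_eq, Expr.eval_len, Expr.eval_arr,
    Expr.eval_add, Expr.eval_const, AdjIn]

theorem Env.adjIn {a : ℕ → ℕ → ℕ} (h : Env n k Γ a) {u v : ℕ} : AdjIn n a u v ↔ Γ.Adj u v := by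
  constructor
  · rintro ⟨h1, h2, h3⟩
    rw [h.row _ h1.le] at h3
    exact (h.adj _ h1 _ h2).1 h3
  · intro h1
    have h2 := h.lt _ _ h1
    have h3 := h.lt _ _ h1.symm
    refine ⟨h2, h3, ?_⟩
    rw [h.row _ h2.le]
    exact (h.adj _ h2 _ h3).2 h1

@[simp] theorem eval_sc {A : ℕ} : (sc A).eval n s = s.arr A 0 := rfl

theorem den_seq {p q : Stmt} : (Stmt.seq p q).den n s = q.den n (p.den n s) := rfl

theorem den_closeStep (h : Env n k Γ s.arr) :
    members n ((closeStep.den n s).arr 6) =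
      splitStep Γ (members n (s.arr 4)) (members n (s.arr 6)) := by
  rw [closeStep, den_seq]
  ext v
  rw [Stmt.den_fill (fun v => v ∈ splitStep Γ (members n (s.arr 4)) (members n (s.arr 6)))]
  · exact and_iff_right_of_imp fun hv => (mem_members.1 (splitStep_subset _ _ hv)).1
  · intro j hj s' hr ha hq
    rw [Expr.sat_mem, ha 7 (by decide), Stmt.den_fill
      (fun v => v ∈ splitStep Γ (members n (s.arr 4)) (members n (s.arr 6)))]
    · simp [hr, hj]
    · intro j hj s' hr ha hq
      have he : Env n k Γ s'.arr := h.congr fun A hA _ => ha A (by omega)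
      have hle : ∀ {P : ℕ → Prop}, (∃ i ≤ n, i ∈ members n (s.arr 6) ∧ P i) ↔
          ∃ i ∈ members n (s.arr 6), P i := fun {P} =>
        ⟨fun ⟨i, _, h⟩ => ⟨i, h⟩, fun ⟨i, h⟩ => ⟨i, (mem_members.1 h.1).1.le, h⟩⟩
      simp [he.adjIn, mem_splitStep, hr, ha 4 (by decide), ha 6 (by decide), hle]

theorem den_close (h : Env n k Γ s.arr) {u v : ℕ} (hc : IsPartialClosure Γ (members n (s.arr 4)) u v 0
    (members n (s.arr 6))) : IsPartialClosure Γ (members n (s.arr 4)) u v (n + 1)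
      (members n (((Stmt.forN 4 closeStep).den n s).arr 6)) := by
  refine (Stmt.den_forN (fun j a _ => (∀ A < 5, a A = s.arr A) ∧
    IsPartialClosure Γ (members n (s.arr 4)) u v j (members n (a 6))) ⟨fun _ _ => rfl, hc⟩ ?_).2
  rintro j hj s' - ⟨h1, h2⟩
  refine ⟨fun A hA => ?_, ?_⟩
  · rw [Stmt.den_arr, h1 A hA]
    simp only [closeStep, Stmt.WritesA, Stmt.fill_writesA]
    omega
  · rw [den_closeStep (h.congr fun A hA _ => h1 A (by omega)), h1 4 (by omega)]
    exact h2.step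

theorem card_members (n : ℕ) (g : ℕ → ℕ) : (members n g).card ≤ n :=
  (Finset.card_filter_le _ _).trans (Finset.card_range n).le

theorem den_pairStep (h : Env n k Γ s.arr) {D : ℕ → ℕ → Prop}
    (hD : IsMinModFor Γ (members n (s.arr 4)) D (members n (s.arr 5))) :
    IsMinModFor Γ (members n (s.arr 4)) (fun u v => D u v ∨ u = s.reg 2 ∧ v = s.reg 3)
      (members n ((pairStep.den n s).arr 5)) := by
  rw [pairStep, Stmt.den_ite]
  split_ifs with hb
  · simp only [Expr.sat_and, Expr.sat_not, Expr.sat_mem, Expr.sat_eq, Expr.eval_reg] at hb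
    obtain ⟨⟨hu, hv⟩, huv⟩ := hb
    rw [den_seq, den_seq]
    set s₁ := (Stmt.fill 5 6 (.or (.eq (.reg 5) (.reg 2)) (.eq (.reg 5) (.reg 3)))).den n s with hs₁
    have a₁ : ∀ A ≠ 6, s₁.arr A = s.arr A := fun A hA => Stmt.den_arr (by simpa using hA)
    have m₁ : members n (s₁.arr 6) = {s.reg 2, s.reg 3} := by
      ext v
      rw [hs₁, Stmt.den_fill (fun v => v = s.reg 2 ∨ v = s.reg 3)]
      · rw [Finset.mem_insert, Finset.mem_singleton]
        refine and_iff_right_of_imp ?_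
        rintro (rfl | rfl)
        · exact (mem_members.1 hu).1
        · exact (mem_members.1 hv).1
      · intro j hj s' hr ha hq
        simp [hr]
    have hc := den_close (u := s.reg 2) (v := s.reg 3) (s := s₁)
      (h.congr fun A hA _ => a₁ A (by omega)) (by
        rw [m₁, a₁ 4 (by omega)]
        exact isPartialClosure_pair (hD.mod.1 hu) (hD.mod.1 hv))
    rw [a₁ 4 (by omega)] at hc
    have := hD.closure hu hv huv hc ((card_members _ _).trans (Nat.le_succ n))
    convert this using 1
    ext v
    rw [Stmt.den_fill (fun v => v ∈ members n (((Stmt.forN 4 closeStep).den n s₁).arr 6))]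
    · exact and_iff_right_of_imp fun hv => (mem_members.1 hv).1
    · intro j hj s' hr ha hq
      simp [hr, ha 6 (by decide)]
  · simp only [Expr.sat_and, Expr.sat_not, Expr.sat_mem, Expr.sat_eq, Expr.eval_reg] at hb
    refine hD.mono fun u hu v hv huv => ?_
    rintro (hd | ⟨rfl, rfl⟩)
    · exact hd
    · exact absurd ⟨⟨hu, hv⟩, huv⟩ hb

theorem pairStep_writesA {A : ℕ} : pairStep.WritesA A → A = 5 ∨ A = 6 ∨ A = 7 := by
  simp only [pairStep, closeStep, Stmt.WritesA, Stmt.fill_writesA]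
  tauto

theorem minModule_writesA {A : ℕ} (h : minModule.WritesA A) : A = 5 ∨ A = 6 ∨ A = 7 := by
  simp only [minModule, Stmt.WritesA, Stmt.fill_writesA] at h
  exact h.elim Or.inl pairStep_writesA

theorem minModule_writesQ {A : ℕ} : ¬ minModule.WritesQ A := by
  simp [minModule, pairStep, closeStep, Stmt.WritesQ]

theorem den_minModule (h : Env n k Γ s.arr) :
    IsMinMod Γ (members n (s.arr 4)) (members n ((minModule.den n s).arr 5)) ∧
      ((members n ((minModule.den n s).arr 5)).card ≤ 1 →
        members n ((minModule.den n s).arr 5) = members n (s.arr 4)) := by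
  rw [minModule, den_seq]
  set s₁ := (Stmt.fill 5 5 (.mem 4 (.reg 5))).den n s with hs₁
  have a₁ : ∀ A ≠ 5, s₁.arr A = s.arr A := fun A hA => Stmt.den_arr (by simpa using hA)
  have m₁ : members n (s₁.arr 5) = members n (s.arr 4) := by
    ext v
    rw [hs₁, Stmt.den_fill (fun v => v ∈ members n (s.arr 4))]
    · exact and_iff_right_of_imp fun hv => (mem_members.1 hv).1
    · intro j hj s' hr ha hq
      simp [hr, ha 4 (by decide)]
  have key := Stmt.den_forN (n := n) (i := 2) (p := .forN 3 pairStep) (s := s₁) (fun j a _ =>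
    (∀ A < 5, a A = s.arr A) ∧ IsMinModFor Γ (members n (s.arr 4)) (fun u _ => u < j)
      (members n (a 5))) ⟨fun A hA => a₁ A (by omega), ?_⟩ ?_
  · have h2 := key.2
    refine ⟨h2.isMinMod fun u hu v _ => ?_, h2.two⟩
    have := (mem_members.1 hu).1
    omega
  · rw [m₁]
    exact isMinModFor_self _ fun u v => Nat.not_lt_zero u
  · rintro j hj s₂ hr ⟨h1, h2⟩
    -- Pairs are treated in lexicographic order: those with first entry below `j`, and those with
    -- first entry `j` and second entry below `l`.
    have := Stmt.den_forN (n := n) (i := 3) (p := pairStep) (s := s₂) (fun l a _ =>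
      (∀ A < 5, a A = s.arr A) ∧ IsMinModFor Γ (members n (s.arr 4))
        (fun u v => u < j ∨ u = j ∧ v < l) (members n (a 5))) ⟨h1, ?_⟩ ?_
    · refine ⟨this.1, this.2.mono fun u hu v hv _ => ?_⟩
      have := (mem_members.1 hv).1
      omega
    · exact h2.mono fun u _ v _ _ => by omega
    · rintro l hl s₃ hr₃ ⟨h3, h4⟩
      refine ⟨fun A hA => ?_, ?_⟩
      · rw [Stmt.den_arr, h3 A hA]
        intro hw
        have := pairStep_writesA hw
        omega
      · have e2 : s₃.reg 2 = j := by rw [hr₃, hr]; simp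
        have e3 : s₃.reg 3 = l := by rw [hr₃]; simp
        rw [← h3 4 (by omega)] at h4 ⊢
        refine (den_pairStep (h.congr fun A hA _ => h3 A (by omega)) h4).mono
          fun u _ v _ _ => ?_
        rw [e2, e3]
        omega

theorem sat_coDiamondE (h : Env n k Γ s.arr) : coDiamondE.Sat n s ↔
    ∃ u ∈ members n (s.arr 5), ∃ v ∈ members n (s.arr 5), ∃ w ∈ members n (s.arr 5),
      ∃ x ∈ members n (s.arr 5), IsCoDiamond Γ u v w x := by
  simp only [coDiamondE, Expr.sat_ex, Expr.sat_and, Expr.sat_not, Expr.sat_mem, Expr.sat_eq,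
    Expr.eval_reg, sat_adjE, h.adjIn, Store.set_arr, Store.set_reg, Function.update_apply,
    Nat.reduceEqDiff, if_true, if_false]
  constructor
  · rintro ⟨u, -, v, -, w, -, x, -, ⟨⟨hu, hv⟩, hw, hx⟩, hd⟩
    exact ⟨u, hu, v, hv, w, hw, x, hx, hd⟩
  · rintro ⟨u, hu, v, hv, w, hw, x, hx, hd⟩
    exact ⟨u, (mem_members.1 hu).1.le, v, (mem_members.1 hv).1.le, w, (mem_members.1 hw).1.le, x,
      (mem_members.1 hx).1.le, ⟨⟨hu, hv⟩, hw, hx⟩, hd⟩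

end

end Prog

namespace Prog

section

variable {n k : ℕ} {Γ : SimpleGraph ℕ} {H : SimpleGraph (Fin k)} {s : Store}

@[simp] theorem den_setA_arr {A : ℕ} {i e : Expr .nat} : ((Stmt.setA A i e).den n s).arr =
    Function.update s.arr A (Function.update (s.arr A) (i.eval n s) (e.eval n s)) := rfl

@[simp] theorem den_setA_qarr {A : ℕ} {i e : Expr .nat} :
    ((Stmt.setA A i e).den n s).qarr = s.qarr := rfl

@[simp] theorem den_setQ_qarr {A : ℕ} {i : Expr .nat} {e : Expr .rat} :
    ((Stmt.setQ A i e).den n s).qarr =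
    Function.update s.qarr A (Function.update (s.qarr A) (i.eval n s) (e.eval n s)) := rfl

/-- Injective names keep the assignments apart, and the written values must not depend on the arrays
being written; so the order of the sets is irrelevant. -/
theorem den_seqSub_setQ {nm : Finset (Fin k) → ℕ} (hnm : Function.Injective nm) {i : Expr .nat}
    {e : Finset (Fin k) → Expr .rat} {idx : ℕ} {val : Finset (Fin k) → ℚ}
    (h : ∀ S s', s'.reg = s.reg → s'.arr = s.arr →
      (∀ A, (∀ S, A ≠ nm S) → s'.qarr A = s.qarr A) → i.eval n s' = idx ∧ (e S).eval n s' = val S) :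
    ∀ S, ((Stmt.seqSub (List.finRange k) fun S => .setQ (nm S) i (e S)).den n s).qarr (nm S) =
      Function.update (s.qarr (nm S)) idx (val S) := by
  refine (Stmt.den_seqSub (fun a q => a = s.arr ∧ (∀ A, (∀ S, A ≠ nm S) → q A = s.qarr A) ∧
    ∀ S, q (nm S) = s.qarr (nm S) ∨ q (nm S) = Function.update (s.qarr (nm S)) idx (val S))
    (fun S _ q => q (nm S) = Function.update (s.qarr (nm S)) idx (val S)) ?_
    ⟨rfl, fun _ _ => rfl, fun _ => Or.inl rfl⟩).2
  rintro S s' hr ⟨h1, h2, h3⟩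
  obtain ⟨h4, h5⟩ := h S s' hr h1 h2
  have new : ((Stmt.setQ (nm S) i (e S)).den n s').qarr (nm S) =
      Function.update (s.qarr (nm S)) idx (val S) := by
    rw [den_setQ_qarr, Function.update_self, h4, h5]
    rcases h3 S with h3 | h3 <;> rw [h3]
    exact Function.update_idem _ _ _
  have old : ∀ T, T ≠ S → ((Stmt.setQ (nm S) i (e S)).den n s').qarr (nm T) = s'.qarr (nm T) :=
    fun T hT => by rw [den_setQ_qarr, Function.update_of_ne (hnm.ne hT)]
  refine ⟨⟨h1, fun A hA => ?_, fun T => ?_⟩, new, fun T hT => ?_⟩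
  · rw [den_setQ_qarr, Function.update_of_ne (hA S), h2 A hA]
  · by_cases hTS : T = S
    · exact Or.inr (hTS ▸ new)
    · rw [old T hTS]
      exact h3 T
  · by_cases hTS : T = S
    · exact hTS ▸ new
    · rw [old T hTS]
      exact hT

theorem assign₂_writesA {t A : ℕ} {e : Finset (Fin k) → Finset (Fin k) → Expr .rat} :
    ¬ (assign₂ t e).WritesA A := fun h => by
  obtain ⟨S, h⟩ := Stmt.seqSub_writesA h
  obtain ⟨T, h⟩ := Stmt.seqSub_writesA h
  exact h

theorem assign₂_writesQ {t A : ℕ} {e : Finset (Fin k) → Finset (Fin k) → Expr .rat}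
    (h : (assign₂ t e).WritesQ A) : ∃ S T : Finset (Fin k), A = qName t S T := by
  obtain ⟨S, h⟩ := Stmt.seqSub_writesQ h
  obtain ⟨T, h⟩ := Stmt.seqSub_writesQ h
  exact ⟨S, T, h⟩

theorem den_assign₂ {t : ℕ} {e : Finset (Fin k) → Finset (Fin k) → Expr .rat}
    {val : Finset (Fin k) → Finset (Fin k) → ℚ}
    (h : ∀ S T s', s'.reg = s.reg → s'.arr = s.arr →
      (∀ A, (∀ S T : Finset (Fin k), A ≠ qName t S T) → s'.qarr A = s.qarr A) →
      (e S T).eval n s' = val S T) :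
    ∀ S T, ((assign₂ t e).den n s).qarr (qName t S T) 0 = val S T := by
  refine (Stmt.den_seqSub (fun a q => a = s.arr ∧
      ∀ A, (∀ S T : Finset (Fin k), A ≠ qName t S T) → q A = s.qarr A)
    (fun S _ q => ∀ T, q (qName t S T) 0 = val S T) ?_ ⟨rfl, fun _ _ => rfl⟩).2
  rintro S s' hr ⟨h1, h2⟩
  have key := den_seqSub_setQ (n := n) (s := s') (nm := fun T => qName t S T) (i := .const 0)
    (e := e S) (idx := 0) (val := val S) (fun T T' h => by simpa using h)
    fun T s'' hr' ha' hq' => ⟨rfl, h S T s'' (hr'.trans hr) (ha'.trans h1) fun A hA => by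
      rw [hq' A fun T => hA S T, h2 A hA]⟩
  have fr : ∀ A, (∀ T, A ≠ qName t S T) → ((Stmt.seqSub (List.finRange k) fun T =>
      .setQ (qName t S T) (.const 0) (e S T)).den n s').qarr A = s'.qarr A := fun A hA =>
    Stmt.den_qarr fun hw => by
      obtain ⟨T, hT⟩ := Stmt.seqSub_writesQ hw
      exact hA T hT
  have new : ∀ T, ((Stmt.seqSub (List.finRange k) fun T =>
      .setQ (qName t S T) (.const 0) (e S T)).den n s').qarr (qName t S T) 0 = val S T := fun T => by
    rw [key T, Function.update_self]
  refine ⟨⟨?_, fun A hA => ?_⟩, new, fun S' hS' T => ?_⟩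
  · rw [← h1]
    funext A
    exact Stmt.den_arr fun hw => by
      obtain ⟨T, hT⟩ := Stmt.seqSub_writesA hw
      exact hT
  · rw [fr A fun T => hA S T, h2 A hA]
  · by_cases hSS : S' = S
    · exact hSS ▸ new T
    · rw [fr _ fun T' h => hSS (qName_inj.1 h).2.1]
      exact hS' T

/-! ### The program: paths and cycles -/

/-- The table of optimum values. -/
noncomputable def tab (q : ℕ → ℕ → ℚ) (S : Finset (Fin k)) (v : ℕ) : ℚ := q (qName 0 S ∅) v

theorem sat_nextE {a : ℕ → ℕ → ℕ} (h : Env n k Γ a) (hs : s.arr = a) : nextE.Sat n s ↔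
    (s.reg 6 ∈ members n (a 5) ∧ s.reg 6 ∉ members n (a 8)) ∧
      (Γ.Adj (s.reg 6) (a 9 0) ∨ Γ.Adj (s.reg 6) (a 10 0)) := by
  subst hs
  simp only [nextE, Expr.sat_and, Expr.sat_not, Expr.sat_mem, Expr.sat_or, sat_adjE, h.adjIn,
    Expr.eval_reg, eval_sc]

theorem sat_candE (h : Env n k Γ s.arr) {A S T R S₁ T₁ : Finset (Fin k)} :
    (candE H A S T R S₁ T₁).Sat n s ↔
      IsCand Γ H A (s.arr 11 0) (s.arr 9 0) (s.arr 10 0) S T R S₁ T₁ := by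
  simp only [candE, Expr.sat_and, Expr.sat_not, Expr.sat_or, Expr.sat_imp, Expr.sat_ofProp,
    sat_adjE, h.adjIn, eval_sc]
  exact ⟨fun ⟨h1, h2, h3, h4⟩ => ⟨h1, h2, h3, h4⟩, fun ⟨h1, h2, h3, h4⟩ => ⟨h1, h2, h3, h4⟩⟩

-- Noncandidates contribute the default `0`. This is harmless: empty sets are always a candidate,
-- with a nonnegative value, so the maximum is attained by a genuine candidate.
open Classical in
theorem isGreatest_pathUpdateE (h : Env n k Γ s.arr) {A S T : Finset (Fin k)}
    (h1 : tab s.qarr (∅ : Finset (Fin k)) (s.arr 11 0) = 0)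
    (h2 : 0 ≤ s.qarr (qName 2 (∅ : Finset (Fin k)) ∅) 0) :
    IsGreatest {r | ∃ R S₁ T₁, IsCand Γ H A (s.arr 11 0) (s.arr 9 0) (s.arr 10 0) S T R S₁ T₁ ∧
      r = tab s.qarr R (s.arr 11 0) + s.qarr (qName 2 S₁ T₁) 0}
      ((pathUpdateE H A S T).eval n s) := by
  let g : Finset (Fin k) → Finset (Fin k) → Finset (Fin k) → Expr .rat := fun R S₁ T₁ =>
    .qite (candE H A S T R S₁ T₁)
      (.qadd (.qarr (qName 0 R ∅) (sc 11)) (.qarr (qName 2 S₁ T₁) (.const 0))) .qzero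
  have hg : ∀ R S₁ T₁, (g R S₁ T₁).eval n s =
      if IsCand Γ H A (s.arr 11 0) (s.arr 9 0) (s.arr 10 0) S T R S₁ T₁ then
        tab s.qarr R (s.arr 11 0) + s.qarr (qName 2 S₁ T₁) 0 else 0 := by
    intro R S₁ T₁
    simp only [g]
    rw [Expr.eval_qite]
    exact if_congr (sat_candE h) rfl rfl
  have hle : ∀ R S₁ T₁, (g R S₁ T₁).eval n s ≤ ((pathUpdateE H A S T).eval n s : ℚ) := by
    intro R S₁ T₁
    refine le_trans ?_ (Expr.eval_maxSub.2 ⟨R, fun c _ => List.mem_finRange c, rfl⟩)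
    refine le_trans ?_ (Expr.eval_maxSub.2 ⟨S₁, fun c _ => List.mem_finRange c, rfl⟩)
    exact Expr.eval_maxSub.2 ⟨T₁, fun c _ => List.mem_finRange c, rfl⟩
  have hcand : IsCand Γ H A (s.arr 11 0) (s.arr 9 0) (s.arr 10 0) S T ∅ ∅ ∅ := by
    refine ⟨Finset.empty_subset _, fun _ => comp_empty_left _, fun _ => comp_empty_left _, ?_⟩
    by_cases e : Γ.Adj (s.arr 11 0) (s.arr 9 0)
    · exact Or.inl ⟨e, Finset.empty_subset _⟩
    · exact Or.inr ⟨e, Finset.empty_subset _⟩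
  refine ⟨?_, ?_⟩
  · obtain ⟨R, -, hR⟩ := (Expr.eval_maxSub (n := n) (s := s) (l := List.finRange k)
      (f := fun R => .maxSub (List.finRange k) fun S₁ => .maxSub (List.finRange k) (g R S₁))).1
    obtain ⟨S₁, -, hS⟩ := (Expr.eval_maxSub (n := n) (s := s) (l := List.finRange k)
      (f := fun S₁ => .maxSub (List.finRange k) (g R S₁))).1
    obtain ⟨T₁, -, hT⟩ := (Expr.eval_maxSub (n := n) (s := s) (l := List.finRange k)
      (f := g R S₁)).1
    have he : (pathUpdateE H A S T).eval n s = ((g R S₁ T₁).eval n s : ℚ) :=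
      hR.trans (hS.trans hT)
    have h3 := hle ∅ ∅ ∅
    rw [he] at h3 ⊢
    rw [hg] at h3 ⊢
    rw [hg, if_pos hcand, h1, zero_add] at h3
    split_ifs at h3 ⊢ with hc
    · exact ⟨R, S₁, T₁, hc, rfl⟩
    · exact ⟨∅, ∅, ∅, hcand, by rw [h1, zero_add]; exact le_antisymm h2 h3⟩
  · rintro _ ⟨R, S₁, T₁, hc, rfl⟩
    have := hle R S₁ T₁
    rwa [hg, if_pos hc] at this

/-- What holds while the segment grows. -/
structure PathInv (n : ℕ) (Γ : SimpleGraph ℕ) (H : SimpleGraph (Fin k))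
    (f : Finset (Fin k) → ℕ → ℚ) (A : Finset (Fin k)) (B : Finset ℕ) (j : ℕ) (a : ℕ → ℕ → ℕ)
    (q : ℕ → ℕ → ℚ) : Prop where
  table : IsSegTable Γ H f A (members n (a 8)) (a 9 0) (a 10 0) fun S T => q (qName 2 S T) 0
  segment : IsSegment Γ B (members n (a 8)) (a 9 0) (a 10 0)
  large : members n (a 8) = B ∨ j + 1 ≤ (members n (a 8)).card

theorem _root_.HColoring.IsSegTable.nonneg {f : Finset (Fin k) → ℕ → ℚ} {A : Finset (Fin k)} {Z : Finset ℕ}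
    {u v : ℕ} {V : Finset (Fin k) → Finset (Fin k) → ℚ} (h : IsSegTable Γ H f A Z u v V)
    (hf : ∀ x ∈ Z, f ∅ x = 0) (S T : Finset (Fin k)) : 0 ≤ V S T :=
  (h.greatest S T).2 ⟨fun _ => ∅, IsAssign.empty Z A, Finset.empty_subset _, Finset.empty_subset _,
    (Finset.sum_eq_zero hf).symm⟩

theorem den_pathInit {A : Finset (Fin k)} {B : Finset ℕ} (hB : B = members n (s.arr 5))
    (hf : IsTable (tab (k := k) s.qarr) B) (hrep : s.arr 12 0 ∈ B) :
    PathInv n Γ H (tab s.qarr) A B 0 ((pathInit A).den n s).arr ((pathInit A).den n s).qarr := by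
  have hmem : members n (((pathInit A).den n s).arr 8) = {s.arr 12 0} := by
    rw [pathInit, den_seq, den_seq, den_seq, Stmt.den_arr assign₂_writesA]
    ext v
    rw [Stmt.den_fill (fun v => v = s.arr 12 0)]
    · rw [Finset.mem_singleton]
      refine and_iff_right_of_imp ?_
      rintro rfl
      exact (mem_members.1 (hB ▸ hrep)).1
    · intro j hj s' hr ha hq
      simp [hr, ha 12 (by decide), Stmt.den_reg]
  have h9 : ((pathInit A).den n s).arr 9 0 = s.arr 12 0 := by
    rw [pathInit, den_seq, den_seq, den_seq, Stmt.den_arr assign₂_writesA,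
      Stmt.den_arr (by simp)]
    simp
  have h10 : ((pathInit A).den n s).arr 10 0 = s.arr 12 0 := by
    rw [pathInit, den_seq, den_seq, den_seq, Stmt.den_arr assign₂_writesA,
      Stmt.den_arr (by simp)]
    simp
  have hq : ∀ S T : Finset (Fin k), ((pathInit A).den n s).qarr (qName 2 S T) 0 =
      tab s.qarr (S ∩ T ∩ A) (s.arr 12 0) := by
    rw [pathInit, den_seq, den_seq, den_seq]
    refine den_assign₂ fun S T s' hr ha hq => ?_
    simp only [Expr.eval_qarr, eval_sc, ha, tab]
    rw [hq _ fun S T h => by simp at h, Stmt.den_qarr (by simp), Stmt.den_arr (by simp)]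
    simp
  refine ⟨?_, ?_, ?_⟩
  · rw [hmem, h9, h10]
    simp only [hq]
    exact isSegTable_singleton ⟨fun v hv => hf.empty v (by
      rw [Finset.mem_singleton.1 hv]; exact hrep), fun v hv => hf.mono v (by
      rw [Finset.mem_singleton.1 hv]; exact hrep)⟩ A
  · rw [hmem, h9, h10]
    exact isSegment_singleton hrep
  · right
    rw [hmem, Finset.card_singleton]

open Classical in
theorem den_pathExtend (h : Env n k Γ s.arr) {A : Finset (Fin k)} {B : Finset ℕ}
    {f : Finset (Fin k) → ℕ → ℚ} {j : ℕ} (hB : B = members n (s.arr 5))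
    (hf : IsTable f B) (hfs : ∀ S v, tab s.qarr S v = f S v)
    (hdeg : ∀ c ∈ B, ∀ p ∈ B, ∀ q ∈ B, ∀ r ∈ B, Γ.Adj c p → Γ.Adj c q → Γ.Adj c r → p ≠ q →
      p ≠ r → q = r)
    (hI : PathInv n Γ H f A B j s.arr s.qarr) (hb : (Expr.ex 6 nextE).Sat n s) :
    PathInv n Γ H f A B (j + 1) ((pathExtend H A).den n s).arr ((pathExtend H A).den n s).qarr := by
  obtain ⟨hT, hS, hL⟩ := hI
  obtain ⟨i, hi, hb⟩ := Expr.sat_ex.1 hb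
  have hx := Expr.sat_find hi hb
  set x := (Expr.find 6 nextE).eval n s with hxdef
  rw [sat_nextE h (s.set_arr 6 x)] at hx
  simp only [Store.set_reg, Function.update_self, ← hB] at hx
  obtain ⟨⟨hxB, hxZ⟩, hxadj⟩ := hx
  have hxn : x < n := by
    rw [hB] at hxB
    exact (mem_members.1 hxB).1
  rw [pathExtend, den_seq, den_seq, den_seq, den_seq, den_seq]
  set s₁ := (Stmt.setA 11 (.const 0) (.find 6 nextE)).den n s with hs₁
  have a₁ : ∀ A ≠ 11, s₁.arr A = s.arr A := fun A hA => Stmt.den_arr (by simpa [Stmt.WritesA] using hA)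
  have x₁ : s₁.arr 11 0 = x := by simp [hs₁, hxdef]
  have h₁ : Env n k Γ s₁.arr := h.congr fun A hA _ => a₁ A (by omega)
  have q₁ : s₁.qarr = s.qarr := rfl
  have hV := fun S T => isGreatest_pathUpdateE (H := H) h₁ (A := A) (S := S) (T := T)
    (by rw [q₁, hfs, x₁]; exact hf.empty x hxB)
    (hT.nonneg (fun y hy => hf.empty y (hS.subset hy)) ∅ ∅)
  set s₂ := (assign₂ 3 (pathUpdateE H A)).den n s₁ with hs₂
  have a₂ : ∀ A, s₂.arr A = s₁.arr A := fun A => Stmt.den_arr assign₂_writesA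
  have q₂ : ∀ S T : Finset (Fin k), s₂.qarr (qName 3 S T) 0 = (pathUpdateE H A S T).eval n s₁ := by
    refine den_assign₂ fun S T s' hr ha hq => ?_
    have e1 : ∀ R : Finset (Fin k), s'.qarr (qName 0 R ∅) = s₁.qarr (qName 0 R ∅) := fun R =>
      hq _ fun S T h => by simp at h
    have e2 : ∀ S T : Finset (Fin k), s'.qarr (qName 2 S T) = s₁.qarr (qName 2 S T) := fun S T =>
      hq _ fun S T h => by simp at h
    have h' : Env n k Γ s'.arr := ha ▸ h₁
    refine (IsGreatest.unique ?_ (hV S T))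
    have := isGreatest_pathUpdateE (H := H) h' (A := A) (S := S) (T := T) ?_ ?_
    · simpa only [tab, e1, e2, ha] using this
    · rw [tab, e1, ha, x₁]
      exact (hfs ∅ x).trans (hf.empty x hxB)
    · rw [e2]
      exact hT.nonneg (fun y hy => hf.empty y (hS.subset hy)) ∅ ∅
  set s₃ := (assign₂ 2 fun S T : Finset (Fin k) => .qarr (qName 3 S T) (.const 0)).den n s₂ with hs₃
  have a₃ : ∀ A, s₃.arr A = s₂.arr A := fun A => Stmt.den_arr assign₂_writesA
  have q₃ : ∀ S T : Finset (Fin k), s₃.qarr (qName 2 S T) 0 = (pathUpdateE H A S T).eval n s₁ := by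
    refine den_assign₂ fun S T s' hr ha hq => ?_
    rw [← q₂, Expr.eval_qarr, hq _ fun S T h => by simp at h]
    rfl
  have e₃ : s₃.arr = s₁.arr := funext fun A => (a₃ A).trans (a₂ A)
  have h₃ : Env n k Γ s₃.arr := e₃ ▸ h₁
  set s₄ := (Stmt.ite (adjE (sc 11) (sc 9)) .skip (.setA 10 (.const 0) (sc 9))).den n s₃ with hs₄
  have a₄ : ∀ A ≠ 10, s₄.arr A = s₁.arr A := fun A hA => by
    rw [← e₃]
    exact Stmt.den_arr (by simpa [Stmt.WritesA] using hA)
  have q₄ : s₄.qarr = s₃.qarr := by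
    funext A
    exact Stmt.den_qarr (by simp [Stmt.WritesQ])
  have v₄ : s₄.arr 10 0 = if Γ.Adj x (s.arr 9 0) then s.arr 10 0 else s.arr 9 0 := by
    have e9 : s₁.arr 9 0 = s.arr 9 0 := by rw [a₁ 9 (by decide)]
    have e10 : s₁.arr 10 0 = s.arr 10 0 := by rw [a₁ 10 (by decide)]
    have hc : (adjE (sc 11) (sc 9)).Sat n s₃ ↔ Γ.Adj x (s.arr 9 0) := by
      rw [sat_adjE, h₃.adjIn, eval_sc, eval_sc, e₃, x₁, e9]
    rw [hs₄, Stmt.den_ite]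
    by_cases hadj : Γ.Adj x (s.arr 9 0)
    · rw [if_pos (hc.2 hadj), if_pos hadj, ← e10, ← e₃]
      rfl
    · rw [if_neg (mt hc.1 hadj), if_neg hadj, den_setA_arr, eval_sc, e₃, e9]
      simp
  set s₅ := (Stmt.setA 9 (.const 0) (sc 11)).den n s₄ with hs₅
  have r9 : ((Stmt.setA 8 (sc 11) (.const 1)).den n s₅).arr 9 0 = x := by
    simp [hs₅, a₄, x₁]
  have r10 : ((Stmt.setA 8 (sc 11) (.const 1)).den n s₅).arr 10 0 =
      if Γ.Adj x (s.arr 9 0) then s.arr 10 0 else s.arr 9 0 := by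
    rw [← v₄]
    simp [hs₅]
  have r8 : members n (((Stmt.setA 8 (sc 11) (.const 1)).den n s₅).arr 8) =
      insert x (members n (s.arr 8)) := by
    ext v
    have e8 : s₅.arr 8 = s.arr 8 := by simp [hs₅, a₄, a₁]
    have e11 : s₅.arr 11 0 = x := by simp [hs₅, a₄, x₁]
    rw [Finset.mem_insert, mem_members, mem_members, den_setA_arr, Function.update_self, eval_sc,
      e8, e11, Expr.eval_const]
    by_cases hv : v = x
    · subst hv
      simp [hxn]
    · simp [hv]
  have rq : ∀ S T : Finset (Fin k), ((Stmt.setA 8 (sc 11) (.const 1)).den n s₅).qarr (qName 2 S T) 0 =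
      (pathUpdateE H A S T).eval n s₁ := fun S T => by
    rw [den_setA_qarr, hs₅, den_setA_qarr, q₄, q₃]
  refine ⟨?_, ?_, ?_⟩
  · rw [r8, r9, r10]
    simp only [rq]
    refine hT.extend hxZ (hS.adj_ends hxB hxZ) fun S T => ?_
    have := hV S T
    rw [x₁, a₁ 9 (by decide), a₁ 10 (by decide), q₁] at this
    simpa only [hfs] using this
  · rw [r8, r9, r10]
    exact hS.extend hdeg hT.left hT.right hxB hxZ hxadj
  · right
    rw [r8, Finset.card_insert_of_notMem hxZ]
    rcases hL with hL | hL
    · exact absurd (hL ▸ hxB) hxZ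
    · omega

theorem pathExtend_writesA {A : Finset (Fin k)} {A' : ℕ} (h : (pathExtend H A).WritesA A') :
    8 ≤ A' ∧ A' ≤ 11 := by
  simp only [pathExtend, Stmt.WritesA, assign₂_writesA, false_or] at h
  omega

theorem pathExtend_writesQ {A : Finset (Fin k)} {A' : ℕ} (h : (pathExtend H A).WritesQ A') :
    ∃ S T : Finset (Fin k), A' = qName 2 S T ∨ A' = qName 3 S T := by
  simp only [pathExtend, Stmt.WritesQ, false_or, or_false] at h
  rcases h with h | h
  · obtain ⟨S, T, h⟩ := assign₂_writesQ h
    exact ⟨S, T, Or.inr h⟩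
  · obtain ⟨S, T, h⟩ := assign₂_writesQ h
    exact ⟨S, T, Or.inl h⟩

theorem path_writesA {A : Finset (Fin k)} {A' : ℕ} (h : (path H A).WritesA A') :
    8 ≤ A' ∧ A' ≤ 11 := by
  simp only [path, pathInit, Stmt.WritesA, Stmt.fill_writesA, assign₂_writesA, or_false] at h
  rcases h with h | h
  · omega
  · exact pathExtend_writesA h

theorem path_writesQ {A : Finset (Fin k)} {A' : ℕ} (h : (path H A).WritesQ A') :
    (∃ S T : Finset (Fin k), A' = qName 2 S T ∨ A' = qName 3 S T) ∨ A' = qName 1 A ∅ := by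
  simp only [path, pathInit, Stmt.WritesQ, Stmt.fill_writesQ, or_false, false_or] at h
  rcases h with h | h | h
  · obtain ⟨S, T, h⟩ := assign₂_writesQ h
    exact Or.inl ⟨S, T, Or.inl h⟩
  · exact Or.inl (pathExtend_writesQ h)
  · exact Or.inr h

/-- Every round adds a vertex unless the segment is already `B`, and connectedness shows that a
segment without extension is `B`. The `n + 1` rounds exceed what a set of at most `n` vertices can
absorb. -/
theorem den_path (h : Env n k Γ s.arr) {Act B : Finset ℕ} (hB : B = members n (s.arr 5))
    (hf : IsTable (tab (k := k) s.qarr) B) (hrep : s.arr 12 0 ∈ B) (hmin : IsMinMod Γ Act B)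
    (hdeg : ∀ c ∈ B, ∀ p ∈ B, ∀ q ∈ B, ∀ r ∈ B, Γ.Adj c p → Γ.Adj c q → Γ.Adj c r → p ≠ q →
      p ≠ r → q = r)
    {a b c : ℕ} (ha : a ∈ B) (hb : b ∈ B) (hc : c ∈ B) (hab : a ≠ b) (hac : a ≠ c) (hbc : b ≠ c)
    (A : Finset (Fin k)) :
    IsBest Γ H (tab s.qarr) B A (((path H A).den n s).qarr (qName 1 A ∅) 0) := by
  rw [path, den_seq, den_seq, den_setQ_qarr]
  simp only [Expr.eval_const, Function.update_self, Expr.eval_qarr]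
  have hinit := den_pathInit (Γ := Γ) (H := H) (A := A) hB hf hrep
  have key := Stmt.den_forN (n := n) (i := 4) (p := .ite (.ex 6 nextE) (pathExtend H A) .skip)
    (s := (pathInit A).den n s) (fun j a q => (∀ A' < 8, a A' = s.arr A') ∧
      (∀ S : Finset (Fin k), q (qName 0 S ∅) = s.qarr (qName 0 S ∅)) ∧
      PathInv n Γ H (tab s.qarr) A B j a q) ⟨?_, ?_, hinit⟩ ?_
  · obtain ⟨-, -, hT, hS, hL⟩ := key
    have : members n (((Stmt.forN 4 (.ite (.ex 6 nextE) (pathExtend H A) .skip)).den n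
        ((pathInit A).den n s)).arr 8) = B := by
      refine hL.resolve_right fun hL => ?_
      have := card_members n (((Stmt.forN 4 (.ite (.ex 6 nextE) (pathExtend H A) .skip)).den n
        ((pathInit A).den n s)).arr 8)
      omega
    rw [this] at hT
    exact hT.isBest
  · intro A' hA
    refine Stmt.den_arr ?_
    simp only [pathInit, Stmt.WritesA, Stmt.fill_writesA, assign₂_writesA, or_false]
    omega
  · intro S
    refine Stmt.den_qarr ?_
    simp only [pathInit, Stmt.WritesQ, Stmt.fill_writesQ, false_or]
    intro hw
    obtain ⟨S', T', h⟩ := assign₂_writesQ hw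
    simp at h
  · rintro j hj s' - ⟨h1, h2, h3⟩
    have h' : Env n k Γ s'.arr := h.congr fun A' hA _ => h1 A' (by omega)
    have hB' : B = members n (s'.arr 5) := by rw [hB, h1 5 (by omega)]
    rw [Stmt.den_ite]
    split_ifs with hsat
    · refine ⟨fun A' hA => ?_, fun S => ?_, den_pathExtend h' hB' hf (fun S v => ?_) hdeg h3 hsat⟩
      · rw [Stmt.den_arr, h1 A' hA]
        intro hw
        have := pathExtend_writesA hw
        omega
      · rw [Stmt.den_qarr, h2]
        intro hw
        obtain ⟨S', T', h | h⟩ := pathExtend_writesQ hw <;> simp at h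
      · rw [tab, h2, tab]
    · refine ⟨h1, h2, h3.table, h3.segment, Or.inl ?_⟩
      refine h3.segment.eq_of_maximal hmin ha hb hc hab hac hbc h3.table.left fun x hx hxZ => ?_
      by_contra hcon
      refine hsat (Expr.sat_ex.2 ⟨x, ?_, ?_⟩)
      · rw [hB] at hx
        exact (mem_members.1 hx).1.le
      · rw [sat_nextE h' (s'.set_arr 6 x)]
        simp only [Store.set_reg, Function.update_self]
        refine ⟨⟨hB' ▸ hx, hxZ⟩, ?_⟩
        show Γ.Adj x (s'.arr 9 0) ∨ Γ.Adj x (s'.arr 10 0)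
        tauto

end

end Prog

section

variable {k : ℕ} {Γ : SimpleGraph ℕ} {H : SimpleGraph (Fin k)}

theorem IsBlocks.congr {f₀ f f' : Finset (Fin k) → ℕ → ℚ} {N Act : Finset ℕ}
    (h : IsBlocks Γ H f₀ N Act f) (hf : ∀ v ∈ Act, ∀ S, f' S v = f S v) :
    IsBlocks Γ H f₀ N Act f' := by
  obtain ⟨blk, h1, h2, h3, h4⟩ := h
  exact ⟨blk, h1, h2, h3, fun v hv S => hf v hv S ▸ h4 v hv S⟩

/-- Written as a sum, the answer covers a single remaining block and the empty graph alike. -/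
theorem IsBlocks.isBest {f₀ f : Finset (Fin k) → ℕ → ℚ} {N Act : Finset ℕ}
    (h : IsBlocks Γ H f₀ N Act f) (hc : Act.card ≤ 1) (S : Finset (Fin k)) :
    IsBest Γ H f₀ N S (∑ v ∈ Act, f S v) := by
  obtain ⟨blk, rfl, -, -, hbest⟩ := h
  rcases Finset.card_le_one_iff_subset_singleton.1 hc with ⟨v, hv⟩
  rcases Finset.subset_singleton_iff.1 hv with rfl | rfl
  · simp only [Finset.biUnion_empty, Finset.sum_empty]
    refine ⟨⟨fun _ => ∅, IsAssign.empty _ _, by simp⟩, ?_⟩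
    rintro _ ⟨s, -, rfl⟩
    simp
  · simpa using hbest v (Finset.mem_singleton_self v) S

end

namespace Prog

section

variable {n k : ℕ} {Γ : SimpleGraph ℕ} {H : SimpleGraph (Fin k)} {s : Store}

/-! ### The program: modules without co-diamonds -/

@[simp] theorem eval_wit₁ {c : Fin k} : (wit₁ c).eval n s = s.reg (2 * c + 10) := rfl

@[simp] theorem eval_wit₂ {c : Fin k} : (wit₂ c).eval n s = s.reg (2 * c + 11) := rfl

theorem sat_consistentE (h : Env n k Γ s.arr) : (consistentE k).Sat n s ↔
    Consistent (k := k) Γ (members n (s.arr 5)) (fun c => s.reg (2 * c + 10))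
      fun c => s.reg (2 * c + 11) := by
  simp only [consistentE, Expr.sat_allCol, List.mem_finRange, forall_true_left, Expr.sat_imp,
    Expr.sat_and, Expr.sat_mem, Expr.sat_not, Expr.sat_eq, sat_adjE, h.adjIn, eval_wit₁, eval_wit₂,
    and_imp, Consistent, ne_eq]

theorem sat_allowedE (h : Env n k Γ s.arr) {c : Fin k} : (allowedE H c).Sat n s ↔
    Allowed Γ H (members n (s.arr 5)) (fun c => s.reg (2 * c + 10)) (fun c => s.reg (2 * c + 11))
      (s.reg 6) c := by
  simp only [allowedE, Expr.sat_allCol, List.mem_finRange, forall_true_left, Expr.sat_imp,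
    Expr.sat_and, Expr.sat_or, Expr.sat_ofProp, Expr.sat_mem, Expr.sat_not, Expr.sat_eq, sat_adjE,
    h.adjIn, eval_wit₁, eval_wit₂, Expr.eval_reg, Allowed, or_iff_not_imp_left (a := H.Adj _ _)]

/-- Array names are literals, so the table cannot be addressed by a computed color set. The maximum
over all subsets of the allowed set gives the same value because the table is monotone. -/
theorem eval_vertexE (h : Env n k Γ s.arr) {B : Finset ℕ} (hB : B = members n (s.arr 5))
    (hf : IsTable (tab (k := k) s.qarr) B) (hv : s.reg 6 ∈ B) (A : Finset (Fin k)) :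
    (vertexE H A).eval n s = tab s.qarr (allowedSet Γ H B (fun c => s.reg (2 * c + 10))
      (fun c => s.reg (2 * c + 11)) A (s.reg 6)) (s.reg 6) := by
  set M := allowedSet Γ H B (fun c => s.reg (2 * c + 10)) (fun c => s.reg (2 * c + 11)) A (s.reg 6)
    with hM
  have hsat : ∀ S : Finset (Fin k), (Expr.and (.ofProp (S ⊆ A))
      (.allCol (List.finRange k) fun c => .or (.ofProp (c ∉ S)) (allowedE H c))).Sat n s ↔
      S ⊆ M := by
    intro S
    simp only [Expr.sat_and, Expr.sat_ofProp, Expr.sat_allCol, List.mem_finRange, forall_true_left,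
      Expr.sat_or, sat_allowedE h, ← hB]
    rw [hM]
    constructor
    · rintro ⟨h1, h2⟩ c hc
      exact mem_allowedSet.2 ⟨h1 hc, (h2 c).resolve_left (not_not.2 hc)⟩
    · intro h1
      refine ⟨fun c hc => (mem_allowedSet.1 (h1 hc)).1, fun c => ?_⟩
      by_cases hc : c ∈ S
      · exact Or.inr (mem_allowedSet.1 (h1 hc)).2
      · exact Or.inl hc
  refine IsGreatest.unique Expr.eval_maxSub ⟨⟨M, fun c _ => List.mem_finRange c, ?_⟩, ?_⟩
  · rw [Expr.eval_qite, if_pos ((hsat M).2 le_rfl)]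
    rfl
  · rintro _ ⟨S, -, rfl⟩
    rw [Expr.eval_qite]
    split_ifs with hS
    · exact hf.mono _ hv _ _ ((hsat S).1 hS)
    · exact hf.nonneg hv _

theorem isBest_witnessE (h : Env n k Γ s.arr) {B : Finset ℕ} (hB : B = members n (s.arr 5))
    (hf : IsTable (tab (k := k) s.qarr) B)
    (hco : ∀ u ∈ B, ∀ v ∈ B, ∀ w ∈ B, ∀ x ∈ B, ¬ IsCoDiamond Γ u v w x) (A : Finset (Fin k)) :
    IsBest Γ H (tab s.qarr) B A ((witnessE H A).eval n s) := by
  set l := (List.range (2 * k)).map (· + 10) with hl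
  have hBn : ∀ v ∈ B, v < n := fun v hv => (mem_members.1 (hB ▸ hv)).1
  have key : ∀ s', Expr.Varies n l s s' → ((Expr.qite (consistentE k)
      (.qsum 6 (.qite (.mem 5 (.reg 6)) (vertexE H A) .qzero)) .qzero).eval n s' : ℚ) =
      if (consistentE k).Sat n s' then ∑ v ∈ B, tab s.qarr (allowedSet Γ H B
        (fun c => s'.reg (2 * c + 10)) (fun c => s'.reg (2 * c + 11)) A v) v else 0 := by
    intro s' hs'
    rw [Expr.eval_qite, Expr.eval_qzero]
    refine if_congr Iff.rfl ?_ rfl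
    rw [Expr.eval_qsum]
    have : B = Finset.range (n + 1) ∩ B := by
      rw [Finset.inter_eq_right.2 fun v hv => Finset.mem_range.2 ((hBn v hv).trans (Nat.lt_succ_self n))]
    rw [this, ← Finset.sum_ite_mem, ← this]
    refine Finset.sum_congr rfl fun v _ => ?_
    rw [Expr.eval_qite, Expr.eval_qzero]
    have hmem : (Expr.mem 5 (.reg 6)).Sat n (s'.set 6 v) ↔ v ∈ B := by
      rw [Expr.sat_mem, Store.set_arr, hs'.arr, ← hB]
      simp
    by_cases hv : v ∈ B
    · rw [if_pos (hmem.2 hv), if_pos hv, eval_vertexE (Γ := Γ) (B := B)]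
      · have e : ∀ i : ℕ, i ≠ 6 → (s'.set 6 v).reg i = s'.reg i := fun i hi => by simp [hi]
        have e1 : ∀ c : Fin k, (s'.set 6 v).reg (2 * c + 10) = s'.reg (2 * c + 10) := fun c =>
          e _ (by omega)
        have e2 : ∀ c : Fin k, (s'.set 6 v).reg (2 * c + 11) = s'.reg (2 * c + 11) := fun c =>
          e _ (by omega)
        simp only [e1, e2, Store.set_qarr, hs'.qarr]
        simp
      · rw [Store.set_arr, hs'.arr]
        exact h
      · rw [Store.set_arr, hs'.arr, hB]
      · rw [Store.set_qarr, hs'.qarr]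
        exact hf
      · simpa using hv
    · rw [if_neg (mt hmem.1 hv), if_neg hv]
  have hcons : ∀ s', Expr.Varies n l s s' → ((consistentE k).Sat n s' ↔ Consistent (k := k) Γ B
      (fun c => s'.reg (2 * c + 10)) fun c => s'.reg (2 * c + 11)) := by
    intro s' hs'
    rw [hB, ← hs'.arr]
    exact sat_consistentE (hs'.arr ▸ h)
  refine isBest_of_witnesses hf hco hBn (fun p q hp hq hpq => ?_) ?_
  -- The store in which the nested suprema meet the given witnesses: first witnesses in even
  -- registers, second ones in odd registers.
  · let s' : Store := { s with reg := fun r => if hr : 10 ≤ r ∧ r < 2 * k + 10 then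
      (if r % 2 = 0 then p ⟨(r - 10) / 2, by omega⟩ else q ⟨(r - 10) / 2, by omega⟩) else s.reg r }
    have hs' : Expr.Varies n l s s' := by
      refine ⟨rfl, rfl, fun r hr => dif_neg fun hr' => hr ?_, fun r hr => ?_⟩
      · rw [hl, List.mem_map]
        exact ⟨r - 10, by rw [List.mem_range]; omega, by omega⟩
      · simp only [hl, List.mem_map, List.mem_range] at hr
        obtain ⟨i, hi, rfl⟩ := hr
        simp only [s']
        rw [dif_pos (by omega)]
        split_ifs
        · exact hp _
        · exact hq _
    have e1 : ∀ c : Fin k, s'.reg (2 * c + 10) = p c := fun c => by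
      simp only [s']
      rw [dif_pos (by omega), if_pos (by omega)]
      congr 1
      ext
      simp only
      omega
    have e2 : ∀ c : Fin k, s'.reg (2 * c + 11) = q c := fun c => by
      simp only [s']
      rw [dif_pos (by omega), if_neg (by omega)]
      congr 1
      ext
      simp only
      omega
    refine le_trans (le_of_eq ?_) (Expr.eval_le_supNest hs')
    rw [key s' hs', if_pos ((hcons s' hs').2 (by simpa only [e1, e2] using hpq))]
    simp only [e1, e2]
  · have hnd : l.Nodup := List.nodup_range.map (add_left_injective 10)
    rcases Expr.supNest_eq (n := n) hnd (x := .qite (consistentE k)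
      (.qsum 6 (.qite (.mem 5 (.reg 6)) (vertexE H A) .qzero)) .qzero) (s := s) with h0 | ⟨s', hs', h0⟩
    · exact Or.inl h0
    · rw [key s' hs'] at h0
      split_ifs at h0 with hc
      · exact Or.inr ⟨_, _, (hcons s' hs').1 hc, h0⟩
      · exact Or.inl h0

/-! ### The program: contracting a module -/

theorem moduleValues_writesA {A : ℕ} (h : (moduleValues H).WritesA A) : 8 ≤ A ∧ A ≤ 11 := by
  rcases h with h | h
  · obtain ⟨S, h⟩ := Stmt.seqSub_writesA h
    exact path_writesA h
  · obtain ⟨S, h⟩ := Stmt.seqSub_writesA h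
    exact h.elim

theorem moduleValues_writesQ {A : ℕ} (h : (moduleValues H).WritesQ A) :
    ∃ t, 1 ≤ t ∧ t ≤ 3 ∧ ∃ S T : Finset (Fin k), A = qName t S T := by
  rcases h with h | h
  · obtain ⟨S, h⟩ := Stmt.seqSub_writesQ h
    rcases path_writesQ h with ⟨S, T, rfl | rfl⟩ | rfl
    · exact ⟨2, by omega, by omega, S, T, rfl⟩
    · exact ⟨3, by omega, by omega, S, T, rfl⟩
    · exact ⟨1, by omega, by omega, _, _, rfl⟩
  · obtain ⟨S, h⟩ := Stmt.seqSub_writesQ h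
    exact ⟨1, by omega, by omega, S, ∅, h⟩

theorem den_moduleValues (h : Env n k Γ s.arr) (hchair : ChairFree Γ) (hbull : BullFree Γ)
    {Act B : Finset ℕ} (hB : B = members n (s.arr 5)) (hf : IsTable (tab (k := k) s.qarr) B)
    (hrep : s.arr 12 0 ∈ B) (hmin : IsMinMod Γ Act B) (A : Finset (Fin k)) :
    IsBest Γ H (tab s.qarr) B A (((moduleValues H).den n s).qarr (qName 1 A ∅) 0) := by
  rw [moduleValues, Stmt.den_ite]
  split_ifs with hco
  · rw [sat_coDiamondE h, ← hB] at hco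
    obtain ⟨u, hu, v, hv, w, hw, x, hx, hd⟩ := hco
    have hdeg := hmin.degree_le_two hchair hbull hu hv hw hx hd
    -- The co-diamond supplies the three distinct vertices that connectedness of the module
    -- requires.
    have huw : u ≠ w := by rintro rfl; exact hd.2.2.2.2.1 hd.1
    have hvw : v ≠ w := by rintro rfl; exact hd.2.2.2.1 hd.1.symm
    refine (Stmt.den_seqSub (fun a q => (∀ A', A' < 8 ∨ A' = 12 → a A' = s.arr A') ∧
      ∀ S : Finset (Fin k), q (qName 0 S ∅) = s.qarr (qName 0 S ∅))
      (fun A _ q => IsBest Γ H (tab s.qarr) B A (q (qName 1 A ∅) 0)) ?_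
      ⟨fun _ _ => rfl, fun _ => rfl⟩).2 A
    rintro S s' - ⟨h1, h2⟩
    have htab : tab (k := k) s'.qarr = tab s.qarr := by
      funext S v
      rw [tab, h2, tab]
    have new := den_path (H := H) (h.congr fun A hA _ => h1 A (by omega)) (by rw [hB, h1 5 (by omega)])
      (htab ▸ hf) (h1 12 (Or.inr rfl) ▸ hrep) hmin hdeg hu hv hw hd.1.ne huw hvw S
    rw [htab] at new
    refine ⟨⟨fun A hA => ?_, fun T => ?_⟩, new, fun T hT => ?_⟩
    · rw [Stmt.den_arr, h1 A hA]
      intro hw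
      have := path_writesA hw
      omega
    · rw [Stmt.den_qarr, h2]
      intro hw
      rcases path_writesQ hw with ⟨S, T, h | h⟩ | h <;> simp at h
    · by_cases hTS : T = S
      · exact hTS ▸ new
      · rw [Stmt.den_qarr]
        · exact hT
        · intro hw
          rcases path_writesQ hw with ⟨S', T', h | h⟩ | h
          · simp at h
          · simp at h
          · exact hTS (qName_inj.1 h).2.1
  · rw [sat_coDiamondE h, ← hB] at hco
    have := den_seqSub_setQ (n := n) (s := s) (nm := fun A : Finset (Fin k) => qName 1 A ∅)
      (i := .const 0) (e := witnessE H) (idx := 0) (val := fun A => (witnessE H A).eval n s)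
      (fun S T h => by simpa using h) ?_ A
    · rw [this, Function.update_self]
      exact isBest_witnessE h hB hf (fun u hu v hv w hw x hx hd =>
        hco ⟨u, hu, v, hv, w, hw, x, hx, hd⟩) A
    · intro S s' hr ha hq
      refine ⟨rfl, IsGreatest.unique (s := {r | ∃ t, IsAssign Γ H B S t ∧
        r = ∑ v ∈ B, tab s.qarr (t v) v}) ?_ (isBest_witnessE h hB hf (fun u hu v hv w hw x hx hd =>
        hco ⟨u, hu, v, hv, w, hw, x, hx, hd⟩) S)⟩
      have htab : tab (k := k) s'.qarr = tab s.qarr := by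
        funext S v
        rw [tab, hq _ fun S h => by simp at h, tab]
      have := isBest_witnessE (H := H) (ha ▸ h) (ha ▸ hB) (htab ▸ hf) (fun u hu v hv w hw x hx hd =>
        hco ⟨u, hu, v, hv, w, hw, x, hx, hd⟩) S
      rwa [htab] at this

theorem contract_writesA {A : ℕ} (h : (contract H).WritesA A) : 4 ≤ A := by
  simp only [contract, Stmt.WritesA, Stmt.fill_writesA] at h
  rcases h with h | h | h | h | h | h
  · have := minModule_writesA h
    omega
  · omega
  · have := moduleValues_writesA h
    omega
  · obtain ⟨S, h⟩ := Stmt.seqSub_writesA h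
    exact h.elim
  · omega
  · omega

theorem contract_writesQ {A : ℕ} (h : (contract H).WritesQ A) :
    ∃ t ≤ 4, ∃ S T : Finset (Fin k), A = qName t S T := by
  simp only [contract, Stmt.WritesQ, Stmt.fill_writesQ, minModule_writesQ, false_or, or_false] at h
  rcases h with h | h
  · obtain ⟨t, -, h1, h2⟩ := moduleValues_writesQ h
    exact ⟨t, by omega, h2⟩
  · obtain ⟨S, h⟩ := Stmt.seqSub_writesQ h
    exact ⟨0, by omega, S, ∅, h⟩

/-- Only the representative of the module stays active. If the module has two vertices, the active
set shrinks; if not, the module was everything and at most one vertex is left. -/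
theorem den_contract (h : Env n k Γ s.arr) (hchair : ChairFree Γ) (hbull : BullFree Γ)
    {f₀ : Finset (Fin k) → ℕ → ℚ} {N : Finset ℕ} (h₀ : ∀ v ∈ N, f₀ ∅ v = 0)
    (hb : IsBlocks Γ H f₀ N (members n (s.arr 4)) (tab s.qarr)) :
    IsBlocks Γ H f₀ N (members n (((contract H).den n s).arr 4))
      (tab ((contract H).den n s).qarr) ∧
    ((members n (((contract H).den n s).arr 4)).card < (members n (s.arr 4)).card ∨
      (members n (((contract H).den n s).arr 4)).card ≤ 1) := by
  obtain ⟨hmin, htwo⟩ := den_minModule h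
  have hT := hb.isTable h₀
  rw [contract, den_seq, den_seq, den_seq, den_seq, den_seq]
  set Act := members n (s.arr 4) with hAct
  set s₁ := minModule.den n s with hs₁
  set B := members n (s₁.arr 5) with hB
  have a₁ : ∀ A < 5, s₁.arr A = s.arr A := fun A hA => Stmt.den_arr fun hw => by
    have := minModule_writesA hw
    omega
  have q₁ : s₁.qarr = s.qarr := funext fun A => Stmt.den_qarr minModule_writesQ
  have h₁ : Env n k Γ s₁.arr := h.congr fun A hA _ => a₁ A (by omega)
  set s₂ := (Stmt.setA 12 (.const 0) (.find 6 (.mem 5 (.reg 6)))).den n s₁ with hs₂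
  have a₂ : ∀ A ≠ 12, s₂.arr A = s₁.arr A := fun A hA => Stmt.den_arr (by simpa [Stmt.WritesA] using hA)
  have q₂ : s₂.qarr = s.qarr := q₁
  have h₂ : Env n k Γ s₂.arr := h₁.congr fun A hA _ => a₂ A (by omega)
  set b := s₂.arr 12 0 with hbdef
  set s₃ := (moduleValues H).den n s₂ with hs₃
  have a₃ : ∀ A, A < 8 ∨ A = 12 → s₃.arr A = s₂.arr A := fun A hA => Stmt.den_arr fun hw => by
    have := moduleValues_writesA hw
    omega
  have q₃ : ∀ S : Finset (Fin k), s₃.qarr (qName 0 S ∅) = s.qarr (qName 0 S ∅) := fun S => by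
    rw [← q₂]
    refine Stmt.den_qarr fun hw => ?_
    obtain ⟨t, h1, h2, S, T, h3⟩ := moduleValues_writesQ hw
    rw [qName_inj] at h3
    omega
  set s₄ := (Stmt.seqSub (List.finRange k) fun A : Finset (Fin k) =>
    .setQ (qName 0 A ∅) (sc 12) (.qarr (qName 1 A ∅) (.const 0))).den n s₃ with hs₄
  have a₄ : s₄.arr = s₃.arr := funext fun A => Stmt.den_arr fun hw => by
    obtain ⟨S, hw⟩ := Stmt.seqSub_writesA hw
    exact hw
  have q₄ : ∀ S : Finset (Fin k), s₄.qarr (qName 0 S ∅) =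
      Function.update (s.qarr (qName 0 S ∅)) b (s₃.qarr (qName 1 S ∅) 0) := by
    intro S
    rw [← q₃]
    refine den_seqSub_setQ (nm := fun A : Finset (Fin k) => qName 0 A ∅)
      (fun S T h => by simpa using h) (val := fun S => s₃.qarr (qName 1 S ∅) 0)
      (fun S s' hr ha hq => ⟨?_, ?_⟩) S
    · rw [eval_sc, ha, a₃ 12 (Or.inr rfl)]
    · rw [Expr.eval_qarr, hq _ fun T h => by simp at h]
      rfl
  have htab : ∀ (S : Finset (Fin k)) v, tab (k := k) ((Stmt.fill 5 4 (.mem 7 (.reg 5))).den n ((Stmt.fill 5 7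
      (.and (.mem 4 (.reg 5)) (.or (.not (.mem 5 (.reg 5))) (.eq (.reg 5) (sc 12))))).den n s₄)).qarr S v =
      if v = b then s₃.qarr (qName 1 S ∅) 0 else tab s.qarr S v := by
    intro S v
    rw [tab, Stmt.den_qarr Stmt.fill_writesQ, Stmt.den_qarr Stmt.fill_writesQ, q₄,
      Function.update_apply]
    rfl
  have hnew : members n (((Stmt.fill 5 4 (.mem 7 (.reg 5))).den n ((Stmt.fill 5 7
      (.and (.mem 4 (.reg 5)) (.or (.not (.mem 5 (.reg 5))) (.eq (.reg 5) (sc 12))))).den n s₄)).arr 4) =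
      {v ∈ Act | v ∉ B ∨ v = b} := by
    ext v
    have hmem : ∀ u, u ∈ members n (((Stmt.fill 5 7 (.and (.mem 4 (.reg 5))
        (.or (.not (.mem 5 (.reg 5))) (.eq (.reg 5) (sc 12))))).den n s₄).arr 7) ↔
        u ∈ Act ∧ (u ∉ B ∨ u = b) := by
      intro u
      rw [Stmt.den_fill (fun u => u ∈ Act ∧ (u ∉ B ∨ u = b))]
      · exact and_iff_right_of_imp fun hu => (mem_members.1 hu.1).1
      · intro j hj s' hr ha hq
        have e4 : s'.arr 4 = s.arr 4 := by
          rw [ha 4 (by decide), a₄, a₃ 4 (by omega), a₂ 4 (by decide), a₁ 4 (by decide)]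
        have e5 : s'.arr 5 = s₁.arr 5 := by
          rw [ha 5 (by decide), a₄, a₃ 5 (by omega), a₂ 5 (by decide)]
        have e12 : s'.arr 12 0 = b := by
          rw [ha 12 (by decide), a₄, a₃ 12 (by omega)]
        simp only [Expr.sat_and, Expr.sat_or, Expr.sat_not, Expr.sat_mem, Expr.sat_eq,
          Expr.eval_reg, eval_sc, hr, Function.update_self, e4, e5, e12]
        rfl
    rw [Stmt.den_fill (fun u => u ∈ Act ∧ (u ∉ B ∨ u = b)), Finset.mem_filter]
    · exact and_iff_right_of_imp fun hu => (mem_members.1 hu.1).1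
    · intro j hj s' hr ha hq
      rw [Expr.sat_mem, Expr.eval_reg, hr, Function.update_self, ha 7 (by decide), hmem]
  rw [hnew]
  have hsub : {v ∈ Act | v ∉ B ∨ v = b} ⊆ Act := Finset.filter_subset _ _
  by_cases hBne : B.Nonempty
  · have hbB : b ∈ B := by
      obtain ⟨y, hy⟩ := hBne
      have hsat : (Expr.mem 5 (.reg 6)).Sat n (s₁.set 6 y) := by
        rw [Expr.sat_mem]
        simpa using hy
      have := Expr.sat_find (mem_members.1 hy).1.le hsat
      rw [Expr.sat_mem] at this
      have e : b = (Expr.find 6 (.mem 5 (.reg 6))).eval n s₁ := by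
        rw [hbdef, hs₂, den_setA_arr]
        simp
      rw [e]
      simpa using this
    have hfB : IsTable (tab (k := k) s₂.qarr) B := by
      rw [q₂]
      exact ⟨fun v hv => hT.empty v (hmin.mod.1 hv), fun v hv => hT.mono v (hmin.mod.1 hv)⟩
    have hval := den_moduleValues (H := H) h₂ hchair hbull (by rw [a₂ 5 (by decide)]) hfB hbB hmin
    rw [q₂] at hval
    refine ⟨hb.contract hmin.mod hbB (fun S => ?_) fun S v hv => ?_, ?_⟩
    · rw [htab, if_pos rfl]
      exact hval S
    · rw [htab, if_neg hv]
    · by_cases hcard : B.card ≤ 1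
      · right
        exact (Finset.card_le_card hsub).trans (htwo hcard ▸ hcard)
      · left
        obtain ⟨y, hy, hyb⟩ := Finset.exists_mem_ne (not_le.1 hcard) b
        refine Finset.card_lt_card (hsub.ssubset_of_mem_notMem (hmin.mod.1 hy) fun hc => ?_)
        exact (Finset.mem_filter.1 hc).2.elim (fun hc => hc hy) hyb
  -- With no active vertices the representative is a meaningless default, but no table entry matters
  -- either.
  · have hB0 : B = ∅ := Finset.not_nonempty_iff_eq_empty.1 hBne
    have hA0 : Act = ∅ := by rw [← htwo (by rw [hB0]; simp), hB0]
    rw [hA0] at hb ⊢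
    simp only [Finset.filter_empty, Finset.card_empty]
    exact ⟨hb.congr fun v hv => absurd hv (Finset.notMem_empty v), Or.inr (by omega)⟩

end

end Prog

namespace Prog

section

variable {n k : ℕ} {Γ : SimpleGraph ℕ} {H : SimpleGraph (Fin k)} {s : Store}

/-! ### The program: the optimum value -/

/-- The revenue function in the memory. -/
def revOf (k : ℕ) (q : ℕ → ℕ → ℚ) (c : Fin k) (v : ℕ) : ℚ := q 0 (k * v + c)

theorem eval_revE {a : ℕ → ℕ → ℕ} (h : Env n k Γ a) (hs : s.arr = a) {c : Fin k} {e : Expr .nat}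
    {v : ℕ} (he : e.eval n s = v) (hv : v ≤ n) : (revE c e).eval n s = revOf k s.qarr c v := by
  subst hs
  simp only [revE, Expr.eval_qarr, Expr.eval_add, Expr.eval_arr, Expr.eval_const, he, h.rk v hv,
    revOf]

theorem solve_writesA {A : ℕ} (h : (solve H).WritesA A) : 4 ≤ A := by
  simp only [solve, initTables, Stmt.WritesA, Stmt.fill_writesA] at h
  rcases h with h | h | h | h
  · obtain ⟨S, h⟩ := Stmt.seqSub_writesA h
    exact h.elim
  · omega
  · exact contract_writesA h
  · exact h.elim

theorem solve_writesQ {A : ℕ} (h : (solve H).WritesQ A) :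
    ∃ t ≤ 4, ∃ S T : Finset (Fin k), A = qName t S T := by
  simp only [solve, initTables, Stmt.WritesQ, Stmt.fill_writesQ, false_or] at h
  rcases h with h | h | h
  · obtain ⟨S, h⟩ := Stmt.seqSub_writesQ h
    exact ⟨0, by omega, S, ∅, h⟩
  · exact contract_writesQ h
  · exact ⟨4, le_rfl, _, _, h⟩

theorem den_initTables (h : Env n k Γ s.arr) :
    ∀ v ≤ n, ∀ S : Finset (Fin k), tab ((initTables k).den n s).qarr S v =
      maxRev (revOf k s.qarr) S v := by
  have := Stmt.den_forN (n := n) (i := 5) (p := .seqSub (List.finRange k) fun S : Finset (Fin k) =>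
    .setQ (qName 0 S ∅) (.reg 5) (.maxCol (List.finRange k) S fun c => revE c (.reg 5))) (s := s)
    (fun j a q => a = s.arr ∧ q 0 = s.qarr 0 ∧ ∀ v < j, ∀ S : Finset (Fin k), q (qName 0 S ∅) v =
      maxRev (revOf k s.qarr) S v) ⟨rfl, rfl, fun v hv => absurd hv (Nat.not_lt_zero v)⟩ ?_
  · exact fun v hv => this.2.2 v (Nat.lt_succ_of_le hv)
  · rintro j hj s' hr ⟨h1, h2, h3⟩
    have key := den_seqSub_setQ (n := n) (s := s') (nm := fun S : Finset (Fin k) => qName 0 S ∅)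
      (i := .reg 5) (e := fun S => .maxCol (List.finRange k) S fun c => revE c (.reg 5)) (idx := j)
      (val := fun S => maxRev (revOf k s.qarr) S j) (fun S T h => by simpa using h) ?_
    · refine ⟨?_, ?_, fun v hv S => ?_⟩
      · rw [← h1]
        exact funext fun A => Stmt.den_arr fun hw => by
          obtain ⟨S, hw⟩ := Stmt.seqSub_writesA hw
          exact hw
      · rw [← h2]
        refine Stmt.den_qarr fun hw => ?_
        obtain ⟨S, hw⟩ := Stmt.seqSub_writesQ hw
        exact qName_ne_zero hw.symm
      · rw [key S]
        rcases Nat.lt_succ_iff_lt_or_eq.1 hv with hv | rfl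
        · rw [Function.update_of_ne hv.ne, h3 v hv]
        · rw [Function.update_self]
    · intro S s'' hr' ha' hq'
      have hreg : s''.reg 5 = j := by rw [hr', hr]; simp
      refine ⟨hreg, ?_⟩
      rw [Expr.eval_maxCol fun c _ => List.mem_finRange c, maxRev]
      congr 1
      funext c
      rw [eval_revE h (ha'.trans h1) (e := .reg 5) hreg hj, revOf, revOf,
        hq' 0 fun T h => qName_ne_zero h.symm, h2]

theorem den_solve (h : Env n k Γ s.arr) (hchair : ChairFree Γ) (hbull : BullFree Γ) :
    IsOpt Γ H n (revOf k s.qarr)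
      (((solve H).den n s).qarr (qName 4 (∅ : Finset (Fin k)) ∅) 0) := by
  rw [solve, den_seq, den_seq, den_seq]
  set s₁ := (initTables k).den n s with hs₁
  have a₁ : s₁.arr = s.arr := funext fun A => Stmt.den_arr fun hw => by
    obtain ⟨S, hw⟩ := Stmt.seqSub_writesA hw
    exact hw
  have t₁ := den_initTables h
  set s₂ := (Stmt.fill 5 4 (.lt (.reg 5) .len)).den n s₁ with hs₂
  have m₂ : members n (s₂.arr 4) = Finset.range n := by
    ext v
    rw [hs₂, Stmt.den_fill (fun v => v < n), Finset.mem_range, and_self_iff]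
    intro j hj s' hr ha hq
    simp [hr]
  have q₂ : s₂.qarr = s₁.qarr := funext fun A => Stmt.den_qarr Stmt.fill_writesQ
  have h₂ : Env n k Γ s₂.arr := h.congr fun A hA _ => by
    rw [← a₁]
    exact Stmt.den_arr fun hw => by
      rw [Stmt.fill_writesA] at hw
      omega
  have hinit : IsBlocks Γ H (maxRev (revOf k s.qarr)) (Finset.range n) (members n (s₂.arr 4))
      (tab s₂.qarr) := by
    rw [m₂, q₂]
    exact (IsBlocks.init (isTable_maxRev _ _)).congr fun v hv S =>
      t₁ v (Finset.mem_range.1 hv).le S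
  -- As long as two active vertices remain, each round has removed at least one; after `n + 1`
  -- rounds this alternative is impossible.
  have key := Stmt.den_forN (n := n) (i := 1) (p := contract H) (s := s₂) (fun j a q =>
    Env n k Γ a ∧ IsBlocks Γ H (maxRev (revOf k s.qarr)) (Finset.range n) (members n (a 4)) (tab q) ∧
      ((members n (a 4)).card ≤ 1 ∨ (members n (a 4)).card + j ≤ n))
    ⟨h₂, hinit, Or.inr (card_members _ _)⟩ ?_
  · obtain ⟨-, h1, h2⟩ := key
    have hc := h2.resolve_right (by omega)
    have hbest := h1.isBest hc Finset.univ
    set s₃ := (Stmt.forN 1 (contract H)).den n s₂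
    refine (congrArg (IsBest Γ H (maxRev (revOf k s.qarr)) (Finset.range n) Finset.univ) ?_).mpr hbest
    rw [den_setQ_qarr]
    simp only [Expr.eval_const, Function.update_self, Expr.eval_qsum]
    have hsub : Finset.range (n + 1) ∩ members n (s₃.arr 4) = members n (s₃.arr 4) :=
      Finset.inter_eq_right.2 fun v hv =>
        Finset.mem_range.2 ((mem_members.1 hv).1.trans (Nat.lt_succ_self n))
    have hsum : ∑ v ∈ members n (s₃.arr 4), tab (k := k) s₃.qarr Finset.univ v =
        ∑ v ∈ Finset.range (n + 1),
          if v ∈ members n (s₃.arr 4) then tab (k := k) s₃.qarr Finset.univ v else 0 := by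
      rw [Finset.sum_ite_mem, hsub]
    rw [hsum]
    refine Finset.sum_congr rfl fun v _ => ?_
    rw [Expr.eval_qite]
    refine if_congr ?_ ?_ rfl
    · rw [Expr.sat_mem]
      simp
    · rw [Expr.eval_qarr]
      simp [tab]
  · rintro j hj s' - ⟨h1, h2, h3⟩
    obtain ⟨h4, h5⟩ := den_contract h1 hchair hbull (fun v hv => (isTable_maxRev _ _).empty v hv) h2
    refine ⟨h1.congr fun A hA _ => Stmt.den_arr fun hw => ?_, h4, ?_⟩
    · have := contract_writesA hw
      omega
    · omega

/-! ### The program: the solution -/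

theorem revOf_update {q : ℕ → ℕ → ℚ} {c : Fin k} {v : ℕ} {x : ℚ} {d : Fin k} {u : ℕ} :
    revOf k (Function.update q 0 (Function.update (q 0) (k * v + c) x)) d u =
      if d = c ∧ u = v then x else revOf k q d u := by
  have : k * u + d = k * v + c ↔ d = c ∧ u = v := by
    constructor
    · intro h
      have h1 : (k * u + d) % k = (k * v + c) % k := by rw [h]
      rw [Nat.mul_add_mod, Nat.mul_add_mod, Nat.mod_eq_of_lt d.2, Nat.mod_eq_of_lt c.2] at h1
      have h2 : k * u = k * v := by omega
      exact ⟨Fin.ext h1, Nat.eq_of_mul_eq_mul_left (d.pos) h2⟩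
    · rintro ⟨rfl, rfl⟩
      rfl
  simp only [revOf, Function.update_self, Function.update_apply, this]

theorem tryZero_writesA {c : Fin k} {A : ℕ} (h : (tryZero H c).WritesA A) : 4 ≤ A := by
  simp only [tryZero, Stmt.WritesA, false_or, or_false] at h
  exact solve_writesA h

/-- Computing an optimum leaves the revenues and the rational arrays of kinds `5` and `6` intact, so
the two optima can be compared and a rejected change undone exactly. -/
theorem den_tryZero (h : Env n k Γ s.arr) (hchair : ChairFree Γ) (hbull : BullFree Γ)
    {w₀ : Fin k → ℕ → ℚ} {D : Fin k → ℕ → Prop} {best : ℚ} {v : ℕ} (hv : s.reg 0 = v) (hvn : v < n)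
    (c : Fin k) (hb : s.qarr (qName 5 (∅ : Finset (Fin k)) ∅) 0 = best)
    (hR : IsReduced Γ H n w₀ D best (revOf k s.qarr)) :
    ((tryZero H c).den n s).qarr (qName 5 (∅ : Finset (Fin k)) ∅) 0 = best ∧
    IsReduced Γ H n w₀ (fun d u => D d u ∨ d = c ∧ u = v) best
      (revOf k ((tryZero H c).den n s).qarr) := by
  have ne0 : ∀ t, qName t (∅ : Finset (Fin k)) ∅ ≠ 0 := fun t => qName_ne_zero
  have ne0' : ∀ t, 0 ≠ qName t (∅ : Finset (Fin k)) ∅ := fun t => (ne0 t).symm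
  rw [tryZero, den_seq, den_seq, den_seq]
  set s₁ := (Stmt.setQ (qName 6 (∅ : Finset (Fin k)) ∅) (.const 0) (revE c (.reg 0))).den n s with hs₁
  have e1 : s₁.qarr 0 = s.qarr 0 := by
    rw [hs₁, den_setQ_qarr, Function.update_of_ne (ne0' 6)]
  have e1' : s₁.qarr (qName 5 (∅ : Finset (Fin k)) ∅) 0 = best := by
    rw [hs₁, den_setQ_qarr, Function.update_of_ne (by simp), hb]
  have o1 : s₁.qarr (qName 6 (∅ : Finset (Fin k)) ∅) 0 = revOf k s.qarr c v := by
    rw [hs₁, den_setQ_qarr, Function.update_self, eval_revE h rfl (e := .reg 0) hv hvn.le]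
    simp
  have idx : ∀ s' : Store, s'.arr 3 = s.arr 3 → s'.reg = s.reg →
      (Expr.add (.arr 3 (.reg 0)) (.const c)).eval n s' = k * v + c := by
    intro s' ha hr
    simp only [Expr.eval_add, Expr.eval_arr, Expr.eval_reg, Expr.eval_const, hr, hv, ha,
      h.rk v hvn.le]
  set s₂ := (Stmt.setQ 0 (.add (.arr 3 (.reg 0)) (.const c)) .qzero).den n s₁ with hs₂
  have e2 : s₂.qarr = Function.update s₁.qarr 0 (Function.update (s₁.qarr 0) (k * v + c) 0) := by
    rw [hs₂, den_setQ_qarr, idx s₁ rfl rfl]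
    rfl
  have r2 : revOf k s₂.qarr = zeroAt (revOf k s.qarr) c v := by
    funext d u
    rw [e2, revOf_update, zeroAt, revOf, revOf, e1]
  have hopt := den_solve (H := H) (s := s₂) h hchair hbull
  rw [r2] at hopt
  set s₃ := (solve H).den n s₂ with hs₃
  set r := s₃.qarr (qName 4 (∅ : Finset (Fin k)) ∅) 0 with hr
  have fr : ∀ t, 4 < t → s₃.qarr (qName t (∅ : Finset (Fin k)) ∅) = s₂.qarr (qName t (∅ : Finset (Fin k)) ∅) :=
    fun t ht => Stmt.den_qarr fun hw => by
      obtain ⟨t', h1, S, T, h2⟩ := solve_writesQ hw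
      rw [qName_inj] at h2
      omega
  have fr0 : s₃.qarr 0 = s₂.qarr 0 := Stmt.den_qarr fun hw => by
    obtain ⟨t', h1, S, T, h2⟩ := solve_writesQ hw
    exact qName_ne_zero h2.symm
  have b3 : s₃.qarr (qName 5 (∅ : Finset (Fin k)) ∅) 0 = best := by
    rw [fr 5 (by omega), e2, Function.update_of_ne (ne0 5), e1']
  have o3 : s₃.qarr (qName 6 (∅ : Finset (Fin k)) ∅) 0 = revOf k s.qarr c v := by
    rw [fr 6 (by omega), e2, Function.update_of_ne (ne0 6), o1]
  rw [Stmt.den_ite]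
  have hsat : (Expr.qlt (.qarr (qName 4 (∅ : Finset (Fin k)) ∅) (.const 0))
      (.qarr (qName 5 (∅ : Finset (Fin k)) ∅) (.const 0))).Sat n s₃ ↔ r < best := by
    rw [Expr.sat_qlt, Expr.eval_qarr, Expr.eval_qarr, Expr.eval_const, b3]
  split_ifs with hlt
  · rw [hsat] at hlt
    have ha3 : s₃.arr 3 = s.arr 3 := Stmt.den_arr fun hw => by
      have := solve_writesA hw
      omega
    have hq : ((Stmt.setQ 0 (.add (.arr 3 (.reg 0)) (.const c))
        (.qarr (qName 6 (∅ : Finset (Fin k)) ∅) (.const 0))).den n s₃).qarr =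
        Function.update s₃.qarr 0 (Function.update (s₃.qarr 0) (k * v + c) (revOf k s.qarr c v)) := by
      rw [den_setQ_qarr, idx s₃ ha3 (Stmt.den_reg n _ s₂), Expr.eval_qarr, Expr.eval_const, o3]
    have hrev : revOf k ((Stmt.setQ 0 (.add (.arr 3 (.reg 0)) (.const c))
        (.qarr (qName 6 (∅ : Finset (Fin k)) ∅) (.const 0))).den n s₃).qarr = revOf k s.qarr := by
      funext d u
      rw [hq, revOf_update]
      split_ifs with hdu
      · rw [hdu.1, hdu.2]
      · have := congrFun (congrFun r2 d) u
        rw [zeroAt_of_ne hdu] at this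
        rw [← this, revOf, revOf, fr0]
    refine ⟨?_, ?_⟩
    · rw [hq, Function.update_of_ne (ne0 5), b3]
    · rw [hrev]
      exact hR.keep hopt hlt
  · rw [hsat, not_lt] at hlt
    refine ⟨b3, ?_⟩
    have : revOf k s₃.qarr = zeroAt (revOf k s.qarr) c v := by
      rw [← r2]
      funext d u
      rw [revOf, revOf, fr0]
    show IsReduced Γ H n w₀ _ best (revOf k s₃.qarr)
    rw [this]
    exact hR.drop hopt hlt

theorem den_multiples :
    (∀ i ≤ n, ((multiples k).den n s).arr 2 i = n * i ∧ ((multiples k).den n s).arr 3 i = k * i) ∧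
      ((multiples k).den n s).arr 0 = s.arr 0 ∧ ((multiples k).den n s).qarr = s.qarr := by
  rw [multiples, den_seq, den_seq]
  have := Stmt.den_forN (n := n) (i := 0) (p := .seq
      (.setA 2 (.add (.reg 0) (.const 1)) (.add (.arr 2 (.reg 0)) .len))
      (.setA 3 (.add (.reg 0) (.const 1)) (.add (.arr 3 (.reg 0)) (.const k))))
    (s := (Stmt.setA 3 (.const 0) (.const 0)).den n ((Stmt.setA 2 (.const 0) (.const 0)).den n s))
    (fun j a q => (∀ i ≤ j, a 2 i = n * i ∧ a 3 i = k * i) ∧ a 0 = s.arr 0 ∧ q = s.qarr)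
    ⟨fun i hi => ?_, by simp, rfl⟩ ?_
  · exact ⟨fun i hi => this.1 i (by omega), this.2⟩
  · obtain rfl : i = 0 := by omega
    simp
  · rintro j hj s' hr ⟨h1, h2, h3⟩
    have hr0 : s'.reg 0 = j := by simp [hr]
    refine ⟨fun i hi => ?_, ?_, h3⟩
    · obtain ⟨h4, h5⟩ := h1 j le_rfl
      rcases Nat.le_succ_iff.1 hi with hi | rfl
      · obtain ⟨h6, h7⟩ := h1 i hi
        have hne : i ≠ j + 1 := by omega
        simp [den_seq, Stmt.den_reg, hr0, hne, h6, h7]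
      · simp [den_seq, Stmt.den_reg, hr0, h4, h5, Nat.mul_succ]
    · simp [den_seq, h2]

theorem output_spec (h : Env n k Γ s.arr) : ∀ v < n,
    (((output k).den n s).arr 1 v = 0 ∧ ∀ c : Fin k, ¬ 0 < revOf k s.qarr c v) ∨
      ∃ c : Fin k, 0 < revOf k s.qarr c v ∧ ((output k).den n s).arr 1 v = c + 1 := by
  have := Stmt.den_forN (n := n) (i := 0) (p := .seq (.setA 1 (.reg 0) (.const 0))
      (.seqCol (List.finRange k) fun c => .ite (.qlt .qzero (revE c (.reg 0)))
        (.setA 1 (.reg 0) (.const (c + 1))) .skip)) (s := s)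
    (fun j a q => (∀ A, A ≠ 1 → a A = s.arr A) ∧ q = s.qarr ∧ ∀ v < j,
      (a 1 v = 0 ∧ ∀ c : Fin k, ¬ 0 < revOf k s.qarr c v) ∨
      ∃ c : Fin k, 0 < revOf k s.qarr c v ∧ a 1 v = c + 1)
    ⟨fun _ _ => rfl, rfl, fun v hv => absurd hv (Nat.not_lt_zero v)⟩ ?_
  · exact fun v hv => this.2.2 v (by omega)
  · rintro j hj s' hr ⟨h1, h2, h3⟩
    have hr0 : s'.reg 0 = j := by simp [hr]
    rw [den_seq]
    have key := Stmt.den_seqCol (n := n) (p := fun c : Fin k => .ite (.qlt .qzero (revE c (.reg 0)))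
        (.setA 1 (.reg 0) (.const (c + 1))) .skip)
      (s := (Stmt.setA 1 (.reg 0) (.const 0)).den n s') (fun D a q => (∀ A, A ≠ 1 → a A = s.arr A) ∧
        q = s.qarr ∧ (∀ v ≠ j, a 1 v = s'.arr 1 v) ∧
        ((a 1 j = 0 ∧ ∀ c : Fin k, D c → ¬ 0 < revOf k s.qarr c j) ∨
        ∃ c : Fin k, 0 < revOf k s.qarr c j ∧ a 1 j = c + 1)) ?_ ?_
    · obtain ⟨h4, h5, h6, h7⟩ := key
      refine ⟨h4, h5, fun v hv => ?_⟩
      rcases Nat.lt_succ_iff_lt_or_eq.1 hv with hv | rfl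
      · rw [h6 v hv.ne]
        exact h3 v hv
      · simpa using h7
    · rintro c D s'' hr'' ⟨h4, h5, h6, h7⟩
      have hr0' : s''.reg 0 = j := by rw [hr'', Stmt.den_reg, hr0]
      have he : Env n k Γ s''.arr := h.congr fun A _ hA => h4 A hA
      have hsat : (Expr.qlt .qzero (revE c (.reg 0))).Sat n s'' ↔ 0 < revOf k s.qarr c j := by
        rw [Expr.sat_qlt, Expr.eval_qzero, eval_revE he rfl (e := .reg 0) hr0' hj, h5]
      rw [Stmt.den_ite]
      split_ifs with hb
      · rw [hsat] at hb
        refine ⟨fun A hA => ?_, h5, fun v hv => ?_, Or.inr ⟨c, hb, ?_⟩⟩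
        · rw [den_setA_arr, Function.update_of_ne hA, h4 A hA]
        · rw [den_setA_arr, Function.update_self, Expr.eval_reg, hr0', Function.update_of_ne hv, h6 v hv]
        · simp [hr0']
      · rw [hsat] at hb
        refine ⟨h4, h5, h6, ?_⟩
        rcases h7 with ⟨h7, h8⟩ | h7
        · refine Or.inl ⟨h7, ?_⟩
          rintro d (hd | rfl)
          · exact h8 d hd
          · exact hb
        · exact Or.inr h7
    · refine ⟨fun A hA => ?_, h2, fun v hv => ?_, Or.inl ⟨?_, fun c hc => hc.elim⟩⟩
      · rw [den_setA_arr, Function.update_of_ne hA, h1 A hA]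
      · simp [hr0, hv]
      · simp [hr0]

theorem den_main (hadj : ∀ u < n, ∀ v < n, s.arr 0 (n * u + v) = 1 ↔ Γ.Adj u v)
    (hlt : ∀ u v, Γ.Adj u v → u < n) (hchair : ChairFree Γ) (hbull : BullFree Γ)
    (hw : ∀ c v, 0 ≤ revOf k s.qarr c v) :
    ∃ w q, IsReduced Γ H n (revOf k s.qarr) (fun _ v => v < n) q w ∧ ∀ v < n,
      (((main H).den n s).arr 1 v = 0 ∧ ∀ c : Fin k, ¬ 0 < w c v) ∨
        ∃ c : Fin k, 0 < w c v ∧ ((main H).den n s).arr 1 v = c + 1 := by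
  rw [main, den_seq, den_seq, den_seq, den_seq]
  set s₁ := (multiples k).den n s with hs₁
  obtain ⟨h1, h2, h3⟩ := den_multiples (n := n) (k := k) (s := s)
  have h₁ : Env n k Γ s₁.arr := ⟨fun i hi => (h1 i hi).1, fun i hi => (h1 i hi).2, h2 ▸ hadj, hlt⟩
  have hopt := den_solve (H := H) h₁ hchair hbull
  rw [h3] at hopt
  set s₂ := (solve H).den n s₁ with hs₂
  have h₂ : Env n k Γ s₂.arr := h₁.congr fun A hA _ => Stmt.den_arr fun hw => by
    have := solve_writesA hw
    omega
  set s₃ := (Stmt.setQ (qName 5 (∅ : Finset (Fin k)) ∅) (.const 0)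
    (.qarr (qName 4 (∅ : Finset (Fin k)) ∅) (.const 0))).den n s₂ with hs₃
  have h₃ : Env n k Γ s₃.arr := h₂
  have q₃ : s₃.qarr 0 = s.qarr 0 := by
    rw [hs₃, den_setQ_qarr, Function.update_of_ne (Ne.symm qName_ne_zero), ← h3]
    refine Stmt.den_qarr fun hw => ?_
    obtain ⟨t', h1, S, T, h2⟩ := solve_writesQ hw
    exact qName_ne_zero h2.symm
  have r₃ : revOf k s₃.qarr = revOf k s.qarr := by
    funext c v
    rw [revOf, revOf, q₃]
  set best := s₂.qarr (qName 4 (∅ : Finset (Fin k)) ∅) 0 with hbest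
  have b₃ : s₃.qarr (qName 5 (∅ : Finset (Fin k)) ∅) 0 = best := by
    rw [hs₃, den_setQ_qarr]
    simp [hbest]
  have hinit : IsReduced Γ H n (revOf k s.qarr) (fun _ v => v < 0) best (revOf k s₃.qarr) := by
    rw [r₃]
    exact isReduced_init hw hopt fun v _ c => Nat.not_lt_zero v
  have key := Stmt.den_forN (n := n) (i := 0)
    (p := .ite (.lt (.reg 0) .len) (.seqCol (List.finRange k) (tryZero H)) .skip) (s := s₃)
    (fun j a q => Env n k Γ a ∧ q (qName 5 (∅ : Finset (Fin k)) ∅) 0 = best ∧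
      IsReduced Γ H n (revOf k s.qarr) (fun _ v => v < j) best (revOf k q)) ⟨h₃, b₃, hinit⟩ ?_
  · set s₄ := (Stmt.forN 0
      (.ite (.lt (.reg 0) .len) (.seqCol (List.finRange k) (tryZero H)) .skip)).den n s₃
    exact ⟨revOf k s₄.qarr, best, key.2.2.mono fun v hv c _ => Nat.lt_succ_of_lt hv, output_spec key.1⟩
  · rintro j hj s' hr ⟨h4, h5, h6⟩
    have hr0 : s'.reg 0 = j := by simp [hr]
    rw [Stmt.den_ite]
    split_ifs with hb
    · rw [Expr.sat_lt, Expr.eval_reg, Expr.eval_len, hr0] at hb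
      have := Stmt.den_seqCol (n := n) (p := tryZero H) (s := s') (fun D a q =>
        Env n k Γ a ∧ q (qName 5 (∅ : Finset (Fin k)) ∅) 0 = best ∧
        IsReduced Γ H n (revOf k s.qarr) (fun c v => v < j ∨ D c ∧ v = j) best (revOf k q)) ?_
        ⟨h4, h5, h6.mono fun v _ c hd => hd.resolve_right fun e => e.1⟩
      · refine ⟨this.1, this.2.1, this.2.2.mono fun v _ c hd => ?_⟩
        rcases Nat.lt_succ_iff_lt_or_eq.1 hd with hd | hd
        · exact Or.inl hd
        · exact Or.inr ⟨trivial, hd⟩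
      · rintro c D s'' hr'' ⟨h7, h8, h9⟩
        obtain ⟨h10, h11⟩ := den_tryZero h7 hchair hbull ((congrFun hr'' 0).trans hr0) hb c h8 h9
        refine ⟨h7.congr fun A hA _ => Stmt.den_arr fun hw => ?_, h10, h11.mono fun v _ d hd => ?_⟩
        · have := tryZero_writesA hw
          omega
        · tauto
    · rw [Expr.sat_lt, Expr.eval_reg, Expr.eval_len, hr0] at hb
      exact ⟨h4, h5, h6.mono fun v hv c _ => hv.trans_le (not_lt.1 hb)⟩

end

end Prog

/-! ### Running times -/

/-- The nesting depth. -/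
def Expr.height : {τ : Ty} → Expr τ → ℕ
  | _, .const _ => 0
  | _, .len => 0
  | _, .reg _ => 0
  | _, .arr _ e => e.height + 1
  | _, .add e₁ e₂ => max e₁.height e₂.height + 1
  | _, .find _ b => b.height + 1
  | _, .eq e₁ e₂ => max e₁.height e₂.height + 1
  | _, .lt e₁ e₂ => max e₁.height e₂.height + 1
  | _, .qlt e₁ e₂ => max e₁.height e₂.height + 1
  | _, .and b₁ b₂ => max b₁.height b₂.height + 1
  | _, .not b => b.height + 1
  | _, .ex _ b => b.height + 1
  | _, .qzero => 0
  | _, .qarr _ e => e.height + 1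
  | _, .qadd e₁ e₂ => max e₁.height e₂.height + 1
  | _, .qmax e₁ e₂ => max e₁.height e₂.height + 1
  | _, .qite b e₁ e₂ => max b.height (max e₁.height e₂.height) + 1
  | _, .qsum _ e => e.height + 1
  | _, .qsup _ e => e.height + 1

/-- The nesting depth. -/
def Stmt.height : Stmt → ℕ
  | .skip => 0
  | .setA _ i e => max i.height e.height + 1
  | .setQ _ i e => max i.height e.height + 1
  | .seq p q => max p.height q.height + 1
  | .ite b p q => max b.height (max p.height q.height) + 1
  | .forN _ p => p.height + 1

section Cost

variable {n : ℕ}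

theorem cost_un {a p : ℕ} (h : a ≤ (64 * (n + 2)) ^ p) : a + 4 ≤ (64 * (n + 2)) ^ (p + 1) := by
  have : 1 ≤ (64 * (n + 2)) ^ p := Nat.one_le_pow _ _ (by omega)
  rw [pow_succ]
  nlinarith

theorem cost_tri {a b c p q r : ℕ} (ha : a ≤ (64 * (n + 2)) ^ p) (hb : b ≤ (64 * (n + 2)) ^ q)
    (hc : c ≤ (64 * (n + 2)) ^ r) :
    a + (b + c) + 6 ≤ (64 * (n + 2)) ^ (max p (max q r) + 1) := by
  have hmono : ∀ {i j}, i ≤ j → (64 * (n + 2)) ^ i ≤ (64 * (n + 2)) ^ j := fun h =>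
    Nat.pow_le_pow_right (by omega) h
  have h1 := ha.trans (hmono (le_max_left p (max q r)))
  have h2 := hb.trans (hmono ((le_max_left q r).trans (le_max_right p (max q r))))
  have h3 := hc.trans (hmono ((le_max_right q r).trans (le_max_right p (max q r))))
  have : 1 ≤ (64 * (n + 2)) ^ (max p (max q r)) := Nat.one_le_pow _ _ (by omega)
  rw [pow_succ]
  nlinarith

theorem cost_bin {a b p q : ℕ} (ha : a ≤ (64 * (n + 2)) ^ p) (hb : b ≤ (64 * (n + 2)) ^ q) :
    a + b + 4 ≤ (64 * (n + 2)) ^ (max p q + 1) := by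
  have := cost_tri ha hb hb
  rw [max_self] at this
  omega

theorem cost_loop {a p : ℕ} (h : a ≤ (64 * (n + 2)) ^ p) :
    (n + 1) * (a + 12) + 20 ≤ (64 * (n + 2)) ^ (p + 1) := by
  have h1 : 1 ≤ (64 * (n + 2)) ^ p := Nat.one_le_pow _ _ (by omega)
  rw [pow_succ]
  set X := (64 * (n + 2)) ^ p
  calc (n + 1) * (a + 12) + 20 ≤ (n + 1) * (X + 12 * X) + 20 * X := by gcongr <;> omega
    _ = X * (13 * (n + 1) + 20) := by ring
    _ ≤ X * (64 * (n + 2)) := by gcongr; omega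

/-- One level of nesting costs at most a factor `64 * (n + 2)`, even for a loop: the bounds
`cost_loop` and `cost_tri` absorb all additive constants. -/
theorem Expr.cost_le {τ : Ty} (e : Expr τ) : e.cost n ≤ (64 * (n + 2)) ^ e.height := by
  induction e with
  | const | len | reg | qzero => exact le_rfl
  | arr _ e ih => exact le_trans (by simp only [cost]; omega) (cost_un ih)
  | qarr _ e ih => exact le_trans (by simp only [cost]; omega) (cost_un ih)
  | not e ih => exact cost_un ih
  | add _ _ h₁ h₂ => exact le_trans (by simp only [cost]; omega) (cost_bin h₁ h₂)
  | qadd _ _ h₁ h₂ => exact le_trans (by simp only [cost]; omega) (cost_bin h₁ h₂)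
  | eq _ _ h₁ h₂ => exact cost_bin h₁ h₂
  | lt _ _ h₁ h₂ => exact cost_bin h₁ h₂
  | qlt _ _ h₁ h₂ => exact cost_bin h₁ h₂
  | and _ _ h₁ h₂ => exact cost_bin h₁ h₂
  | qmax _ _ h₁ h₂ => exact cost_bin h₁ h₂
  | qite _ _ _ h₁ h₂ h₃ => exact cost_tri h₁ h₂ h₃
  | find _ _ ih => exact cost_loop ih
  | ex _ _ ih => exact cost_loop ih
  | qsum _ _ ih => exact cost_loop ih
  | qsup _ _ ih => exact cost_loop ih

theorem Stmt.cost_le (p : Stmt) : p.cost n ≤ (64 * (n + 2)) ^ p.height := by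
  induction p with
  | skip => exact le_rfl
  | setA _ i e => exact le_trans (by simp only [cost]; omega) (cost_bin i.cost_le e.cost_le)
  | setQ _ i e => exact le_trans (by simp only [cost]; omega) (cost_bin i.cost_le e.cost_le)
  | seq _ _ h₁ h₂ => exact le_trans (by simp only [cost]; omega) (cost_bin h₁ h₂)
  | ite b _ _ h₁ h₂ => exact cost_tri b.cost_le h₁ h₂
  | forN _ _ ih => exact cost_loop ih

end Cost

/-! ### Bounds for the nesting depth -/

section Height

variable {k : ℕ}

/-- The sets of colors are enumerated by a binary tree, one level per color, so a range over `2 ^ k`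
sets adds only `k` to the depth and hence to the exponent. -/
theorem Expr.height_maxSub {l : List (Fin k)} {m : ℕ} : ∀ {f : Finset (Fin k) → Expr .rat},
    (∀ S, (f S).height ≤ m) → (maxSub l f).height ≤ l.length + m := by
  induction l with
  | nil => exact fun h => (h ∅).trans (Nat.le_add_left _ _)
  | cons c l ih =>
    intro f h
    have h1 := ih h
    have h2 := ih (f := fun S => f (insert c S)) fun S => h _
    simp only [maxSub, height, List.length_cons]
    omega

theorem Expr.height_allCol {l : List (Fin k)} {m : ℕ} {g : Fin k → Expr .bool}
    (h : ∀ c, (g c).height ≤ m) : (allCol l g).height ≤ l.length + (m + 1) := by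
  induction l with
  | nil => simp [allCol, height]
  | cons c l ih =>
    have := h c
    simp only [allCol, List.foldr_cons, height, List.length_cons] at ih ⊢
    omega

theorem Expr.height_maxCol {l : List (Fin k)} {S : Finset (Fin k)} {m : ℕ} {g : Fin k → Expr .rat}
    (h : ∀ c, (g c).height ≤ m) : (maxCol l S g).height ≤ l.length + m := by
  induction l with
  | nil => simp [maxCol, height]
  | cons c l ih =>
    have : (if c ∈ S then g c else qzero).height ≤ m := by
      split_ifs
      · exact h c
      · exact Nat.zero_le m
    simp only [maxCol, List.foldr_cons, height, List.length_cons] at ih ⊢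
    omega

theorem Expr.height_supNest {l : List ℕ} {e : Expr .rat} :
    (supNest l e).height = l.length + e.height := by
  induction l with
  | nil => simp [supNest]
  | cons c l ih =>
    simp only [supNest, List.foldr_cons, height, List.length_cons] at ih ⊢
    omega

theorem Stmt.height_seqSub {l : List (Fin k)} {m : ℕ} : ∀ {f : Finset (Fin k) → Stmt},
    (∀ S, (f S).height ≤ m) → (seqSub l f).height ≤ l.length + m := by
  induction l with
  | nil => exact fun h => (h ∅).trans (Nat.le_add_left _ _)
  | cons c l ih =>
    intro f h
    have h1 := ih h
    have h2 := ih (f := fun S => f (insert c S)) fun S => h _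
    simp only [seqSub, height, List.length_cons]
    omega

theorem Stmt.height_seqCol {l : List (Fin k)} {m : ℕ} {p : Fin k → Stmt}
    (h : ∀ c, (p c).height ≤ m) : (seqCol l p).height ≤ l.length + m := by
  induction l with
  | nil => simp [seqCol, height]
  | cons c l ih =>
    have := h c
    simp only [seqCol, List.foldr_cons, height, List.length_cons] at ih ⊢
    omega

end Height

namespace Prog

section

variable {k : ℕ} {H : SimpleGraph (Fin k)}

theorem height_assign₂ {t m : ℕ} {e : Finset (Fin k) → Finset (Fin k) → Expr .rat}
    (h : ∀ S T, (e S T).height ≤ m) : (assign₂ t e).height ≤ 2 * k + (m + 1) := by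
  have h1 : ∀ S : Finset (Fin k), _ := fun S => Stmt.height_seqSub (l := List.finRange k) (m := m + 1)
    (f := fun T => .setQ (qName t S T) (.const 0) (e S T)) fun T => by
      simpa [Stmt.height, Expr.height] using h S T
  have h2 := Stmt.height_seqSub (l := List.finRange k) h1
  simp only [List.length_finRange] at h2
  exact h2.trans (by omega)

theorem height_sc {A : ℕ} : (sc A).height = 1 := rfl

theorem height_ofProp {p : Prop} : (Expr.ofProp p).height = 1 := rfl

theorem height_pathInit {A : Finset (Fin k)} : (pathInit A).height ≤ 2 * k + 20 := by
  have h := height_assign₂ (k := k) (t := 2) (m := 2)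
    (e := fun S T => .qarr (qName 0 (S ∩ T ∩ A) ∅) (sc 12)) fun S T => le_rfl
  simp only [pathInit, Stmt.fill, Stmt.height, Expr.height, height_sc]
  omega

theorem height_pathExtend {A : Finset (Fin k)} : (pathExtend H A).height ≤ 5 * k + 40 := by
  have h1 : ∀ S T : Finset (Fin k), (pathUpdateE H A S T).height ≤ 3 * k + 20 := by
    intro S T
    have := Expr.height_maxSub (l := List.finRange k) fun R =>
      Expr.height_maxSub (l := List.finRange k) fun S₁ => Expr.height_maxSub (l := List.finRange k)
      (m := 20) (f := fun T₁ => .qite (candE H A S T R S₁ T₁)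
      (.qadd (.qarr (qName 0 R ∅) (sc 11)) (.qarr (qName 2 S₁ T₁) (.const 0))) .qzero) fun T₁ => by
        simp only [Expr.height, candE, Expr.imp, Expr.or, Expr.ofProp, adjE, sc]
        decide
    simp only [List.length_finRange] at this
    exact this.trans (by omega)
  have h2 := height_assign₂ (t := 3) h1
  have h3 := height_assign₂ (k := k) (t := 2) (m := 1)
    (e := fun S T => .qarr (qName 3 S T) (.const 0)) fun S T => le_rfl
  simp only [pathExtend, nextE, adjE, Expr.mem, Expr.or, Stmt.height, Expr.height, sc]
  omega

theorem height_path {A : Finset (Fin k)} : (path H A).height ≤ 5 * k + 50 := by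
  have h1 := height_pathInit (A := A)
  have h2 := height_pathExtend (H := H) (A := A)
  simp only [path, nextE, adjE, Expr.mem, Expr.or, Stmt.height, Expr.height, sc]
  omega

/-- The `2 * k` nested suprema over the witnesses account for `2 * k`; the remaining multiple of `k`
comes from enumerating color sets and colors. -/
theorem height_witnessE {A : Finset (Fin k)} : (witnessE H A).height ≤ 5 * k + 50 := by
  have h1 : ∀ c : Fin k, (allowedE H c).height ≤ k + 20 := fun c => by
    have := Expr.height_allCol (l := List.finRange k) (m := 15) (g := fun d => .or (.ofProp (H.Adj c d))
      (.and (.imp (.mem 5 (wit₁ d)) (.not (adjE (wit₁ d) (.reg 6))))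
        (.imp (.mem 5 (wit₂ d)) (.not (adjE (wit₂ d) (.reg 6)))))) fun d => by
        simp only [Expr.height, Expr.imp, Expr.or, Expr.ofProp, adjE, Expr.mem, wit₁, wit₂]
        decide
    simp only [List.length_finRange] at this
    simp only [allowedE, Expr.or, Expr.mem, wit₁, wit₂, Expr.height] at this ⊢
    omega
  have h2 : (consistentE k).height ≤ k + 20 := by
    have := Expr.height_allCol (l := List.finRange k) (m := 15)
      (g := fun c => .imp (.and (.mem 5 (wit₁ c)) (.mem 5 (wit₂ c)))
    (.and (.not (.eq (wit₁ c) (wit₂ c))) (.not (adjE (wit₁ c) (wit₂ c))))) fun d => by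
        simp only [Expr.height, Expr.imp, adjE, Expr.mem, wit₁, wit₂]
        decide
    simp only [List.length_finRange] at this
    exact this.trans (by omega)
  have h3 : (vertexE H A).height ≤ k + (2 * k + 40) := by
    have := Expr.height_maxSub (l := List.finRange k) (m := 2 * k + 40) (f := fun S =>
      .qite (.and (.ofProp (S ⊆ A))
    (.allCol (List.finRange k) fun c => .or (.ofProp (c ∉ S)) (allowedE H c)))
    (.qarr (qName 0 S ∅) (.reg 6)) .qzero) fun S => by
      have := Expr.height_allCol (l := List.finRange k) (m := k + 25)
        (g := fun c => .or (.ofProp (c ∉ S)) (allowedE H c)) fun c => by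
        have := h1 c
        simp only [Expr.height, Expr.or, Expr.ofProp]
        omega
      simp only [List.length_finRange] at this
      simp only [Expr.height, height_ofProp]
      omega
    rw [List.length_finRange] at this
    exact this
  rw [witnessE, Expr.height_supNest, List.length_map, List.length_range]
  simp only [Expr.height, Expr.mem]
  omega

theorem height_moduleValues : (moduleValues H).height ≤ 6 * k + 60 := by
  have h1 := Stmt.height_seqSub (l := List.finRange k) fun A : Finset (Fin k) =>
    height_path (H := H) (A := A)
  have h2 := Stmt.height_seqSub (l := List.finRange k) (m := 5 * k + 53)
    (f := fun A => .setQ (qName 1 A ∅) (.const 0) (witnessE H A)) fun A => by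
      have := height_witnessE (H := H) (A := A)
      simp only [Stmt.height, Expr.height]
      omega
  have h3 : coDiamondE.height ≤ 30 := by decide
  simp only [List.length_finRange] at h1 h2
  simp only [moduleValues, Stmt.height]
  omega

theorem height_contract : (contract H).height ≤ 6 * k + 70 := by
  have h1 := height_moduleValues (H := H)
  have h2 := Stmt.height_seqSub (l := List.finRange k) (m := 2) (f := fun A : Finset (Fin k) =>
    .setQ (qName 0 A ∅) (sc 12) (.qarr (qName 1 A ∅) (.const 0))) fun A => le_rfl
  have h3 : minModule.height ≤ 50 := by decide
  simp only [List.length_finRange] at h2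
  simp only [contract, Stmt.height, Stmt.fill, Expr.height, Expr.mem, Expr.or, height_sc]
  omega

theorem height_initTables : (initTables k).height ≤ 2 * k + 20 := by
  have h := Stmt.height_seqSub (l := List.finRange k) (m := k + 10) (f := fun S : Finset (Fin k) =>
    .setQ (qName 0 S ∅) (.reg 5) (.maxCol (List.finRange k) S fun c => revE c (.reg 5)))
    fun S => by
      have := Expr.height_maxCol (l := List.finRange k) (S := S) (m := 3)
        (g := fun c => revE c (.reg 5)) fun c => le_rfl
      simp only [List.length_finRange] at this
      simp only [Stmt.height, Expr.height]
      omega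
  simp only [List.length_finRange] at h
  simp only [initTables, Stmt.height]
  omega

theorem height_solve : (solve H).height ≤ 6 * k + 80 := by
  have h1 := height_contract (H := H)
  have h2 := height_initTables (k := k)
  simp only [solve, Stmt.height, Stmt.fill, Expr.height, Expr.mem]
  omega

theorem height_tryZero {c : Fin k} : (tryZero H c).height ≤ 6 * k + 90 := by
  have h1 := height_solve (H := H)
  simp only [tryZero, Stmt.height, revE, Expr.height]
  omega

theorem height_output : (output k).height ≤ k + 20 := by
  have h := Stmt.height_seqCol (l := List.finRange k) (m := 10) (p := fun c =>
    .ite (.qlt .qzero (revE c (.reg 0))) (.setA 1 (.reg 0) (.const (c + 1))) .skip) fun c => by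
      simp only [Stmt.height, revE, Expr.height]
      decide
  simp only [List.length_finRange] at h
  simp only [output, Stmt.height, Expr.height]
  omega

theorem height_main : (main H).height ≤ 7 * k + 100 := by
  have h1 := height_solve (H := H)
  have h2 := Stmt.height_seqCol (l := List.finRange k) fun c => height_tryZero (H := H) (c := c)
  have h3 := height_output (k := k)
  simp only [List.length_finRange] at h2
  simp only [main, multiples, Stmt.height, Expr.height]
  omega

end

end Prog

/-! ### From the verified program to the machine, and the final time bound -/

theorem Program.haltsWithin_of_run {P : Program} {m : Memory} {T : ℕ} {Q : Memory → Prop}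
    (h : Run P P.main m T Q) : ∃ m', P.HaltsWithin m T m' ∧ Q m' := by
  obtain ⟨t, ht, m', h1, h2⟩ := h
  refine ⟨m', ?_, h2⟩
  obtain ⟨d, rfl⟩ := Nat.exists_eq_add_of_le' ht
  rw [HaltsWithin, Function.iterate_add_apply, h1 []]
  -- A halted configuration is a fixed point, so running for the full time bound changes nothing.
  exact Function.iterate_fixed rfl d

section Input

variable {n k : ℕ} (G : SimpleGraph (Fin n)) (rev : Fin n → Fin k → NNRat)

theorem inputMemory_arr_eq_one {u v : ℕ} (hu : u < n) (hv : v < n) :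
    (inputMemory G rev).arr 0 (n * u + v) = 1 ↔ (natGraph G).Adj u v := by
  simp only [inputMemory]
  rw [natGraph_adj]
  constructor
  · intro h
    split_ifs at h with h'
    obtain ⟨-, a, b, hab, he⟩ := h'
    have e1 : u = a := by
      have := congrArg (· / n) he
      simpa [Nat.mul_add_div (by omega : 0 < n), Nat.div_eq_of_lt hv, Nat.div_eq_of_lt b.2] using this
    have e2 : v = b := by
      subst e1
      omega
    subst e1 e2
    exact ⟨hu, hv, hab⟩
  · rintro ⟨h1, h2, h⟩
    exact if_pos ⟨rfl, _, _, h, rfl⟩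

theorem revOf_inputMemory : Prog.revOf k (inputMemory G rev).qarr = natRev rev := by
  funext c v
  have key : ∀ (a : Fin n) (b : Fin k), k * v + c = k * a + b ↔ v = a ∧ c = b := by
    intro a b
    constructor
    · intro he
      have hk : 0 < k := c.pos
      have e1 : v = a := by
        have := congrArg (· / k) he
        simpa [Nat.mul_add_div hk, Nat.div_eq_of_lt c.2, Nat.div_eq_of_lt b.2] using this
      refine ⟨e1, Fin.ext ?_⟩
      rw [e1] at he
      omega
    · rintro ⟨h1, rfl⟩
      rw [h1]
  simp only [Prog.revOf, inputMemory, if_true, natRev, key]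
  split_ifs with h
  · rw [Finset.sum_eq_single ⟨v, h⟩ (fun a _ ha => ?_) (by simp)]
    · simp
    · refine Finset.sum_eq_zero fun j _ => if_neg fun e => ha (Fin.ext e.1.symm)
  · refine Finset.sum_eq_zero fun a _ => Finset.sum_eq_zero fun j _ => if_neg fun e => h ?_
    rw [e.1]
    exact a.2

end Input

theorem solvesWithin_main {n k : ℕ} (H : SimpleGraph (Fin k)) (G : SimpleGraph (Fin n))
    (rev : Fin n → Fin k → NNRat) (hbull : InducedFree bull G) (hchair : InducedFree chair G) {T : ℕ}
    (hT : (Prog.main H).cost n ≤ T) :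
    (⟨(Prog.main H).comp 0, []⟩ : Program).SolvesWithin H G rev T := by
  -- The input memory represents this store directly: its only nonzero register is register `0`,
  -- reserved for the length.
  set s : Store := ⟨0, (inputMemory G rev).arr, (inputMemory G rev).qarr⟩
  obtain ⟨m', h1, h2, -⟩ := Program.haltsWithin_of_run (P := ⟨(Prog.main H).comp 0, []⟩)
    (((Prog.main H).run_comp _ n 0 s (inputMemory G rev)
      ⟨rfl, fun _ => rfl, rfl, rfl⟩).mono hT fun _ h => h)
  have hrev : Prog.revOf k s.qarr = natRev rev := revOf_inputMemory G rev
  obtain ⟨w, q, hw, ho⟩ := Prog.den_main (H := H) (s := s) (Γ := natGraph G)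
    (fun u hu v hv => inputMemory_arr_eq_one G rev hu hv)
    (fun u v h => (natGraph_adj.1 h).1) (chairFree_of_inducedFree hchair)
    (bullFree_of_inducedFree hbull) (by rw [hrev]; exact natRev_nonneg rev)
  rw [hrev] at hw
  obtain ⟨S, hS, hX, hc⟩ := hw.exists_solution fun v hv _ => hv
  refine ⟨m', S, h1, fun v => ?_, hS⟩
  rw [h2.arr]
  rcases ho v v.2 with ⟨h0, hn⟩ | ⟨c, hwc, h0⟩
  · rw [h0, dif_neg fun hv => hn _ (hX v hv)]
  · obtain ⟨hv, rfl⟩ := hc v c hwc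
    rw [h0, dif_pos hv]

/-- Without colors the required bound degenerates to `n ^ 0 = 1` step. The untouched input memory
already encodes the empty solution, the only one. -/
theorem solvesWithin_skip {n : ℕ} (H : SimpleGraph (Fin 0)) (G : SimpleGraph (Fin n))
    (rev : Fin n → Fin 0 → NNRat) : (⟨.skip, []⟩ : Program).SolvesWithin H G rev 1 := by
  refine ⟨inputMemory G rev, ⟨∅, fun v => absurd v.2 (by simp), fun {v} => absurd v.2 (by simp)⟩,
    rfl, fun v => by simp [inputMemory], fun S => ?_⟩
  have : S.X = ∅ := Finset.eq_empty_of_forall_notMem fun v hv => (S.c ⟨v, hv⟩).elim0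
  have : IsEmpty S.X := by
    rw [this]
    exact Finset.isEmpty_coe_sort.2 rfl
  simp [Solution.revenue]

/-- The only fact needed about the clique number: the time bound holds without it, and multiplying
the exponent by it does no harm. -/
theorem one_le_cliqueNum {n : ℕ} (G : SimpleGraph (Fin n)) (hn : 0 < n) : 1 ≤ G.cliqueNum := by
  have : G.IsClique (({⟨0, hn⟩} : Finset (Fin n)) : Set (Fin n)) := by simp
  simpa using this.card_le_cliqueNum

/-- For `2 ≤ n` the base `64 * (n + 2)` is at most `2 ^ 7 * n ≤ n ^ 8`. For `1 ≤ k` the depth `7 * k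
+ 100` is at most `107 * k`, and `8 * 107 = 856`. -/
theorem cost_main_le {n k w : ℕ} (H : SimpleGraph (Fin k)) (hn : 2 ≤ n) (hk : 1 ≤ k) (hw : 1 ≤ w) :
    (Prog.main H).cost n ≤ n ^ (856 * k * w) := by
  have h1 : 64 * (n + 2) ≤ n ^ 8 := by
    calc 64 * (n + 2) ≤ 2 ^ 7 * n := by omega
      _ ≤ n ^ 7 * n := Nat.mul_le_mul_right _ (Nat.pow_le_pow_left hn 7)
      _ = n ^ 8 := (pow_succ n 7).symm
  calc (Prog.main H).cost n ≤ (64 * (n + 2)) ^ (Prog.main H).height := Stmt.cost_le _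
    _ ≤ (n ^ 8) ^ (Prog.main H).height := Nat.pow_le_pow_left h1 _
    _ = n ^ (8 * (Prog.main H).height) := (pow_mul _ _ _).symm
    _ ≤ n ^ (856 * k * w) := by
      refine Nat.pow_le_pow_right (by omega) ?_
      have := Prog.height_main (H := H)
      calc 8 * (Prog.main H).height ≤ 856 * k := by omega
        _ ≤ 856 * k * w := Nat.le_mul_of_pos_right _ hw

end HColoring

theorem mainTheorem7 :
    ∃ τ : ℕ, ∀ (k : ℕ) (H : SimpleGraph (Fin k)),
      ∃ (P : HColoring.Program) (C : ℕ),
        ∀ (n : ℕ) (G : SimpleGraph (Fin n)) (rev : Fin n → Fin k → NNRat),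
          HColoring.InducedFree HColoring.bull G →
          HColoring.InducedFree HColoring.chair G →
          (n ≤ 1 → P.SolvesWithin H G rev C) ∧
          (2 ≤ n → P.SolvesWithin H G rev (n ^ (τ * k * G.cliqueNum))) := by
  open HColoring in
  refine ⟨856, fun k H => ?_⟩
  rcases k.eq_zero_or_pos with rfl | hk
  · refine ⟨⟨.skip, []⟩, 1, fun n G rev _ _ => ⟨fun _ => solvesWithin_skip H G rev, fun _ => ?_⟩⟩
    rw [mul_zero, zero_mul, pow_zero]
    exact solvesWithin_skip H G rev
  -- For `n ≤ 1` powers of `n` bound nothing useful, so the constant covers the two sizes `0` and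
  -- `1` directly.
  · refine ⟨⟨(Prog.main H).comp 0, []⟩, (Prog.main H).cost 0 + (Prog.main H).cost 1,
      fun n G rev hb hc => ⟨fun hn => solvesWithin_main H G rev hb hc ?_,
        fun hn => solvesWithin_main H G rev hb hc ?_⟩⟩
    · interval_cases n <;> omega
    · exact cost_main_le H hn hk (one_le_cliqueNum G (by omega))
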